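/- Let $\Gamma\subseteq\mathbb{R}$ be a subgroup containing $\mathbb{Z}$ and let $V$ be a $\Gamma/\mathbb{Z}$-graded vertex (super)algebra over $\mathbb{C}$ with vacuum $|0\rangle$, products $a_{(n)}b$ ($n\in\mathbb{Z}$), translation operator $Ta=a_{(-2)}|0\rangle$, and an energy operator $H$, that is, a parity-preserving, degree-preserving operator, diagonalizable with real eigenvalues, such that $[H,Y(a,z)]=z\partial_zY(a,z)+Y(Ha,z)$. For $a\in V$ of degree $[\alpha]\in\Gamma/\mathbb{Z}$ and with $Ha=\Delta_a a$, put $[\epsilon_a]=[\alpha-\Delta_a]\in\mathbb{R}/\mathbb{Z}$, let $\epsilon_a\in(-1,0]$ be the representative of $[\epsilon_a]$ in this interval, and put $\gamma_a=\Delta_a+\epsilon_a$. Put $\chi(a,b)=1$ if $\epsilon_a+\epsilon_b\le-1$ and $\chi(a,b)=0$ otherwise. Let $V_\Gamma$ be the span of the homogeneous $a$ with $[\epsilon_a]=[0]$, and let $V_{\Gamma,\hbar}=\mathbb{C}[\hbar,\hbar^{-1}]\otimes_{\mathbb{C}}V_\Gamma$. For an integer $p\ge0$ put $$a_{[n,p]}b=\sum_{j\ge0}\binom{\gamma_a+p}{j}\hbar^j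 a_{(n+j)}b,\qquad a*_pb=\sum_{m=0}^p\binom{-p-1}{m}\hbar^{-p-m}a_{[-p-1-m,p]}b\quad(a,b\in V_\Gamma),$$ extended linearly (so that $*_p$ is a $\mathbb{C}[\hbar,\hbar^{-1}]$-bilinear product on $V_{\Gamma,\hbar}$), and $$J_p=\mathbb{C}[\hbar,\hbar^{-1}]\{(T+\hbar H)a\mid a\in V_\Gamma\}+\mathbb{C}[\hbar,\hbar^{-1}]\{a_{[-2p-2+\chi(a,b),\,p]}b\mid a,b\in V\text{ homogeneous},\ [\epsilon_a]+[\epsilon_b]=[0]\}\subseteq V_{\Gamma,\hbar}.$$ Then: 1. For every $p\ge1$, $J_p\subseteq J_{p-1}$, and $x*_py-x*_{p-1}y\in J_{p-1}$ for all $x,y\in V_{\Gamma,\hbar}$. 2. For every $p\ge0$, $J_p$ is a two-sided ideal of $(V_{\Gamma,\hbar},*_p)$ and the quotient $\mathrm{Zhu}_{p,\Gamma,\hbar}(V)=V_{\Gamma,\hbar}/J_p$, with the product induced by $*_p$, is an associative $\mathbb{C}[\hbar,\hbar^{-1}]$-(super)algebra (possibly zero) whose unit is the image of $|0\rangle$ and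 whose even and odd parts are the images of those of $V_{\Gamma,\hbar}$. 3. For all $p\ge q\ge0$ the identity map of $V_{\Gamma,\hbar}$ induces a surjective (parity-preserving, unital) homomorphism of associative $\mathbb{C}[\hbar,\hbar^{-1}]$-algebras $\phi_{p,q}:\mathrm{Zhu}_{p,\Gamma,\hbar}(V)\twoheadrightarrow\mathrm{Zhu}_{q,\Gamma,\hbar}(V)$; in particular, for every $p\ge1$, there is a surjection $\phi_p=\phi_{p,p-1}:\mathrm{Zhu}_{p,\Gamma,\hbar}(V)\twoheadrightarrow\mathrm{Zhu}_{p-1,\Gamma,\hbar}(V)$. One has $\phi_{p,p}=\mathrm{id}$ and $\phi_{q,r}\circ\phi_{p,q}=\phi_{p,r}$ for $p\ge q\ge r$, so that the algebras $\mathrm{Zhu}_{p,\Gamma,\hbar}(V)$ form an inverse system. -/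

import Mathlib

open scoped TensorProduct LaurentPolynomial

noncomputable section

/-- The sign `p(a, b) = (-1)^{p(a) p(b)}` of a pair of parities. -/
def koszulSign (i j : ZMod 2) : ℂ := (-1) ^ (i.val * j.val)

/-- A (super) vertex algebra over `ℂ`. The state-field correspondence is
`a ↦ Y(a, z) = ∑ a_(n) z^{-n-1}`, where `a_(n) b` is `VertexOperator.ncoeff (Y a) n b`. The Borcherds
identity is written in coefficients; all its sums over `j` have finite support. -/
structure VertexAlgebra (V : Type*) [AddCommGroup V] [Module ℂ V] where
  parity : ZMod 2 → Submodule ℂ V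
  parity_isInternal : DirectSum.IsInternal parity
  vac : V
  vac_ne_zero : vac ≠ 0
  vac_even : vac ∈ parity 0
  Y : V →ₗ[ℂ] VertexOperator ℂ V
  Y_injective : Function.Injective Y
  Y_parity : ∀ (i j : ZMod 2) (n : ℤ) (a b : V), a ∈ parity i → b ∈ parity j →
    VertexOperator.ncoeff (Y a) n b ∈ parity (i + j)
  Y_vac : ∀ (n : ℤ) (b : V), VertexOperator.ncoeff (Y vac) n b = if n = -1 then b else 0
  borcherds : ∀ (i i' : ZMod 2) (a b c : V), a ∈ parity i → b ∈ parity i' → ∀ m k n : ℤ,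
    ∑ᶠ j : ℕ, Ring.choose m j •
      VertexOperator.ncoeff (Y (VertexOperator.ncoeff (Y a) (n + j) b)) (m + k - j) c =
    ∑ᶠ j : ℕ, ((-1) ^ j * Ring.choose n j : ℤ) •
      (VertexOperator.ncoeff (Y a) (m + n - j) (VertexOperator.ncoeff (Y b) (k + j) c) -
        (koszulSign i i' * (-1 : ℂ) ^ n) •
          VertexOperator.ncoeff (Y b) (k + n - j) (VertexOperator.ncoeff (Y a) (m + j) c))

namespace VertexAlgebra

variable {V : Type*} [AddCommGroup V] [Module ℂ V] (A : VertexAlgebra V)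

/-- The `n`-th product `a_(n) b`. -/
def nprod (n : ℤ) (a b : V) : V := VertexOperator.ncoeff (A.Y a) n b

/-- The translation operator `T a = a_(-2) |0⟩`. -/
def T (a : V) : V := A.nprod (-2) a A.vac

end VertexAlgebra

/-- The group `Γ/ℤ`, for a subgroup `Γ` of `ℝ` (containing `ℤ`). -/
abbrev ModInt (Γ : AddSubgroup ℝ) : Type :=
  Γ ⧸ (AddSubgroup.zmultiples (1 : ℝ)).addSubgroupOf Γ

/-- A `Γ/ℤ`-graded vertex (super)algebra with an energy operator `H`. The degree components
`deg [α]` are sub-superspaces whose direct sum is `V`, and `H` is a parity-preserving operator that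
is diagonalizable with real eigenvalues, preserves each `deg [α]`, and satisfies
`[H, Y(a, z)] = z ∂_z Y(a, z) + Y(H a, z)`. -/
structure GradedVertexAlgebra (Γ : AddSubgroup ℝ) (V : Type*) [AddCommGroup V] [Module ℂ V]
    extends VertexAlgebra V where
  deg : ModInt Γ → Submodule ℂ V
  deg_iSupIndep : iSupIndep deg
  deg_iSup : ⨆ g, deg g = ⊤
  deg_parity : ∀ g, deg g = (deg g ⊓ parity 0) ⊔ (deg g ⊓ parity 1)
  vac_deg : vac ∈ deg 0
  Y_deg : ∀ (g h : ModInt Γ) (n : ℤ) (a b : V), a ∈ deg g → b ∈ deg h →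
    VertexOperator.ncoeff (Y a) n b ∈ deg (g + h)
  H : Module.End ℂ V
  H_diagonalizable : ⨆ Δ : ℝ, Module.End.eigenspace H (Δ : ℂ) = ⊤
  H_parity : ∀ (i : ZMod 2) (a : V), a ∈ parity i → H a ∈ parity i
  H_deg : ∀ (g : ModInt Γ) (a : V), a ∈ deg g → H a ∈ deg g
  H_comm : ∀ (n : ℤ) (a b : V),
    H (VertexOperator.ncoeff (Y a) n b) - VertexOperator.ncoeff (Y a) n (H b) =
      ((-n - 1 : ℤ) : ℂ) • VertexOperator.ncoeff (Y a) n b + VertexOperator.ncoeff (Y (H a)) n b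

/-- The largest non-positive element of the coset `x + ℤ`. -/
def epsReal (x : ℝ) : ℝ := x - ⌈x⌉

namespace GradedVertexAlgebra

variable {Γ : AddSubgroup ℝ} {V : Type*} [AddCommGroup V] [Module ℂ V]
  (A : GradedVertexAlgebra Γ V)

/-- `V^{[α]}[Δ]`: the elements of degree `[α]` and conformal weight `Δ`. -/
def piece (α : Γ) (Δ : ℝ) : Submodule ℂ V :=
  A.deg (α : ModInt Γ) ⊓ Module.End.eigenspace A.H (Δ : ℂ)

/-- `V_Γ = {a | [ε_a] = [0]}`, where `[ε_a] = [α - Δ]` for `a` in `V^{[α]}[Δ]`. -/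
def VGamma : Submodule ℂ V :=
  ⨆ (α : Γ) (Δ : ℝ) (_ : (α : ℝ) - Δ ∈ AddSubgroup.zmultiples (1 : ℝ)), A.piece α Δ

lemma nprod_mem_piece {α β : Γ} {Δ Δ' : ℝ} {a b : V} (ha : a ∈ A.piece α Δ)
    (hb : b ∈ A.piece β Δ') (n : ℤ) :
    A.nprod n a b ∈ A.piece (α + β) (Δ + Δ' - n - 1) := by
  refine ⟨A.Y_deg _ _ n a b ha.1 hb.1, ?_⟩
  have h1 := Module.End.mem_eigenspace_iff.1 ha.2
  have h2 := Module.End.mem_eigenspace_iff.1 hb.2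
  have h := A.H_comm n a b
  rw [h1, h2] at h
  refine Module.End.mem_eigenspace_iff.2 ?_
  simp only [VertexAlgebra.nprod]
  rw [sub_eq_iff_eq_add] at h
  rw [h]
  simp only [map_smul, Pi.smul_apply, LinearMap.smul_apply, ← add_smul]
  congr 1
  push_cast
  ring

lemma nprod_mem {α β : Γ} {Δ Δ' : ℝ} {a b : V} (ha : a ∈ A.piece α Δ) (hb : b ∈ A.piece β Δ')
    (h : ((α : ℝ) - Δ) + (β - Δ') ∈ AddSubgroup.zmultiples (1 : ℝ)) (n : ℤ) :
    A.nprod n a b ∈ A.VGamma := by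
  have h' : (((α + β : Γ) : ℝ) - (Δ + Δ' - n - 1)) ∈ AddSubgroup.zmultiples (1 : ℝ) := by
    obtain ⟨k, hk⟩ := AddSubgroup.mem_zmultiples_iff.1 h
    refine AddSubgroup.mem_zmultiples_iff.2 ⟨k + n + 1, ?_⟩
    simp only [zsmul_eq_mul, mul_one] at hk ⊢
    push_cast
    linarith
  exact Submodule.mem_iSup_of_mem _ (Submodule.mem_iSup_of_mem _
    (Submodule.mem_iSup_of_mem h' (A.nprod_mem_piece ha hb n)))

lemma VGamma_induction {P : V → Prop} {a : V} (ha : a ∈ A.VGamma)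
    (hp : ∀ (α : Γ) (Δ : ℝ), (α : ℝ) - Δ ∈ AddSubgroup.zmultiples (1 : ℝ) →
      ∀ x ∈ A.piece α Δ, P x) (h0 : P 0) (hadd : ∀ x y, P x → P y → P (x + y)) : P a := by
  refine Submodule.iSup_induction _ (motive := P) ha (fun α x hx => ?_) h0 hadd
  refine Submodule.iSup_induction _ (motive := P) hx (fun Δ y hy => ?_) h0 hadd
  refine Submodule.iSup_induction _ (motive := P) hy (fun h z hz => hp α Δ h z hz) h0 hadd

lemma nprod_mem_VGamma {a b : V} (ha : a ∈ A.VGamma) (hb : b ∈ A.VGamma) (n : ℤ) :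
    A.nprod n a b ∈ A.VGamma := by
  refine A.VGamma_induction (P := fun x => A.nprod n x b ∈ A.VGamma) ha ?_ ?_ ?_
  · intro α Δ h x hx
    refine A.VGamma_induction (P := fun y => A.nprod n x y ∈ A.VGamma) hb ?_ ?_ ?_
    · intro β Δ' h' y hy
      exact A.nprod_mem hx hy (add_mem h h') n
    · simp [VertexAlgebra.nprod]
    · intro y z hy hz
      simpa [VertexAlgebra.nprod] using add_mem hy hz
  · simp [VertexAlgebra.nprod]
  · intro y z hy hz
    simpa [VertexAlgebra.nprod] using add_mem hy hz

lemma H_vac : A.H A.vac = 0 := by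
  apply A.Y_injective
  rw [map_zero]
  apply HVertexOperator.coeff_inj
  funext m
  ext b
  have h := A.H_comm (-m - 1) A.vac b
  simp only [A.Y_vac] at h
  have h2 : VertexOperator.ncoeff (A.Y (A.H A.vac)) (-m - 1) b = 0 := by
    by_cases hm : m = 0
    · subst hm; simpa using h.symm
    · have : ¬ (-m - 1 = -1) := by omega
      simpa [this] using h.symm
  rw [VertexOperator.coeff_eq_ncoeff, h2]
  simp

lemma vac_mem_VGamma : A.vac ∈ A.VGamma := by
  refine Submodule.mem_iSup_of_mem 0 (Submodule.mem_iSup_of_mem 0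
    (Submodule.mem_iSup_of_mem (by simp) ⟨A.vac_deg, ?_⟩))
  refine Module.End.mem_eigenspace_iff.2 ?_
  rw [A.H_vac]
  simp

lemma T_mem_VGamma {a : V} (ha : a ∈ A.VGamma) : A.T a ∈ A.VGamma :=
  A.nprod_mem_VGamma ha A.vac_mem_VGamma (-2)

lemma H_mem_VGamma : ∀ a ∈ A.VGamma, A.H a ∈ A.VGamma := by
  intro a ha
  refine A.VGamma_induction (P := fun x => A.H x ∈ A.VGamma) ha ?_ ?_ ?_
  · intro α Δ h x hx
    rw [Module.End.mem_eigenspace_iff.1 hx.2]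
    exact Submodule.smul_mem _ _ (Submodule.mem_iSup_of_mem _ (Submodule.mem_iSup_of_mem _
      (Submodule.mem_iSup_of_mem h hx)))
  · simp
  · intro x y hx hy
    simpa using add_mem hx hy

/-- The restriction of the energy operator to `V_Γ`. -/
def HGamma : Module.End ℂ A.VGamma := A.H.restrict A.H_mem_VGamma

lemma HGamma_isInternal :
    DirectSum.IsInternal (fun Δ : ℝ => Module.End.eigenspace A.HGamma (Δ : ℂ)) := by
  refine DirectSum.isInternal_submodule_of_iSupIndep_of_iSup_eq_top
    ((Module.End.eigenspaces_iSupIndep A.HGamma).comp Complex.ofReal_injective) ?_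
  rw [eq_top_iff]
  rintro ⟨a, ha⟩ -
  have key : ∃ x ∈ ⨆ Δ : ℝ, Module.End.eigenspace A.HGamma (Δ : ℂ), (x : V) = a := by
    refine A.VGamma_induction (P := fun a => ∃ x ∈ ⨆ Δ : ℝ,
      Module.End.eigenspace A.HGamma (Δ : ℂ), (x : V) = a) ha ?_ ⟨0, zero_mem _, rfl⟩ ?_
    · intro α Δ h x hx
      refine ⟨⟨x, Submodule.mem_iSup_of_mem _ (Submodule.mem_iSup_of_mem _
        (Submodule.mem_iSup_of_mem h hx))⟩, Submodule.mem_iSup_of_mem Δ ?_, rfl⟩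
      rw [Module.End.mem_eigenspace_iff]
      exact Subtype.ext (Module.End.mem_eigenspace_iff.1 hx.2)
    · rintro _ _ ⟨x, hx, rfl⟩ ⟨y, hy, rfl⟩
      exact ⟨x + y, add_mem hx hy, rfl⟩
  obtain ⟨x, hx, hxa⟩ := key
  exact (Subtype.ext hxa : x = ⟨a, ha⟩) ▸ hx

/-- `V_{Γ,ħ} = ℂ[ħ, ħ⁻¹] ⊗ V_Γ`. The variable `ħ` is `LaurentPolynomial.T 1`. -/
abbrev VGammaH : Type _ := ℂ[T;T⁻¹] ⊗[ℂ] A.VGamma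

/-- For a sequence `c m = a_(m) b` of products, the modified product
`a_{[n, p]} b = ∑_{j ≥ 0} binom(γ + p, j) ħ^j a_(n+j) b`, where `γ = γ_a`.
The sum is finite, since `a_(m) b = 0` for `m` large. -/
def modProd (p : ℕ) (γ : ℝ) (n : ℤ) (c : ℤ → A.VGamma) : A.VGammaH :=
  ∑ᶠ j : ℕ, (LaurentPolynomial.C (Ring.choose ((γ + p : ℝ) : ℂ) j) * LaurentPolynomial.T (j : ℤ))
    ⊗ₜ[ℂ] c (n + j)

/-- The set `{(T + ħ H) a | a ∈ V_Γ}`. -/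
def derivGens : Set A.VGammaH :=
  {x | ∃ (a : V) (ha : a ∈ A.VGamma),
    x = 1 ⊗ₜ[ℂ] ⟨A.T a, A.T_mem_VGamma ha⟩ +
      LaurentPolynomial.T 1 ⊗ₜ[ℂ] ⟨A.H a, A.H_mem_VGamma a ha⟩}

/-- `χ(a, b)` in terms of representatives `x` of `[ε_a]` and `y` of `[ε_b]`. -/
def chi (x y : ℝ) : ℤ := if epsReal x + epsReal y ≤ -1 then 1 else 0

/-- The set `{a_{[-2p-2+χ(a,b), p]} b | [ε_a] + [ε_b] = [0]}`, with `a` and `b` homogeneous for the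
degree and the conformal weight; here `ε_a = epsReal (α - Δ)` and `γ_a = Δ + ε_a`. -/
def prodGens (p : ℕ) : Set A.VGammaH :=
  {x | ∃ (α β : Γ) (Δ Δ' : ℝ) (a b : V) (ha : a ∈ A.piece α Δ) (hb : b ∈ A.piece β Δ')
    (h : ((α : ℝ) - Δ) + (β - Δ') ∈ AddSubgroup.zmultiples (1 : ℝ)),
    x = A.modProd p (Δ + epsReal (α - Δ)) (-2 * p - 2 + chi (α - Δ) (β - Δ'))
      (fun m => ⟨A.nprod m a b, A.nprod_mem ha hb h m⟩)}

/-- The subspace `J_{p,Γ,ħ}` of `V_{Γ,ħ}`. -/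
def J (p : ℕ) : Submodule ℂ[T;T⁻¹] A.VGammaH :=
  Submodule.span _ A.derivGens ⊔ Submodule.span _ (A.prodGens p)

lemma nprod_eventually_zero (a b : V) : ∃ N : ℤ, ∀ n, N ≤ n → A.nprod n a b = 0 := by
  refine ⟨-(HahnSeries.order ((HahnModule.of ℂ).symm (A.Y a b))), fun n hn => ?_⟩
  exact VertexOperator.ncoeff_eq_zero_of_lt_order _ _ _ (by omega)

lemma modProd_support_finite (p : ℕ) (γ : ℝ) (n : ℤ) (c : ℤ → A.VGamma)
    (hc : ∃ N : ℤ, ∀ m, N ≤ m → c m = 0) :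
    (Function.support fun j : ℕ =>
      (LaurentPolynomial.C (Ring.choose ((γ + p : ℝ) : ℂ) j) * LaurentPolynomial.T (j : ℤ))
        ⊗ₜ[ℂ] c (n + j)).Finite := by
  obtain ⟨N, hN⟩ := hc
  refine (Set.finite_lt_nat (N - n).toNat).subset fun j hj => ?_
  by_contra hlt
  simp only [Set.mem_ofPred_eq, not_lt] at hlt
  exact hj (by simp [hN (n + j) (by omega)])

/-- The bilinear map `(a, b) ↦ ∑_{j ≥ 0} binom(γ + p, j) ħ^j a_(n+j) b` on `V_Γ`, for fixed `γ`. -/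
def modProdHom (p : ℕ) (γ : ℝ) (n : ℤ) : A.VGamma →ₗ[ℂ] A.VGamma →ₗ[ℂ] A.VGammaH :=
  have hfin (a b : A.VGamma) := A.modProd_support_finite p γ n
    (fun m => ⟨A.nprod m a b, A.nprod_mem_VGamma a.2 b.2 m⟩) (by
      obtain ⟨N, hN⟩ := A.nprod_eventually_zero (a : V) b
      exact ⟨N, fun m hm => Subtype.ext (hN m hm)⟩)
  LinearMap.mk₂ ℂ
    (fun a b => A.modProd p γ n (fun m => ⟨A.nprod m a b, A.nprod_mem_VGamma a.2 b.2 m⟩))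
    (fun a a' b => by
      rw [modProd, modProd, modProd, ← finsum_add_distrib (hfin a b) (hfin a' b)]
      refine finsum_congr fun j => ?_
      rw [← TensorProduct.tmul_add]
      congr 1
      exact Subtype.ext (by simp [VertexAlgebra.nprod]))
    (fun r a b => by
      rw [modProd, modProd, smul_finsum' _ (hfin a b)]
      refine finsum_congr fun j => ?_
      rw [← TensorProduct.tmul_smul]
      congr 1
      exact Subtype.ext (by simp [VertexAlgebra.nprod]))
    (fun a b b' => by
      rw [modProd, modProd, modProd, ← finsum_add_distrib (hfin a b) (hfin a b')]
      refine finsum_congr fun j => ?_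
      rw [← TensorProduct.tmul_add]
      congr 1
      exact Subtype.ext (by simp [VertexAlgebra.nprod]))
    (fun r a b => by
      rw [modProd, modProd, smul_finsum' _ (hfin a b)]
      refine finsum_congr fun j => ?_
      rw [← TensorProduct.tmul_smul]
      congr 1
      exact Subtype.ext (by simp [VertexAlgebra.nprod]))

/-- The expression `∑_{m=0}^p binom(-p-1, m) ħ^{-p-m} a_{[-p-1-m, p]} b` for `a`, `b` in `V_Γ`,
computed with a fixed value `γ` in place of `γ_a`. -/
def starAux (p : ℕ) (γ : ℝ) : A.VGamma →ₗ[ℂ] A.VGamma →ₗ[ℂ] A.VGammaH :=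
  ∑ m ∈ Finset.range (p + 1), Ring.choose (-p - 1 : ℤ) m •
    (A.modProdHom p γ (-p - 1 - m)).compr₂
      ((LinearMap.lsmul ℂ[T;T⁻¹] A.VGammaH (LaurentPolynomial.T (-p - m : ℤ))).restrictScalars ℂ)

lemma HGamma_bijective : Function.Bijective (DirectSum.coeLinearMap
    (fun Δ : ℝ => Module.End.eigenspace A.HGamma (Δ : ℂ))) := A.HGamma_isInternal

/-- The decomposition of `V_Γ` into the components of given conformal weight. -/
def weightDecomp : A.VGamma ≃ₗ[ℂ]
    DirectSum ℝ (fun Δ : ℝ => Module.End.eigenspace A.HGamma (Δ : ℂ)) :=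
  (LinearEquiv.ofBijective _ A.HGamma_bijective).symm

/-- The product `a *_p b` on `V_Γ`: if `a` has conformal weight `Δ_a` then `γ_a = Δ_a`
(since `ε_a = 0`), and the definition is extended linearly to all `a` along the eigenspace
decomposition of `H`. -/
def starGamma (p : ℕ) : A.VGamma →ₗ[ℂ] A.VGamma →ₗ[ℂ] A.VGammaH :=
  (DirectSum.toModule ℂ ℝ (A.VGamma →ₗ[ℂ] A.VGammaH)
    (fun Δ => (A.starAux p Δ).comp (Module.End.eigenspace A.HGamma (Δ : ℂ)).subtype)).comp
  A.weightDecomp.toLinearMap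

lemma starGamma_apply (p : ℕ) (Δ : ℝ) (a b : A.VGamma) (ha : A.H a = (Δ : ℂ) • (a : V)) :
    A.starGamma p a b = ∑ m ∈ Finset.range (p + 1), Ring.choose (-p - 1 : ℤ) m •
      (LaurentPolynomial.T (-p - m : ℤ) : ℂ[T;T⁻¹]) • A.modProd p Δ (-p - 1 - m)
        (fun k => ⟨A.nprod k a b, A.nprod_mem_VGamma a.2 b.2 k⟩) := by
  have ha' : a ∈ Module.End.eigenspace A.HGamma (Δ : ℂ) :=
    Module.End.mem_eigenspace_iff.2 (Subtype.ext ha)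
  have h : A.weightDecomp a =
      DirectSum.lof ℂ ℝ (fun Δ : ℝ => Module.End.eigenspace A.HGamma (Δ : ℂ)) Δ ⟨a, ha'⟩ := by
    refine (LinearEquiv.symm_apply_eq _).2 ?_
    exact (DirectSum.coeLinearMap_lof _ Δ ⟨a, ha'⟩).symm
  simp only [starGamma, LinearMap.comp_apply, LinearEquiv.coe_coe, h, DirectSum.toModule_lof]
  simp [starAux, modProdHom]

/-- The `ℂ[ħ, ħ⁻¹]`-bilinear product `*_p` on `V_{Γ,ħ}`. -/
def star (p : ℕ) : A.VGammaH →ₗ[ℂ[T;T⁻¹]] A.VGammaH →ₗ[ℂ[T;T⁻¹]] A.VGammaH :=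
  LinearMap.liftBaseChange ℂ[T;T⁻¹]
    (((LinearMap.liftBaseChangeEquiv ℂ[T;T⁻¹]).toLinearMap.restrictScalars ℂ).comp
      (A.starGamma p))

lemma star_one_tmul (p : ℕ) (a b : A.VGamma) :
    A.star p (1 ⊗ₜ[ℂ] a) (1 ⊗ₜ[ℂ] b) = A.starGamma p a b := by
  simp [star]

/-- The vacuum, as an element of `V_{Γ,ħ}`. -/
def vacH : A.VGammaH := 1 ⊗ₜ[ℂ] ⟨A.vac, A.vac_mem_VGamma⟩

/-- `J_{p,Γ,ħ}` is a two-sided ideal for `*_p`, and modulo it `*_p` is associative with unit the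
vacuum. -/
structure IsZhuIdeal (p : ℕ) : Prop where
  star_mem_right : ∀ x ∈ A.J p, ∀ y, A.star p x y ∈ A.J p
  star_mem_left : ∀ x, ∀ y ∈ A.J p, A.star p x y ∈ A.J p
  star_assoc : ∀ x y z, A.star p (A.star p x y) z - A.star p x (A.star p y z) ∈ A.J p
  vac_star : ∀ x, A.star p A.vacH x - x ∈ A.J p
  star_vac : ∀ x, A.star p x A.vacH - x ∈ A.J p

/-- The level `p` Zhu algebra `Zhu_{p,Γ,ħ}(V) = V_{Γ,ħ} / J_{p,Γ,ħ}`. The argument `h` only serves to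
equip the quotient with the product inherited from `*_p`. -/
def Zhu (p : ℕ) (_h : A.IsZhuIdeal p) : Type _ := A.VGammaH ⧸ A.J p

namespace Zhu

variable {A} {p : ℕ} (h : A.IsZhuIdeal p)

instance : AddCommGroup (A.Zhu p h) := inferInstanceAs (AddCommGroup (A.VGammaH ⧸ A.J p))

instance : Module ℂ[T;T⁻¹] (A.Zhu p h) :=
  inferInstanceAs (Module ℂ[T;T⁻¹] (A.VGammaH ⧸ A.J p))

/-- The projection `π_p : V_{Γ,ħ} → Zhu_{p,Γ,ħ}(V)`. -/
def proj : A.VGammaH →ₗ[ℂ[T;T⁻¹]] A.Zhu p h := (A.J p).mkQ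

lemma proj_surjective : Function.Surjective (proj h) := (A.J p).mkQ_surjective

lemma proj_eq_proj {x y : A.VGammaH} : proj h x = proj h y ↔ x - y ∈ A.J p :=
  Submodule.Quotient.eq (A.J p)

/-- The product inherited from `*_p`. -/
def mulHom : A.Zhu p h →ₗ[ℂ[T;T⁻¹]] A.Zhu p h →ₗ[ℂ[T;T⁻¹]] A.Zhu p h :=
  (A.J p).liftQ
    { toFun := fun x => (A.J p).liftQ ((proj h).comp (A.star p x))
        (fun y hy => (Submodule.Quotient.mk_eq_zero _).2 (h.star_mem_left x y hy))
      map_add' := fun x x' => by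
        refine LinearMap.ext fun z => ?_
        obtain ⟨z, rfl⟩ := (A.J p).mkQ_surjective z
        change proj h (A.star p (x + x') z) = proj h (A.star p x z) + proj h (A.star p x' z)
        simp
      map_smul' := fun r x => by
        refine LinearMap.ext fun z => ?_
        obtain ⟨z, rfl⟩ := (A.J p).mkQ_surjective z
        change proj h (A.star p (r • x) z) = r • proj h (A.star p x z)
        simp }
    (fun x hx => by
      refine LinearMap.ext fun z => ?_
      obtain ⟨z, rfl⟩ := (A.J p).mkQ_surjective z
      exact (Submodule.Quotient.mk_eq_zero _).2 (h.star_mem_right x hx z))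

lemma mulHom_proj (x y : A.VGammaH) : mulHom h (proj h x) (proj h y) = proj h (A.star p x y) :=
  rfl

instance : Ring (A.Zhu p h) :=
  { (inferInstance : AddCommGroup (A.Zhu p h)) with
    mul := fun x y => mulHom h x y
    one := proj h A.vacH
    left_distrib := fun x y z => map_add (mulHom h x) y z
    right_distrib := fun x y z => LinearMap.map_add₂ (mulHom h) x y z
    zero_mul := fun x => LinearMap.map_zero₂ (mulHom h) x
    mul_zero := fun x => map_zero (mulHom h x)
    mul_assoc := fun x y z => by
      obtain ⟨x, rfl⟩ := proj_surjective h x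
      obtain ⟨y, rfl⟩ := proj_surjective h y
      obtain ⟨z, rfl⟩ := proj_surjective h z
      exact (proj_eq_proj h).2 (h.star_assoc x y z)
    one_mul := fun x => by
      obtain ⟨x, rfl⟩ := proj_surjective h x
      exact (proj_eq_proj h).2 (h.vac_star x)
    mul_one := fun x => by
      obtain ⟨x, rfl⟩ := proj_surjective h x
      exact (proj_eq_proj h).2 (h.star_vac x) }

instance : Algebra ℂ[T;T⁻¹] (A.Zhu p h) :=
  Algebra.ofModule (fun r x y => LinearMap.map_smul₂ (mulHom h) r x y)
    (fun r x y => map_smul (mulHom h x) r y)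

lemma proj_mul (x y : A.VGammaH) : proj h x * proj h y = proj h (A.star p x y) := rfl

lemma proj_vacH : proj h A.vacH = 1 := rfl

/-- The even and odd parts of the Zhu algebra: the images of those of `V_{Γ,ħ}`. -/
def parity (i : ZMod 2) : Submodule ℂ[T;T⁻¹] (A.Zhu p h) :=
  Submodule.span _ {x | ∃ a : A.VGamma, (a : V) ∈ A.parity i ∧ x = proj h (1 ⊗ₜ[ℂ] a)}

end Zhu

end GradedVertexAlgebra
end

/-! Rescale the products of ℂ[ħ, ħ⁻¹] ⊗ V to ħ^{n+1} a_(n) b. They still satisfy the Borcherds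
identity, and ħ disappears from all formulas up to units: a_{[n,p]} b becomes the residue Res_z z^n
(1 + z)^{γ_a + p} Y(a, z) b (`bracket`), the product `*_p` becomes a fixed combination of such
residues (`zhuProd`), and T + ħH becomes `transH` plus the conformal weight. Since V_{Γ,ħ} embeds in
this larger module (`inclH`), everything is checked there on vectors homogeneous for degree, weight
and parity.

Two tools carry the argument. The first is a supply of elements of J_p beyond its generators
(`bracket_mem`): integrating by parts with Ta in place of a lowers the exponent n, and expanding (1
+ z)^e allows a larger power of 1 + z at the price of a lower n. The second is the Borcherds
identity multiplied by (1 + z)^r (1 + w)^t (`Borcherds.bracket`). Its exponents r, t can be chosen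
so that the iterated products a_(n+l) b occur with exactly the power of 1 + w prescribed by their
weights.

The commutator case shows that left multiplication preserves the modified products in J_p
(`zhuProd_left_mem`). The case m = 0 gives right multiplication (`zhuProd_right_mem`) and
associativity (`zhuProd_assoc`), where all terms outside a finite triangle lie in J_p and the
triangle collapses by ((1 + w) - w)^q = 1. The elements (T + ħH)a are handled by a telescoping sum
(`sum_choose_smul_weightedSum_deriv`), and the vacuum is a unit because T^k a / k! ≡ binom(-Δ, k) a.

Pascal's rule compares consecutive levels (`zhuProd_succ_sub_mem`), which yields the maps between
the quotients. The superalgebra structure comes from the parity involution of V, which preserves J_p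
and the product. -/

noncomputable section

/-! ### Formal residues of z^n (1 + z)^r against a sequence vanishing for large indices. -/

section Residues

variable {W : Type*} [AddCommGroup W] [Module ℂ W]

/-- For `s n = a_(n) b`, this is the residue `Res_z z^n (1 + z)^r Y(a, z) b`. -/
def weightedSum (r : ℂ) (n : ℤ) (s : ℤ → W) : W := ∑ᶠ j : ℕ, Ring.choose r j • s (n + j)

lemma weightedSum_eq {s : ℤ → W} {N : ℤ} (hs : ∀ i, N ≤ i → s i = 0) (r : ℂ) {n : ℤ} {M : ℕ}
    (hM : N ≤ n + M) :
    weightedSum r n s = ∑ j ∈ Finset.range M, Ring.choose r j • s (n + j) := by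
  refine finsum_eq_sum_of_support_subset _ fun j hj => ?_
  by_contra h
  simp only [Finset.coe_range, Set.mem_Iio, not_lt] at h
  exact hj (by simp [hs (n + j) (by omega)])

lemma weightedSum_eventually {s : ℤ → W} {N : ℤ} (hs : ∀ i, N ≤ i → s i = 0) (r : ℂ) (n : ℤ) :
    ∀ᶠ M : ℕ in Filter.atTop,
      weightedSum r n s = ∑ j ∈ Finset.range M, Ring.choose r j • s (n + j) := by
  filter_upwards [Filter.eventually_ge_atTop (N - n).toNat] with M hM
  exact weightedSum_eq hs r (by omega)

/-- The identity (1 + z)^{r+1} = (1 + z)^r + z (1 + z)^r, that is, Pascal's rule. -/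
lemma weightedSum_add_one {s : ℤ → W} {N : ℤ} (hs : ∀ i, N ≤ i → s i = 0) (r : ℂ) (n : ℤ) :
    weightedSum (r + 1) n s = weightedSum r n s + weightedSum r (n + 1) s := by
  obtain ⟨M, h1, h2, h3⟩ := ((weightedSum_eventually hs (r + 1) n).and
    ((weightedSum_eventually hs r n).and (Filter.eventually_ge_atTop (N - n).toNat))).exists
  have e : weightedSum (r + 1) n s =
      ∑ j ∈ Finset.range (M + 1), Ring.choose (r + 1) j • s (n + j) :=
    weightedSum_eq hs _ (by push_cast; omega)
  have e' : weightedSum r n s =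
      ∑ j ∈ Finset.range (M + 1), Ring.choose r j • s (n + j) :=
    weightedSum_eq hs _ (by push_cast; omega)
  rw [e, e', weightedSum_eq hs r (n := n + 1) (M := M) (by omega), Finset.sum_range_succ',
    Finset.sum_range_succ']
  simp only [Ring.choose_succ_succ, add_smul, Finset.sum_add_distrib, Ring.choose_zero_right]
  simp only [Nat.cast_add, Nat.cast_one, add_assoc, add_comm (1 : ℤ)]
  abel

lemma weightedSum_add_natCast {s : ℤ → W} {N : ℤ} (hs : ∀ i, N ≤ i → s i = 0) (r : ℂ) (n : ℤ)
    (e : ℕ) : weightedSum (r + e) n s =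
      ∑ q ∈ Finset.range (e + 1), (e.choose q : ℤ) • weightedSum r (n + q) s := by
  induction e generalizing n with
  | zero => simp
  | succ e ih =>
    rw [Nat.cast_add, Nat.cast_one, ← add_assoc, weightedSum_add_one hs, ih, ih,
      Finset.sum_range_succ' _ (e + 1), Finset.sum_range_succ' _ e]
    have h : ∑ q ∈ Finset.range (e + 1), ((e + 1).choose (q + 1) : ℤ) •
          weightedSum r (n + (q + 1 : ℕ)) s =
        ∑ q ∈ Finset.range (e + 1), (e.choose q : ℤ) • weightedSum r (n + 1 + q) s +
        ∑ q ∈ Finset.range (e + 1), (e.choose (q + 1) : ℤ) •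
          weightedSum r (n + (q + 1 : ℕ)) s := by
      rw [← Finset.sum_add_distrib]
      refine Finset.sum_congr rfl fun q _ => ?_
      rw [Nat.choose_succ_succ, Nat.cast_add, add_smul, Nat.cast_add, Nat.cast_one,
        add_right_comm n 1, add_assoc n]
    rw [h, Finset.sum_range_succ (fun q => (e.choose (q + 1) : ℤ) • _)]
    simp
    abel

/-- Integration by parts: k ↦ -k s(k - 1) is the coefficient sequence of the derivative of the
series of s, and the derivative of z^n (1 + z)^{r+1} is (1 + z)^r times n z^{n-1} + (n + r + 1) z^n.
-/
lemma weightedSum_deriv {s : ℤ → W} {N : ℤ} (hs : ∀ i, N ≤ i → s i = 0) (r : ℂ) (n : ℤ) :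
    weightedSum (r + 1) n (fun k => (-k) • s (k - 1)) =
      (-n) • weightedSum r (n - 1) s - ((n : ℂ) + r + 1) • weightedSum r n s := by
  have hs' : ∀ i, N + 1 ≤ i → (fun k : ℤ => (-k) • s (k - 1)) i = 0 := fun i hi => by
    simp [hs (i - 1) (by omega)]
  set M := (N + 1 - n).toNat with hM
  rw [weightedSum_eq hs' (r + 1) (n := n) (M := M + 1) (by push_cast; omega),
    weightedSum_eq hs r (n := n - 1) (M := M + 1) (by push_cast; omega),
    weightedSum_eq hs r (n := n) (M := M) (by omega), Finset.sum_range_succ',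
    Finset.sum_range_succ']
  simp only [Finset.smul_sum, smul_add]
  have h : ∀ j : ℕ, Ring.choose (r + 1) (j + 1) •
      (-(n + ((j + 1 : ℕ) : ℤ))) • s (n + ((j + 1 : ℕ) : ℤ) - 1) =
      (-n) • Ring.choose r (j + 1) • s (n - 1 + ((j + 1 : ℕ) : ℤ)) -
        ((n : ℂ) + r + 1) • Ring.choose r j • s (n + j) := by
    intro j
    have e1 : n + ((j + 1 : ℕ) : ℤ) - 1 = n + j := by push_cast; ring
    have e2 : n - 1 + ((j + 1 : ℕ) : ℤ) = n + j := by push_cast; ring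
    have key : ((j : ℂ) + 1) * Ring.choose r (j + 1) = (r - j) * Ring.choose r j := by
      have := Ring.choose_smul_choose r (n := j + 1) (k := j) (by omega)
      simp only [Nat.choose_succ_self_right, nsmul_eq_mul, add_tsub_cancel_left,
        Ring.choose_one_right] at this
      push_cast at this
      rw [this, mul_comm]
    rw [e1, e2]
    simp only [← Int.cast_smul_eq_zsmul ℂ, smul_smul, ← sub_smul]
    congr 1
    rw [Ring.choose_succ_succ]
    push_cast
    linear_combination -key
  simp only [h, Finset.sum_sub_distrib]
  simp
  abel

/-- Vandermonde's convolution for (1 + z)^r (1 + z)^t. The vanishing of s reduces the rectangle of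
summation to a triangle, which can be summed along diagonals. -/
lemma sum_choose_mul_choose {s : ℤ → W} {N n : ℤ} (hs : ∀ i, N ≤ i → s i = 0) (r t : ℂ)
    {M M' : ℕ} (hM : N ≤ n + M) (hM' : N ≤ n + M') :
    ∑ u ∈ Finset.range M, ∑ v ∈ Finset.range M',
      (Ring.choose r u * Ring.choose t v) • s (n + u + v) = weightedSum (r + t) n s := by
  set K := (N - n).toNat with hK
  have h1 : ∀ u ∈ Finset.range M, u ∉ Finset.range K → ∑ v ∈ Finset.range M',
      (Ring.choose r u * Ring.choose t v) • s (n + u + v) = 0 := by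
    intro u _ hu
    simp only [Finset.mem_range, not_lt] at hu
    exact Finset.sum_eq_zero fun v _ => by rw [hs _ (by omega), smul_zero]
  rw [← Finset.sum_subset (Finset.range_subset_range.2 (by omega)) h1]
  have h2 : ∀ u ∈ Finset.range K, ∑ v ∈ Finset.range M',
      (Ring.choose r u * Ring.choose t v) • s (n + u + v) = ∑ v ∈ Finset.range (K - u),
      (Ring.choose r u * Ring.choose t v) • s (n + u + v) := by
    intro u hu
    refine (Finset.sum_subset (Finset.range_subset_range.2 (by omega)) fun v _ hv => ?_).symm
    simp only [Finset.mem_range, not_lt] at hv hu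
    rw [hs _ (by omega), smul_zero]
  rw [Finset.sum_congr rfl h2, ← Finset.sum_range_diag_flip K
    (fun u v => (Ring.choose r u * Ring.choose t v) • s (n + u + v)),
    weightedSum_eq hs (r + t) (n := n) (M := K) (by omega)]
  refine Finset.sum_congr rfl fun q _ => ?_
  rw [Ring.add_choose_eq q (Commute.all r t), Finset.sum_smul,
    Finset.Nat.sum_antidiagonal_eq_sum_range_succ_mk]
  refine Finset.sum_congr rfl fun u hu => ?_
  simp only [Finset.mem_range] at hu
  congr 2
  omega

lemma choose_mul_natCast_choose (r : ℂ) (u l : ℕ) :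
    Ring.choose r u * (u.choose l : ℂ) =
      if l ≤ u then Ring.choose r l * Ring.choose (r - l) (u - l) else 0 := by
  split_ifs with h
  · have := Ring.choose_smul_choose r h
    rw [nsmul_eq_mul] at this
    rw [← this, mul_comm]
  · simp [Nat.choose_eq_zero_of_lt (not_le.1 h)]

/-- Two computations of the I-th Taylor coefficient of z^m (1 + z)^r at z = w, multiplied by w^k (1
+ w)^t: expanding (1 + z)^r in monomials z^u first, or applying the Leibniz rule to the two factors.
They are matched by binom(m + u, I) = ∑ binom(m, i) binom(u, l) over i + l = I. -/
lemma sum_choose_mul_choose_mul_choose {s : ℤ → W} {N : ℤ} (hs : ∀ i, N ≤ i → s i = 0) (r t : ℂ)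
    (m k : ℤ) (I : ℕ) :
    ∀ᶠ M : ℕ in Filter.atTop, ∑ u ∈ Finset.range M, ∑ v ∈ Finset.range M,
      (Ring.choose r u * Ring.choose t v) • Ring.choose (m + u : ℤ) I • s (m + u + (k + v) - I) =
    ∑ i ∈ Finset.HasAntidiagonal.antidiagonal I, Ring.choose m i.1 • Ring.choose r i.2 •
      weightedSum (r + t - i.2) (m + k - i.1) s := by
  filter_upwards [Filter.eventually_ge_atTop (I + (N - m - k + I).toNat)] with M hM
  have h1 : ∀ i ∈ Finset.HasAntidiagonal.antidiagonal I, Ring.choose m i.1 • Ring.choose r i.2 •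
      weightedSum (r + t - i.2) (m + k - i.1) s =
      ∑ u ∈ Finset.range M, ∑ v ∈ Finset.range M, (Ring.choose r u * Ring.choose t v *
        (Ring.choose m i.1 * (u.choose i.2 : ℂ))) • s (m + u + (k + v) - I) := by
    rintro ⟨i, l⟩ hil
    simp only [Finset.HasAntidiagonal.mem_antidiagonal] at hil
    dsimp only
    rw [show r + t - l = r - l + t by ring, ← sum_choose_mul_choose hs (r - l) t
      (M := M - l) (M' := M) (by omega) (by omega)]
    have hz : ∀ u ∈ Finset.range M, ∑ v ∈ Finset.range M, (Ring.choose r u * Ring.choose t v *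
        ((Ring.choose m i : ℤ) * (u.choose l : ℂ))) • s (m + u + (k + v) - I) =
        if l ≤ u then ∑ v ∈ Finset.range M, ((Ring.choose m i : ℤ) * Ring.choose r l *
        Ring.choose (r - l) (u - l) * Ring.choose t v) • s (m + u + (k + v) - I) else 0 := by
      intro u _
      have h2 := choose_mul_natCast_choose r u l
      split_ifs with h
      · rw [if_pos h] at h2
        refine Finset.sum_congr rfl fun v _ => ?_
        congr 1
        linear_combination (Ring.choose t v * (Ring.choose m i : ℤ)) * h2
      · rw [if_neg h] at h2
        refine Finset.sum_eq_zero fun v _ => ?_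
        rw [show Ring.choose r u * Ring.choose t v * ((Ring.choose m i : ℤ) * (u.choose l : ℂ))
          = 0 by linear_combination (Ring.choose t v * (Ring.choose m i : ℤ)) * h2, zero_smul]
    rw [Finset.sum_congr rfl hz]
    -- The terms with u < l vanish; the remaining ones are reindexed by u - l, to match binom(r - l,
    -- u - l).
    obtain ⟨M', rfl⟩ : ∃ M', M = l + M' := ⟨M - l, by omega⟩
    rw [Finset.sum_range_add (fun u => if l ≤ u then _ else _), add_tsub_cancel_left,
      Finset.sum_eq_zero (s := Finset.range l) (fun u hu => if_neg (by
        simp only [Finset.mem_range] at hu; omega)), zero_add, Finset.smul_sum, Finset.smul_sum]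
    refine Finset.sum_congr rfl fun u _ => ?_
    rw [if_pos (by omega), Finset.smul_sum, Finset.smul_sum]
    refine Finset.sum_congr rfl fun v _ => ?_
    rw [← Int.cast_smul_eq_zsmul ℂ, smul_smul, smul_smul, add_tsub_cancel_left]
    congr 1
    · ring
    · congr 1
      push_cast
      omega
  rw [Finset.sum_congr rfl h1, Finset.sum_comm (s := Finset.HasAntidiagonal.antidiagonal I)]
  refine Finset.sum_congr rfl fun u _ => ?_
  rw [Finset.sum_comm (s := Finset.HasAntidiagonal.antidiagonal I)]
  refine Finset.sum_congr rfl fun v _ => ?_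
  rw [← Finset.sum_smul, ← Finset.mul_sum, ← Int.cast_smul_eq_zsmul ℂ, smul_smul,
    Ring.add_choose_eq I (Commute.all m (u : ℤ))]
  rw [Int.cast_sum]
  congr 2
  refine Finset.sum_congr rfl fun i _ => ?_
  rw [Ring.choose_natCast]
  push_cast
  rfl

end Residues

/-! ### Residue brackets for a system of products, and the Borcherds identity with weights. -/

section Brackets

variable {W : Type*} [AddCommGroup W] [Module ℂ W]

lemma map_weightedSum {W' F : Type*} [AddCommGroup W'] [Module ℂ W'] [FunLike F W W']
    [LinearMapClass F ℂ W W'] (f : F) {s : ℤ → W} {N : ℤ}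
    (hs : ∀ i, N ≤ i → s i = 0) (r : ℂ) (n : ℤ) :
    f (weightedSum r n s) = weightedSum r n (fun k => f (s k)) := by
  have hs' : ∀ i, N ≤ i → f (s i) = 0 := fun i hi => by rw [hs i hi, map_zero]
  have hM : N ≤ n + ((N - n).toNat : ℕ) := by omega
  rw [weightedSum_eq hs r hM, weightedSum_eq hs' r hM, map_sum]
  simp only [map_smul]

lemma weightedSum_add {s t : ℤ → W} {N N' : ℤ} (hs : ∀ i, N ≤ i → s i = 0)
    (ht : ∀ i, N' ≤ i → t i = 0) (r : ℂ) (n : ℤ) :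
    weightedSum r n (fun k => s k + t k) = weightedSum r n s + weightedSum r n t := by
  obtain ⟨M, h1, h2, h3⟩ := ((weightedSum_eventually hs r n).and
    ((weightedSum_eventually ht r n).and
      (Filter.eventually_ge_atTop (max N N' - n).toNat))).exists
  have hst : ∀ i, max N N' ≤ i → (fun k => s k + t k) i = 0 := fun i hi => by
    simp [hs i (by omega), ht i (by omega)]
  rw [h1, h2, weightedSum_eq hst r (M := M) (by omega), ← Finset.sum_add_distrib]
  simp only [smul_add]

variable {R : Type*} [CommRing R] [Algebra ℂ R] [Module R W] [IsScalarTower ℂ R W]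

/-- A family of bilinear products `x_(n) y` on a module with `x_(n) y = 0` for large `n`. -/
structure ProductSystem (R W : Type*) [CommRing R] [AddCommGroup W] [Module R W] where
  prod : ℤ → W →ₗ[R] W →ₗ[R] W
  exists_prod_eq_zero : ∀ x y, ∃ N : ℤ, ∀ n, N ≤ n → prod n x y = 0

namespace ProductSystem

variable (S : ProductSystem R W)

/-- The residue `Res_z z^n (1 + z)^r Y(x, z) y` as a bilinear map in `x` and `y`. -/
def bracket (r : ℂ) (n : ℤ) : W →ₗ[R] W →ₗ[R] W :=
  LinearMap.mk₂ R (fun x y => weightedSum r n fun k => S.prod k x y)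
    (fun x x' y => by
      obtain ⟨N, hN⟩ := S.exists_prod_eq_zero x y
      obtain ⟨N', hN'⟩ := S.exists_prod_eq_zero x' y
      rw [← weightedSum_add hN hN']
      simp)
    (fun c x y => by
      obtain ⟨N, hN⟩ := S.exists_prod_eq_zero x y
      have := map_weightedSum ((LinearMap.lsmul R W c).restrictScalars ℂ) hN r n
      simpa using this.symm)
    (fun x y y' => by
      obtain ⟨N, hN⟩ := S.exists_prod_eq_zero x y
      obtain ⟨N', hN'⟩ := S.exists_prod_eq_zero x y'
      rw [← weightedSum_add hN hN']
      simp)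
    (fun c x y => by
      obtain ⟨N, hN⟩ := S.exists_prod_eq_zero x y
      have := map_weightedSum ((LinearMap.lsmul R W c).restrictScalars ℂ) hN r n
      simpa using this.symm)

lemma bracket_apply (r : ℂ) (n : ℤ) (x y : W) :
    S.bracket r n x y = weightedSum r n fun k => S.prod k x y := rfl

lemma bracket_eventually (r : ℂ) (n : ℤ) (x y : W) : ∀ᶠ M : ℕ in Filter.atTop,
    S.bracket r n x y = ∑ j ∈ Finset.range M, Ring.choose r j • S.prod (n + j) x y := by
  obtain ⟨N, hN⟩ := S.exists_prod_eq_zero x y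
  exact weightedSum_eventually hN r n

lemma bracket_add_one (r : ℂ) (n : ℤ) (x y : W) :
    S.bracket (r + 1) n x y = S.bracket r n x y + S.bracket r (n + 1) x y := by
  obtain ⟨N, hN⟩ := S.exists_prod_eq_zero x y
  exact weightedSum_add_one hN r n

lemma bracket_add_natCast (r : ℂ) (n : ℤ) (e : ℕ) (x y : W) : S.bracket (r + e) n x y =
      ∑ q ∈ Finset.range (e + 1), (e.choose q : ℤ) • S.bracket r (n + q) x y := by
  obtain ⟨N, hN⟩ := S.exists_prod_eq_zero x y
  exact weightedSum_add_natCast hN r n e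

/-- The truncation needed for the outer product depends on the inner vector y_(k+v) z, but only
finitely many v give a nonzero vector, so one bound M serves for all of them. -/
lemma bracket_bracket_eventually (r t : ℂ) (n k : ℤ) (x y z : W) : ∀ᶠ M : ℕ in Filter.atTop,
    S.bracket r n x (S.bracket t k y z) = ∑ u ∈ Finset.range M, ∑ v ∈ Finset.range M,
      (Ring.choose r u * Ring.choose t v) • S.prod (n + u) x (S.prod (k + v) y z) := by
  obtain ⟨N, hN⟩ := S.exists_prod_eq_zero y z
  have h1 : ∀ᶠ M : ℕ in Filter.atTop, ∀ v ∈ Finset.range (N - k).toNat,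
      S.bracket r n x (S.prod (k + v) y z) =
        ∑ u ∈ Finset.range M, Ring.choose r u • S.prod (n + u) x (S.prod (k + v) y z) :=
    (Filter.eventually_all_finset _).2 fun v _ => S.bracket_eventually r n x _
  filter_upwards [h1, S.bracket_eventually t k y z] with M h1 h2
  have h3 : ∀ v : ℕ, S.bracket r n x (S.prod (k + v) y z) =
      ∑ u ∈ Finset.range M, Ring.choose r u • S.prod (n + u) x (S.prod (k + v) y z) := by
    intro v
    by_cases hv : v ∈ Finset.range (N - k).toNat
    · exact h1 v hv
    · simp only [Finset.mem_range, not_lt] at hv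
      rw [hN _ (by omega)]
      simp
  rw [h2, map_sum, Finset.sum_comm]
  refine Finset.sum_congr rfl fun v _ => ?_
  rw [LinearMap.map_smul_of_tower, h3, Finset.smul_sum]
  refine Finset.sum_congr rfl fun u _ => ?_
  rw [smul_smul, mul_comm]

/-- The Borcherds identity for `x` and `y`, with `κ` the sign of the pair `(x, y)`. -/
def Borcherds (κ : ℂ) (x y : W) : Prop := ∀ (z : W) (m k n : ℤ),
  ∑ᶠ j : ℕ, Ring.choose m j • S.prod (m + k - j) (S.prod (n + j) x y) z =
    ∑ᶠ j : ℕ, ((-1) ^ j * Ring.choose n j : ℤ) •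
      (S.prod (m + n - j) x (S.prod (k + j) y z) -
        (κ * (-1 : ℂ) ^ n) • S.prod (k + n - j) y (S.prod (m + j) x z))

lemma finsum_prod_prod_left {x y : W} {N n : ℤ} {L : ℕ} (h : ∀ i, N ≤ i → S.prod i x y = 0)
    (hL : N ≤ n + L) (m k : ℤ) (z : W) :
    ∑ᶠ j : ℕ, Ring.choose m j • S.prod (m + k - j) (S.prod (n + j) x y) z =
      ∑ j ∈ Finset.range L, Ring.choose m j • S.prod (m + k - j) (S.prod (n + j) x y) z := by
  refine finsum_eq_sum_of_support_subset _ fun j hj => ?_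
  by_contra hlt
  simp only [Finset.coe_range, Set.mem_Iio, not_lt] at hlt
  exact hj (by simp [h (n + j) (by omega)])

lemma finsum_prod_prod_right {x y z : W} {N N' m k : ℤ} {L : ℕ}
    (h : ∀ i, N ≤ i → S.prod i y z = 0) (h' : ∀ i, N' ≤ i → S.prod i x z = 0)
    (hL : N ≤ k + L) (hL' : N' ≤ m + L) (n : ℤ) (κ : ℂ) :
    ∑ᶠ j : ℕ, ((-1) ^ j * Ring.choose n j : ℤ) •
      (S.prod (m + n - j) x (S.prod (k + j) y z) -
        (κ * (-1 : ℂ) ^ n) • S.prod (k + n - j) y (S.prod (m + j) x z)) =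
    ∑ j ∈ Finset.range L, ((-1) ^ j * Ring.choose n j : ℤ) •
      (S.prod (m + n - j) x (S.prod (k + j) y z) -
        (κ * (-1 : ℂ) ^ n) • S.prod (k + n - j) y (S.prod (m + j) x z)) := by
  refine finsum_eq_sum_of_support_subset _ fun j hj => ?_
  by_contra hlt
  simp only [Finset.coe_range, Set.mem_Iio, not_lt] at hlt
  exact hj (by simp [h (k + j) (by omega), h' (m + j) (by omega)])

variable {S}

/-- The Borcherds identity multiplied by `(1 + z)^r (1 + w)^t`. -/
theorem Borcherds.bracket {κ : ℂ} {x y : W} (h : S.Borcherds κ x y) (r t : ℂ) (m k n : ℤ) (z : W) :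
    ∀ᶠ M : ℕ in Filter.atTop,
    ∑ I ∈ Finset.range M, ∑ i ∈ Finset.HasAntidiagonal.antidiagonal I,
      Ring.choose m i.1 • Ring.choose r i.2 •
        S.bracket (r + t - i.2) (m + k - i.1) (S.prod (n + I) x y) z =
    ∑ j ∈ Finset.range M, ((-1) ^ j * Ring.choose n j : ℤ) •
      (S.bracket r (m + n - j) x (S.bracket t (k + j) y z) -
        (κ * (-1 : ℂ) ^ n) • S.bracket t (k + n - j) y (S.bracket r (m + j) x z)) := by
  obtain ⟨N₁, h₁⟩ := S.exists_prod_eq_zero x y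
  obtain ⟨N₂, h₂⟩ := S.exists_prod_eq_zero y z
  obtain ⟨N₃, h₃⟩ := S.exists_prod_eq_zero x z
  filter_upwards [Filter.eventually_ge_atTop
    ((N₁ - n).toNat + (N₂ - k).toNat + (N₃ - m).toNat)] with L hL
  -- The identity for each monomial z^{m+u} w^{k+v} of the expanded weight. Increasing the exponents
  -- only helps the vanishing, so the same truncation L works for all u and v; the expansions of (1
  -- + z)^r and (1 + w)^t get a separate, larger truncation M, chosen after L.
  have base : ∀ u v : ℕ,
      ∑ j ∈ Finset.range L, Ring.choose (m + u) j •
        S.prod (m + u + (k + v) - j) (S.prod (n + j) x y) z =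
      ∑ j ∈ Finset.range L, ((-1) ^ j * Ring.choose n j : ℤ) •
      (S.prod (m + n - j + u) x (S.prod (k + j + v) y z) -
        (κ * (-1 : ℂ) ^ n) • S.prod (k + n - j + v) y (S.prod (m + j + u) x z)) := by
    intro u v
    have e := h z (m + u) (k + v) n
    rw [S.finsum_prod_prod_left h₁ (L := L) (by omega),
      S.finsum_prod_prod_right h₂ h₃ (L := L) (by omega) (by omega)] at e
    rw [e]
    refine Finset.sum_congr rfl fun j _ => ?_
    rw [show m + u + n - j = m + n - j + u by ring, show k + v + j = k + j + v by ring,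
      show k + v + n - j = k + n - j + v by ring, show m + u + j = m + j + u by ring]
  have e1 : ∀ᶠ M : ℕ in Filter.atTop, ∀ I ∈ Finset.range L,
      ∑ u ∈ Finset.range M, ∑ v ∈ Finset.range M, (Ring.choose r u * Ring.choose t v) •
        Ring.choose (m + u : ℤ) I • S.prod (m + u + (k + v) - I) (S.prod (n + I) x y) z =
      ∑ i ∈ Finset.HasAntidiagonal.antidiagonal I, Ring.choose m i.1 • Ring.choose r i.2 •
        S.bracket (r + t - i.2) (m + k - i.1) (S.prod (n + I) x y) z := by
    refine (Filter.eventually_all_finset _).2 fun I _ => ?_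
    obtain ⟨N, hN⟩ := S.exists_prod_eq_zero (S.prod (n + I) x y) z
    exact sum_choose_mul_choose_mul_choose hN r t m k I
  have e2 : ∀ᶠ M : ℕ in Filter.atTop, ∀ j ∈ Finset.range L,
      S.bracket r (m + n - j) x (S.bracket t (k + j) y z) =
      ∑ u ∈ Finset.range M, ∑ v ∈ Finset.range M, (Ring.choose r u * Ring.choose t v) •
        S.prod (m + n - j + u) x (S.prod (k + j + v) y z) :=
    (Filter.eventually_all_finset _).2 fun j _ => S.bracket_bracket_eventually ..
  have e3 : ∀ᶠ M : ℕ in Filter.atTop, ∀ j ∈ Finset.range L,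
      S.bracket t (k + n - j) y (S.bracket r (m + j) x z) =
      ∑ v ∈ Finset.range M, ∑ u ∈ Finset.range M, (Ring.choose t v * Ring.choose r u) •
        S.prod (k + n - j + v) y (S.prod (m + j + u) x z) :=
    (Filter.eventually_all_finset _).2 fun j _ => S.bracket_bracket_eventually ..
  obtain ⟨M, e1, e2, e3⟩ := (e1.and (e2.and e3)).exists
  rw [← Finset.sum_congr rfl e1, Finset.sum_comm]
  have e4 : ∀ j ∈ Finset.range L, ((-1) ^ j * Ring.choose n j : ℤ) •
      (S.bracket r (m + n - j) x (S.bracket t (k + j) y z) -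
        (κ * (-1 : ℂ) ^ n) • S.bracket t (k + n - j) y (S.bracket r (m + j) x z)) =
      ∑ u ∈ Finset.range M, ∑ v ∈ Finset.range M, (Ring.choose r u * Ring.choose t v) •
        ((-1) ^ j * Ring.choose n j : ℤ) • (S.prod (m + n - j + u) x (S.prod (k + j + v) y z) -
        (κ * (-1 : ℂ) ^ n) • S.prod (k + n - j + v) y (S.prod (m + j + u) x z)) := by
    intro j hj
    rw [e2 j hj, e3 j hj, Finset.sum_comm (s := Finset.range M) (t := Finset.range M)
      (f := fun v u => (Ring.choose t v * Ring.choose r u) • _)]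
    simp only [Finset.smul_sum, ← Finset.sum_sub_distrib]
    refine Finset.sum_congr rfl fun u _ => Finset.sum_congr rfl fun v _ => ?_
    rw [smul_comm (Ring.choose r u * Ring.choose t v) ((-1) ^ j * Ring.choose n j : ℤ),
      smul_sub (Ring.choose r u * Ring.choose t v),
      smul_comm (Ring.choose r u * Ring.choose t v) (κ * (-1 : ℂ) ^ n),
      mul_comm (Ring.choose t v)]
  rw [Finset.sum_congr rfl e4, Finset.sum_comm (s := Finset.range L)]
  refine Finset.sum_congr rfl fun u _ => ?_
  rw [Finset.sum_comm (s := Finset.range L), Finset.sum_comm (s := Finset.range L)]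
  refine Finset.sum_congr rfl fun v _ => ?_
  rw [← Finset.smul_sum, ← Finset.smul_sum, base]

end ProductSystem

end Brackets

/-! ### Consequences of the Borcherds identity: creation property, translation operator, derivation
rule. -/

namespace GradedVertexAlgebra

variable {Γ : AddSubgroup ℝ} {V : Type*} [AddCommGroup V] [Module ℂ V]
  (A : GradedVertexAlgebra Γ V)

/-- The products of `V` as bilinear maps. -/
def nprodHom (n : ℤ) : V →ₗ[ℂ] V →ₗ[ℂ] V :=
  LinearMap.mk₂ ℂ (A.nprod n) (by simp [VertexAlgebra.nprod]) (by simp [VertexAlgebra.nprod])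
    (by simp [VertexAlgebra.nprod]) (by simp [VertexAlgebra.nprod])

@[simp] lemma nprodHom_apply (n : ℤ) (a b : V) : A.nprodHom n a b = A.nprod n a b := rfl

/-- The products of `V`. -/
def nprodSystem : ProductSystem ℂ V where
  prod := A.nprodHom
  exists_prod_eq_zero := A.nprod_eventually_zero

lemma nprodSystem_borcherds {i j : ZMod 2} {a b : V} (ha : a ∈ A.parity i) (hb : b ∈ A.parity j) :
    A.nprodSystem.Borcherds (koszulSign i j) a b :=
  fun c => A.borcherds i j a b c ha hb

lemma exists_parity_add (a : V) : ∃ b ∈ A.parity 0, ∃ c ∈ A.parity 1, a = b + c := by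
  have h : a ∈ ⨆ i, A.parity i := by
    rw [A.parity_isInternal.submodule_iSup_eq_top]
    trivial
  have h2 : ⨆ i, A.parity i = A.parity 0 ⊔ A.parity 1 :=
    le_antisymm (iSup_le fun i => by fin_cases i; exacts [le_sup_left, le_sup_right])
      (sup_le (le_iSup _ _) (le_iSup _ _))
  rw [h2] at h
  obtain ⟨b, hb, c, hc, rfl⟩ := Submodule.mem_sup.1 h
  exact ⟨b, hb, c, hc, rfl⟩

lemma nprod_vac_left (n : ℤ) (b : V) : A.nprod n A.vac b = if n = -1 then b else 0 := A.Y_vac n b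

lemma nprod_add_left (n : ℤ) (a a' b : V) : A.nprod n (a + a') b = A.nprod n a b + A.nprod n a' b :=
  LinearMap.map_add₂ (A.nprodHom n) a a' b

lemma nprod_add_right (n : ℤ) (a b b' : V) :
    A.nprod n a (b + b') = A.nprod n a b + A.nprod n a b' :=
  map_add (A.nprodHom n a) b b'

lemma nprod_zero_right (n : ℤ) (a : V) : A.nprod n a 0 = 0 := map_zero (A.nprodHom n a)

lemma nprod_zero_left (n : ℤ) (a : V) : A.nprod n 0 a = 0 :=
  LinearMap.map_zero₂ (A.nprodHom n) a

/-- The products of `a_(n) |0⟩` with `c`. -/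
lemma nprod_nprod_vac {i : ZMod 2} {a : V} (ha : a ∈ A.parity i) (k n : ℤ) (c : V) :
    A.nprod k (A.nprod n a A.vac) c =
      ((if k + 1 ≤ 0 then ((-1) ^ (-k - 1).toNat * Ring.choose n (-k - 1).toNat : ℤ) else 0) -
        (if 0 ≤ k + n + 1 then (-1 : ℤ) ^ n.natAbs *
          ((-1) ^ (k + n + 1).toNat * Ring.choose n (k + n + 1).toNat : ℤ) else 0)) •
        A.nprod (n + k + 1) a c := by
  have h := A.nprodSystem_borcherds ha A.vac_even c 0 k n
  have hs : koszulSign i 0 = 1 := by simp [koszulSign]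
  have hn : ((-1 : ℂ)) ^ n = ((-1 : ℤ) ^ n.natAbs : ℤ) := by
    obtain ⟨l, rfl | rfl⟩ := n.eq_nat_or_neg
    · simp
    · rw [zpow_neg, ← inv_zpow]
      simp [inv_neg]
  rw [finsum_eq_single _ 0 (fun j hj => by simp [Ring.choose_zero_pos ℤ (Nat.pos_of_ne_zero hj)]),
    hs] at h
  obtain ⟨N, hN⟩ := A.nprod_eventually_zero A.vac c
  obtain ⟨N', hN'⟩ := A.nprod_eventually_zero a c
  -- The truncation is taken large enough to contain the one index in each sum where the vacuum acts
  -- nontrivially: j = -k - 1 in the first, j = k + n + 1 in the second.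
  rw [A.nprodSystem.finsum_prod_prod_right hN hN' (L := (N - k).toNat + N'.toNat +
    (-k).toNat + (k + n + 2).toNat) (by omega) (by omega)] at h
  simp only [nprodSystem, nprodHom_apply, nprod_vac_left, Ring.choose_zero_right, one_smul] at h
  simp only [smul_sub, Finset.sum_sub_distrib] at h
  simp only [Nat.cast_zero, add_zero, sub_zero, zero_add] at h
  rw [sub_smul, h]
  symm
  congr 1
  · split_ifs with hk
    · rw [Finset.sum_eq_single (-k - 1).toNat]
      · rw [if_pos (by omega)]
        congr 2
        omega
      · intro j _ hj
        rw [if_neg (by omega), nprod_zero_right, smul_zero]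
      · intro hj
        simp only [Finset.mem_range] at hj
        omega
    · rw [zero_smul]
      refine (Finset.sum_eq_zero fun j _ => ?_).symm
      rw [if_neg (by omega), nprod_zero_right, smul_zero]
  · split_ifs with hk
    · rw [Finset.sum_eq_single (k + n + 1).toNat]
      · rw [if_pos (by omega), one_mul, hn, Int.cast_smul_eq_zsmul ℂ, smul_smul, mul_comm]
        congr 2
        omega
      · intro j _ hj
        rw [if_neg (by omega), smul_zero, smul_zero]
      · intro hj
        simp only [Finset.mem_range] at hj
        omega
    · rw [zero_smul]
      refine (Finset.sum_eq_zero fun j _ => ?_).symm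
      rw [if_neg (by omega), smul_zero, smul_zero]

lemma eq_of_nprod_eq {a b : V} (h : ∀ n c, A.nprod n a c = A.nprod n b c) : a = b := by
  apply A.Y_injective
  apply HVertexOperator.coeff_inj
  funext m
  ext c
  rw [VertexOperator.coeff_eq_ncoeff, VertexOperator.coeff_eq_ncoeff]
  exact h _ _

/-- The creation property follows from injectivity of Y: every mode of a_(n)|0⟩ vanishes, since its
two contributions binom(n, u) and binom(n, v) with u + v = n cancel by the symmetry of binomial
coefficients. -/
lemma nprod_vac_of_nonneg {n : ℤ} (hn : 0 ≤ n) (a : V) : A.nprod n a A.vac = 0 := by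
  obtain ⟨a₀, h₀, a₁, h₁, rfl⟩ := A.exists_parity_add a
  have key : ∀ i, ∀ a ∈ A.parity i, A.nprod n a A.vac = 0 := by
    intro i a ha
    refine A.eq_of_nprod_eq fun k c => ?_
    rw [A.nprod_nprod_vac ha, nprod_zero_left]
    obtain ⟨n, rfl⟩ := Int.eq_ofNat_of_zero_le hn
    have hc : ∀ j : ℕ, Ring.choose (n : ℤ) j = (n.choose j : ℤ) := fun j =>
      Ring.choose_natCast n j
    convert zero_smul ℤ _
    simp only [hc]
    by_cases h1 : k + 1 ≤ 0
    · by_cases h2 : 0 ≤ k + n + 1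
      · rw [if_pos h1, if_pos h2]
        obtain ⟨u, hu⟩ := Int.eq_ofNat_of_zero_le (show 0 ≤ -k - 1 by omega)
        obtain ⟨v, hv⟩ := Int.eq_ofNat_of_zero_le h2
        rw [hu, hv]
        have : n = u + v := by omega
        subst this
        simp only [Int.toNat_natCast, Int.natAbs_natCast]
        rw [Nat.choose_symm_add, pow_add]
        have : ((-1 : ℤ) ^ v) * (-1) ^ v = 1 := by rw [← mul_pow]; simp
        linear_combination (-(-1 : ℤ) ^ u * ((u + v).choose v : ℤ)) * this
      · rw [if_pos h1, if_neg h2, Nat.choose_eq_zero_of_lt (by omega)]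
        simp
    · rw [if_neg h1, if_pos (by omega), Nat.choose_eq_zero_of_lt (by omega)]
      simp
  rw [nprod_add_left, key 0 _ h₀, key 1 _ h₁, add_zero]

/-- Upper negation. It is used for q = 0 and q = 1, to evaluate the modes of a_(-1)|0⟩ and of Ta =
a_(-2)|0⟩. -/
lemma neg_one_pow_mul_choose_neg (q j : ℕ) :
    (-1 : ℤ) ^ j * Ring.choose (-(q + 1 : ℕ) : ℤ) j = ((q + j).choose j : ℤ) := by
  rw [Ring.choose_neg, show ((q + 1 : ℕ) : ℤ) + j - 1 = ((q + j : ℕ) : ℤ) by push_cast; ring,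
    Ring.choose_natCast]
  rw [Units.smul_def, Int.coe_negOnePow_natCast, smul_eq_mul, ← mul_assoc, ← mul_pow]
  simp

lemma nprod_neg_one_vac (a : V) : A.nprod (-1) a A.vac = a := by
  obtain ⟨a₀, h₀, a₁, h₁, rfl⟩ := A.exists_parity_add a
  have key : ∀ i, ∀ a ∈ A.parity i, A.nprod (-1) a A.vac = a := by
    intro i a ha
    refine A.eq_of_nprod_eq fun k c => ?_
    have hc : ∀ j : ℕ, (-1) ^ j * Ring.choose (-1 : ℤ) j = 1 := fun j => by
      simpa using neg_one_pow_mul_choose_neg 0 j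
    rw [A.nprod_nprod_vac ha, hc, hc, show -1 + k + 1 = k by ring]
    by_cases h : k + 1 ≤ 0
    · rw [if_pos h, if_neg (by omega), sub_zero, one_smul]
    · rw [if_neg h, if_pos (by omega)]
      simp
  rw [nprod_add_left, key 0 _ h₀, key 1 _ h₁]

lemma nprod_T (n : ℤ) (a b : V) : A.nprod n (A.T a) b = (-n) • A.nprod (n - 1) a b := by
  obtain ⟨a₀, h₀, a₁, h₁, rfl⟩ := A.exists_parity_add a
  have key : ∀ i, ∀ a ∈ A.parity i, A.nprod n (A.T a) b = (-n) • A.nprod (n - 1) a b := by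
    intro i a ha
    have hc : ∀ j : ℕ, (-1) ^ j * Ring.choose (-2 : ℤ) j = j + 1 := fun j => by
      have := neg_one_pow_mul_choose_neg 1 j
      rw [add_comm 1 j, Nat.choose_symm_add] at this
      simpa using this
    rw [VertexAlgebra.T, A.nprod_nprod_vac ha, hc, hc, show -2 + n + 1 = n - 1 by ring]
    congr 1
    by_cases h : n + 1 ≤ 0
    · rw [if_pos h, if_neg (by omega)]
      omega
    · rw [if_neg h]
      by_cases h' : 0 ≤ n + -2 + 1
      · rw [if_pos h']
        simp
        omega
      · rw [if_neg h']
        omega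
  rw [nprod_add_left, smul_add, ← key 0 _ h₀, ← key 1 _ h₁, ← nprod_add_left]
  congr 1
  exact A.nprod_add_left _ _ _ _

/-- The Borcherds identity applied to the vacuum with m = 0, k = -2. By the creation property only
the terms with b_(-2)|0⟩ = Tb and b_(-1)|0⟩ = b survive. -/
lemma T_nprod (n : ℤ) (a b : V) :
    A.T (A.nprod n a b) = A.nprod n a (A.T b) + (-n) • A.nprod (n - 1) a b := by
  have key : ∀ i j, ∀ a ∈ A.parity i, ∀ b ∈ A.parity j,
      A.T (A.nprod n a b) = A.nprod n a (A.T b) + (-n) • A.nprod (n - 1) a b := by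
    intro i j a ha b hb
    have h := A.nprodSystem_borcherds ha hb A.vac 0 (-2) n
    rw [finsum_eq_single _ 0
      (fun j hj => by simp [Ring.choose_zero_pos ℤ (Nat.pos_of_ne_zero hj)]),
      A.nprodSystem.finsum_prod_prod_right (N := 0) (N' := 0) (L := 2)
        (fun i hi => A.nprod_vac_of_nonneg hi b) (fun i hi => A.nprod_vac_of_nonneg hi a)
        (by norm_num) (by norm_num)] at h
    simp only [nprodSystem, nprodHom_apply, Finset.sum_range_succ, Finset.sum_range_zero] at h
    simp [nprod_vac_of_nonneg, nprod_zero_right, nprod_neg_one_vac] at h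
    simpa [VertexAlgebra.T] using h
  have hT : ∀ x y, A.T (x + y) = A.T x + A.T y := fun x y => A.nprod_add_left _ _ _ _
  obtain ⟨a₀, h₀, a₁, h₁, rfl⟩ := A.exists_parity_add a
  obtain ⟨b₀, g₀, b₁, g₁, rfl⟩ := A.exists_parity_add b
  simp only [nprod_add_left, nprod_add_right, hT, smul_add]
  rw [key 0 0 _ h₀ _ g₀, key 0 1 _ h₀ _ g₁, key 1 0 _ h₁ _ g₀, key 1 1 _ h₁ _ g₁]
  abel

/-! ### Rescaled products on ℂ[ħ, ħ⁻¹] ⊗ V, which absorb the powers of ħ. -/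

/-- The space `ℂ[ħ, ħ⁻¹] ⊗ V`. -/
abbrev VH (_ : GradedVertexAlgebra Γ V) : Type _ := ℂ[T;T⁻¹] ⊗[ℂ] V

/-- The rescaled product `ħ^{n+1} a_(n) b` on `ℂ[ħ, ħ⁻¹] ⊗ V`. -/
def prodH (n : ℤ) : A.VH →ₗ[ℂ[T;T⁻¹]] A.VH →ₗ[ℂ[T;T⁻¹]] A.VH :=
  LinearMap.liftBaseChange ℂ[T;T⁻¹]
    (((LinearMap.liftBaseChangeEquiv ℂ[T;T⁻¹]).toLinearMap.restrictScalars ℂ).comp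
      ((A.nprodHom n).compr₂ (TensorProduct.mk ℂ ℂ[T;T⁻¹] V (LaurentPolynomial.T (n + 1)))))

lemma prodH_tmul (n : ℤ) (f g : ℂ[T;T⁻¹]) (a b : V) :
    A.prodH n (f ⊗ₜ a) (g ⊗ₜ b) = (f * g * LaurentPolynomial.T (n + 1)) ⊗ₜ A.nprod n a b := by
  simp [prodH, TensorProduct.smul_tmul', mul_assoc]

lemma prodH_one_tmul (n : ℤ) (a b : V) : A.prodH n (1 ⊗ₜ a) (1 ⊗ₜ b) =
    (LaurentPolynomial.T (n + 1) : ℂ[T;T⁻¹]) ⊗ₜ A.nprod n a b := by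
  rw [prodH_tmul, one_mul, one_mul]

/-- The rescaled products on `ℂ[ħ, ħ⁻¹] ⊗ V`. -/
def systemH : ProductSystem ℂ[T;T⁻¹] A.VH where
  prod := A.prodH
  exists_prod_eq_zero x y := by
    induction x using TensorProduct.induction_on with
    | zero => exact ⟨0, by simp⟩
    | add x x' hx hx' =>
      obtain ⟨N, hN⟩ := hx
      obtain ⟨N', hN'⟩ := hx'
      exact ⟨max N N', fun n hn => by
        rw [LinearMap.map_add₂, hN n (by omega), hN' n (by omega), add_zero]⟩
    | tmul f a =>
      induction y using TensorProduct.induction_on with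
      | zero => exact ⟨0, by simp⟩
      | add x x' hx hx' =>
        obtain ⟨N, hN⟩ := hx
        obtain ⟨N', hN'⟩ := hx'
        exact ⟨max N N', fun n hn => by
          rw [map_add, hN n (by omega), hN' n (by omega), add_zero]⟩
      | tmul g b =>
        obtain ⟨N, hN⟩ := A.nprod_eventually_zero a b
        exact ⟨N, fun n hn => by rw [prodH_tmul, hN n hn, TensorProduct.tmul_zero]⟩

lemma systemH_prod (n : ℤ) : A.systemH.prod n = A.prodH n := rfl

/-- Every term of the identity acquires the same power ħ^{m+k+n+2}, so the identity of V carries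
over. -/
lemma systemH_borcherds {i j : ZMod 2} {a b : V} (ha : a ∈ A.parity i) (hb : b ∈ A.parity j) :
    A.systemH.Borcherds (koszulSign i j) (1 ⊗ₜ a) (1 ⊗ₜ b) := by
  intro z m k n
  obtain ⟨N, hN⟩ := A.systemH.exists_prod_eq_zero (1 ⊗ₜ a) (1 ⊗ₜ b)
  obtain ⟨M, hM⟩ := A.nprod_eventually_zero a b
  -- Formulated with finite sums for all large L, so that it is additive in z and can be proved by
  -- induction over tensors.
  have main : ∀ᶠ L : ℕ in Filter.atTop, ∑ j ∈ Finset.range L, Ring.choose m j •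
      A.systemH.prod (m + k - j) (A.systemH.prod (n + j) (1 ⊗ₜ a) (1 ⊗ₜ b)) z =
      ∑ l ∈ Finset.range L, ((-1) ^ l * Ring.choose n l : ℤ) •
      (A.systemH.prod (m + n - l) (1 ⊗ₜ a) (A.systemH.prod (k + l) (1 ⊗ₜ b) z) -
        (koszulSign i j * (-1 : ℂ) ^ n) •
          A.systemH.prod (k + n - l) (1 ⊗ₜ b) (A.systemH.prod (m + l) (1 ⊗ₜ a) z)) := by
    induction z using TensorProduct.induction_on with
    | zero => simp
    | add z z' hz hz' =>
      filter_upwards [hz, hz'] with L h h'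
      simp only [map_add, smul_add, Finset.sum_add_distrib]
      rw [h, h', ← Finset.sum_add_distrib]
      refine Finset.sum_congr rfl fun l _ => ?_
      simp only [smul_sub, smul_add]
      abel
    | tmul g c =>
      obtain ⟨P, hP⟩ := A.nprod_eventually_zero b c
      obtain ⟨Q, hQ⟩ := A.nprod_eventually_zero a c
      filter_upwards [Filter.eventually_ge_atTop
        ((M - n).toNat + (P - k).toNat + (Q - m).toNat)] with L hL
      have h := A.nprodSystem_borcherds ha hb c m k n
      rw [A.nprodSystem.finsum_prod_prod_left hM (L := L) (by omega),
        A.nprodSystem.finsum_prod_prod_right hP hQ (L := L) (by omega) (by omega)] at h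
      have h2 := congrArg (TensorProduct.mk ℂ ℂ[T;T⁻¹] V
        (g * LaurentPolynomial.T (m + k + n + 2))) h
      simp only [map_sum, map_zsmul, map_sub, map_smul, nprodSystem, nprodHom_apply,
        TensorProduct.mk_apply] at h2
      simp only [systemH_prod, prodH_tmul]
      convert h2 using 3 with l _ l _
      · congr 1
        rw [one_mul, one_mul, mul_right_comm, mul_comm g, ← LaurentPolynomial.T_add]
        congr 2
        ring
      · congr 1
        · congr 1
          rw [one_mul, one_mul, mul_assoc, ← LaurentPolynomial.T_add]
          congr 2
          ring
        · congr 2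
          rw [one_mul, one_mul, mul_assoc, ← LaurentPolynomial.T_add]
          congr 2
          ring
  obtain ⟨P, hP⟩ := A.systemH.exists_prod_eq_zero (1 ⊗ₜ b) z
  obtain ⟨Q, hQ⟩ := A.systemH.exists_prod_eq_zero (1 ⊗ₜ a) z
  obtain ⟨L, h, hL⟩ := (main.and (Filter.eventually_ge_atTop
    ((N - n).toNat + (P - k).toNat + (Q - m).toNat))).exists
  rw [A.systemH.finsum_prod_prod_left hN (L := L) (by omega),
    A.systemH.finsum_prod_prod_right hP hQ (L := L) (by omega) (by omega)]
  exact h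

/-- The translation operator of `V`, as a linear map. -/
def transHom : Module.End ℂ V := (A.nprodHom (-2)).flip A.vac

@[simp] lemma transHom_apply (a : V) : A.transHom a = A.T a := rfl

/-- The translation operator `ħ⁻¹ T` of the rescaled products. -/
def transH : Module.End ℂ[T;T⁻¹] A.VH :=
  (LaurentPolynomial.T (-1) : ℂ[T;T⁻¹]) • A.transHom.baseChange ℂ[T;T⁻¹]

lemma transH_tmul (f : ℂ[T;T⁻¹]) (a : V) :
    A.transH (f ⊗ₜ a) = (LaurentPolynomial.T (-1) * f) ⊗ₜ A.T a := by
  simp [transH, TensorProduct.smul_tmul']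

/-- The energy operator of `ℂ[ħ, ħ⁻¹] ⊗ V`. -/
def energyH : Module.End ℂ[T;T⁻¹] A.VH := A.H.baseChange ℂ[T;T⁻¹]

/-- The vacuum of `ℂ[ħ, ħ⁻¹] ⊗ V`. -/
def vacuumH : A.VH := 1 ⊗ₜ A.vac

lemma ext_VH₂ {M : Type*} [AddCommGroup M] [Module ℂ[T;T⁻¹] M]
    {f g : A.VH →ₗ[ℂ[T;T⁻¹]] A.VH →ₗ[ℂ[T;T⁻¹]] M}
    (h : ∀ a b : V, f (1 ⊗ₜ a) (1 ⊗ₜ b) = g (1 ⊗ₜ a) (1 ⊗ₜ b)) : f = g := by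
  refine LinearMap.ext fun x => LinearMap.ext fun y => ?_
  induction x using TensorProduct.induction_on with
  | zero => simp
  | add x x' h h' => rw [LinearMap.map_add₂, LinearMap.map_add₂, h, h']
  | tmul c a =>
    induction y using TensorProduct.induction_on with
    | zero => simp
    | add x x' h h' => rw [map_add, map_add, h, h']
    | tmul d b =>
      have hc : ∀ (c : ℂ[T;T⁻¹]) (a : V), c ⊗ₜ[ℂ] a = c • (1 ⊗ₜ[ℂ] a) := fun c a => by
        rw [TensorProduct.smul_tmul', smul_eq_mul, mul_one]
      rw [hc c, hc d, map_smul, map_smul, map_smul, LinearMap.smul_apply, h, map_smul,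
        LinearMap.smul_apply]

/-- The factor ħ⁻¹ in `transH` compensates the change of index from n to n - 1 in ħ^{n+1}. -/
lemma prodH_transH (n : ℤ) (x y : A.VH) :
    A.prodH n (A.transH x) y = (-n) • A.prodH (n - 1) x y := by
  have h : (A.prodH n).comp A.transH = (-n) • A.prodH (n - 1) := A.ext_VH₂ fun a b => by
    simp only [LinearMap.comp_apply, transH_tmul, LinearMap.smul_apply, prodH_tmul, mul_one,
      one_mul, ← LaurentPolynomial.T_add, nprod_T, TensorProduct.tmul_smul]
    congr 3
    ring
  exact LinearMap.congr_fun₂ h x y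

lemma transH_prodH (n : ℤ) (x y : A.VH) :
    A.transH (A.prodH n x y) = A.prodH n x (A.transH y) + (-n) • A.prodH (n - 1) x y := by
  have h : (A.prodH n).compr₂ A.transH =
      (A.prodH n).compl₂ A.transH + (-n) • A.prodH (n - 1) := A.ext_VH₂ fun a b => by
    simp only [LinearMap.compr₂_apply, LinearMap.compl₂_apply, transH_tmul, LinearMap.smul_apply,
      LinearMap.add_apply, prodH_tmul, mul_one, one_mul, ← LaurentPolynomial.T_add, T_nprod,
      TensorProduct.tmul_smul, TensorProduct.tmul_add]
    congr 4
    ring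
  exact LinearMap.congr_fun₂ h x y

lemma prodH_vacuumH_left (n : ℤ) (y : A.VH) :
    A.prodH n A.vacuumH y = if n = -1 then y else 0 := by
  induction y using TensorProduct.induction_on with
  | zero => simp
  | add y y' h h' =>
    rw [map_add, h, h']
    split_ifs <;> simp
  | tmul g b =>
    rw [vacuumH, prodH_tmul, nprod_vac_left]
    split_ifs with h
    · subst h
      simp
    · simp

lemma prodH_vacuumH_of_nonneg {n : ℤ} (hn : 0 ≤ n) (x : A.VH) : A.prodH n x A.vacuumH = 0 := by
  induction x using TensorProduct.induction_on with
  | zero => simp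
  | add y y' h h' => rw [LinearMap.map_add₂, h, h', add_zero]
  | tmul g b => rw [vacuumH, prodH_tmul, A.nprod_vac_of_nonneg hn, TensorProduct.tmul_zero]

lemma prodH_neg_one_vacuumH (x : A.VH) : A.prodH (-1) x A.vacuumH = x := by
  induction x using TensorProduct.induction_on with
  | zero => simp
  | add y y' h h' => rw [LinearMap.map_add₂, h, h']
  | tmul g b => rw [vacuumH, prodH_tmul, nprod_neg_one_vac]; simp

/-- The part `V^{[α]}[Δ]` of `ℂ[ħ, ħ⁻¹] ⊗ V`. -/
def pieceH (α : Γ) (Δ : ℝ) : Submodule ℂ[T;T⁻¹] A.VH :=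
  Submodule.span _ ((fun a => 1 ⊗ₜ a) '' (A.piece α Δ : Set V))

lemma one_tmul_mem_pieceH {α : Γ} {Δ : ℝ} {a : V} (ha : a ∈ A.piece α Δ) :
    1 ⊗ₜ a ∈ A.pieceH α Δ := Submodule.subset_span ⟨a, ha, rfl⟩

lemma tmul_mem_pieceH {α : Γ} {Δ : ℝ} {a : V} (ha : a ∈ A.piece α Δ) (f : ℂ[T;T⁻¹]) :
    f ⊗ₜ a ∈ A.pieceH α Δ := by
  have := Submodule.smul_mem _ f (A.one_tmul_mem_pieceH ha)
  rwa [TensorProduct.smul_tmul', smul_eq_mul, mul_one] at this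

lemma pieceH_le {α : Γ} {Δ : ℝ} {S : Submodule ℂ[T;T⁻¹] A.VH}
    (h : ∀ a ∈ A.piece α Δ, 1 ⊗ₜ a ∈ S) : A.pieceH α Δ ≤ S :=
  Submodule.span_le.2 (by rintro _ ⟨a, ha, rfl⟩; exact h a ha)

lemma prodH_mem_pieceH {α β : Γ} {Δ Δ' : ℝ} {x y : A.VH} (hx : x ∈ A.pieceH α Δ)
    (hy : y ∈ A.pieceH β Δ') (n : ℤ) : A.prodH n x y ∈ A.pieceH (α + β) (Δ + Δ' - n - 1) := by
  have h1 : A.pieceH α Δ ≤ (A.pieceH (α + β) (Δ + Δ' - n - 1)).comap ((A.prodH n).flip y) := by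
    refine A.pieceH_le fun a ha => ?_
    have h2 : A.pieceH β Δ' ≤
        (A.pieceH (α + β) (Δ + Δ' - n - 1)).comap (A.prodH n (1 ⊗ₜ a)) := by
      refine A.pieceH_le fun b hb => ?_
      rw [Submodule.mem_comap, prodH_one_tmul]
      exact A.tmul_mem_pieceH (A.nprod_mem_piece ha hb n) _
    exact h2 hy
  exact h1 hx

lemma vac_mem_piece : A.vac ∈ A.piece 0 0 :=
  ⟨A.vac_deg, Module.End.mem_eigenspace_iff.2 (by rw [A.H_vac]; simp)⟩

lemma vacuumH_mem_pieceH : A.vacuumH ∈ A.pieceH 0 0 := A.one_tmul_mem_pieceH A.vac_mem_piece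

lemma T_mem_piece {α : Γ} {Δ : ℝ} {a : V} (ha : a ∈ A.piece α Δ) :
    A.T a ∈ A.piece α (Δ + 1) := by
  have := A.nprod_mem_piece ha A.vac_mem_piece (-2)
  rw [add_zero] at this
  change A.nprod (-2) a A.vac ∈ _
  convert this using 2
  push_cast
  ring

lemma transH_mem_pieceH {α : Γ} {Δ : ℝ} {x : A.VH} (hx : x ∈ A.pieceH α Δ) :
    A.transH x ∈ A.pieceH α (Δ + 1) := by
  have h : A.pieceH α Δ ≤ (A.pieceH α (Δ + 1)).comap A.transH := by
    refine A.pieceH_le fun a ha => ?_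
    rw [Submodule.mem_comap, transH_tmul]
    exact A.tmul_mem_pieceH (A.T_mem_piece ha) _
  exact h hx

lemma energyH_of_mem_pieceH {α : Γ} {Δ : ℝ} {x : A.VH} (hx : x ∈ A.pieceH α Δ) :
    A.energyH x = (Δ : ℂ) • x := by
  have h : A.pieceH α Δ ≤ LinearMap.ker (A.energyH - (Δ : ℂ) • LinearMap.id) := by
    refine A.pieceH_le fun a ha => ?_
    rw [LinearMap.mem_ker]
    simp only [LinearMap.sub_apply, LinearMap.smul_apply, LinearMap.id_apply, energyH,
      LinearMap.baseChange_tmul, Module.End.mem_eigenspace_iff.1 ha.2]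
    rw [TensorProduct.tmul_smul, sub_self]
  have := LinearMap.mem_ker.1 (h hx)
  rwa [LinearMap.sub_apply, sub_eq_zero] at this

end GradedVertexAlgebra

/-! ### The representatives ε and the correction χ. -/

lemma mem_zmultiples_one {x : ℝ} : x ∈ AddSubgroup.zmultiples (1 : ℝ) ↔ ∃ k : ℤ, x = k := by
  simp [AddSubgroup.mem_zmultiples_iff, eq_comm]

lemma epsReal_add_intCast (x : ℝ) (k : ℤ) : epsReal (x + k) = epsReal x := by
  simp [epsReal]

lemma epsReal_of_mem {x : ℝ} (hx : x ∈ AddSubgroup.zmultiples (1 : ℝ)) : epsReal x = 0 := by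
  obtain ⟨k, rfl⟩ := mem_zmultiples_one.1 hx
  simp [epsReal]

lemma epsReal_congr {x y : ℝ} (h : x - y ∈ AddSubgroup.zmultiples (1 : ℝ)) :
    epsReal x = epsReal y := by
  obtain ⟨k, hk⟩ := mem_zmultiples_one.1 h
  rw [show x = y + k by linarith, epsReal_add_intCast]

namespace GradedVertexAlgebra

lemma chi_congr {x y x' y' : ℝ} (hx : x - x' ∈ AddSubgroup.zmultiples (1 : ℝ))
    (hy : y - y' ∈ AddSubgroup.zmultiples (1 : ℝ)) : chi x y = chi x' y' := by
  rw [chi, chi, epsReal_congr hx, epsReal_congr hy]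

lemma chi_comm (x y : ℝ) : chi x y = chi y x := by
  rw [chi, chi, add_comm]

lemma chi_le_one (x y : ℝ) : chi x y ≤ 1 := by
  rw [chi]
  split_ifs <;> norm_num

/-- Each ε lies in (-1, 0], so the sum of two lies in (-2, 0]; being an integer it is 0 or -1. This
turns χ, defined by a case distinction, into an expression that fits the exponents γ. -/
lemma chi_eq_neg {x y : ℝ} (h : x + y ∈ AddSubgroup.zmultiples (1 : ℝ)) :
    (chi x y : ℝ) = -(epsReal x + epsReal y) := by
  obtain ⟨k, hk⟩ := mem_zmultiples_one.1 h
  have e : epsReal x + epsReal y = ((k - ⌈x⌉ - ⌈y⌉ : ℤ) : ℝ) := by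
    push_cast
    rw [← hk, epsReal, epsReal]
    ring
  have h1 : -2 < epsReal x + epsReal y := by
    rw [epsReal, epsReal]
    linarith [Int.ceil_lt_add_one x, Int.ceil_lt_add_one y]
  have h2 : epsReal x + epsReal y ≤ 0 := by
    rw [epsReal, epsReal]
    linarith [Int.le_ceil x, Int.le_ceil y]
  rw [chi]
  rw [e] at h1 h2 ⊢
  have h1' : -2 < k - ⌈x⌉ - ⌈y⌉ := by exact_mod_cast h1
  have h2' : k - ⌈x⌉ - ⌈y⌉ ≤ 0 := by exact_mod_cast h2
  split_ifs with h
  · have h' : k - ⌈x⌉ - ⌈y⌉ ≤ -1 := by exact_mod_cast h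
    rw [show k - ⌈x⌉ - ⌈y⌉ = -1 by omega]
    norm_num
  · have h' : ¬ k - ⌈x⌉ - ⌈y⌉ ≤ -1 := by
      intro h'
      exact h (by exact_mod_cast h')
    rw [show k - ⌈x⌉ - ⌈y⌉ = 0 by omega]
    norm_num

lemma chi_of_mem {x y : ℝ} (hx : x ∈ AddSubgroup.zmultiples (1 : ℝ))
    (hy : y ∈ AddSubgroup.zmultiples (1 : ℝ)) : chi x y = 0 := by
  rw [chi, epsReal_of_mem hx, epsReal_of_mem hy]
  norm_num

variable {Γ : AddSubgroup ℝ} {V : Type*} [AddCommGroup V] [Module ℂ V]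
  (A : GradedVertexAlgebra Γ V)

/-! ### The ideal J_p inside ℂ[ħ, ħ⁻¹] ⊗ V, and a large supply of its elements. -/

/-- The inclusion `V_{Γ,ħ} → ℂ[ħ, ħ⁻¹] ⊗ V`. -/
def inclH : A.VGammaH →ₗ[ℂ[T;T⁻¹]] A.VH := A.VGamma.subtype.baseChange ℂ[T;T⁻¹]

@[simp] lemma inclH_tmul (f : ℂ[T;T⁻¹]) (a : A.VGamma) : A.inclH (f ⊗ₜ a) = f ⊗ₜ (a : V) := rfl

lemma inclH_injective : Function.Injective A.inclH :=
  Module.Flat.lTensor_preserves_injective_linearMap A.VGamma.subtype A.VGamma.injective_subtype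

/-- The image of `J_p` in `ℂ[ħ, ħ⁻¹] ⊗ V`. -/
def JH (p : ℕ) : Submodule ℂ[T;T⁻¹] A.VH := (A.J p).map A.inclH

lemma inclH_mem_JH {p : ℕ} {x : A.VGammaH} : A.inclH x ∈ A.JH p ↔ x ∈ A.J p :=
  A.inclH_injective.mem_set_image

lemma smul_mem_JH {p : ℕ} (c : ℂ) {x : A.VH} (hx : x ∈ A.JH p) : c • x ∈ A.JH p :=
  Submodule.smul_of_tower_mem _ c hx

/-- Powers of ħ are units, so the rescaling does not affect membership in a submodule. -/
lemma T_smul_mem_iff {M : Type*} [AddCommGroup M] [Module ℂ[T;T⁻¹] M]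
    (S : Submodule ℂ[T;T⁻¹] M) (n : ℤ) (x : M) :
    (LaurentPolynomial.T n : ℂ[T;T⁻¹]) • x ∈ S ↔ x ∈ S :=
  Submodule.smul_mem_iff_of_isUnit S (LaurentPolynomial.isUnit_T n)

/-- The dictionary between a_{[n,p]} b and residues: ħ^{n+1} ħ^j = ħ^{(n+j)+1} is the rescaling
factor of the product with index n + j. -/
lemma inclH_modProd (p : ℕ) (γ : ℝ) (n : ℤ) (a b : V) (hab : ∀ m, A.nprod m a b ∈ A.VGamma) :
    (LaurentPolynomial.T (n + 1) : ℂ[T;T⁻¹]) •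
      A.inclH (A.modProd p γ n fun m => ⟨A.nprod m a b, hab m⟩) =
    A.systemH.bracket ((γ + p : ℝ) : ℂ) n (1 ⊗ₜ a) (1 ⊗ₜ b) := by
  obtain ⟨N, hN⟩ := A.nprod_eventually_zero a b
  have hc : ∀ m, N ≤ m → (⟨A.nprod m a b, hab m⟩ : A.VGamma) = 0 := fun m hm =>
    Subtype.ext (hN m hm)
  obtain ⟨M, h, hM⟩ := ((A.systemH.bracket_eventually ((γ + p : ℝ) : ℂ) n (1 ⊗ₜ a) (1 ⊗ₜ b)).and
    (Filter.eventually_ge_atTop (N - n).toNat)).exists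
  rw [h, modProd, finsum_eq_sum_of_support_subset (s := Finset.range M), map_sum, Finset.smul_sum]
  · refine Finset.sum_congr rfl fun j _ => ?_
    rw [inclH_tmul, systemH_prod, prodH_one_tmul, TensorProduct.smul_tmul',
      TensorProduct.smul_tmul', smul_eq_mul, mul_left_comm, ← LaurentPolynomial.T_add,
      ← LaurentPolynomial.smul_eq_C_mul]
    congr 3
    ring
  · intro j hj
    by_contra hlt
    simp only [Finset.coe_range, Set.mem_Iio, not_lt] at hlt
    exact hj (by
      simp only [hc (n + j) (by omega), TensorProduct.tmul_zero])

lemma transH_add_mem {p : ℕ} {α : Γ} {Δ : ℝ} (h : (α : ℝ) - Δ ∈ AddSubgroup.zmultiples (1 : ℝ))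
    {x : A.VH} (hx : x ∈ A.pieceH α Δ) : A.transH x + (Δ : ℂ) • x ∈ A.JH p := by
  have key : A.pieceH α Δ ≤ (A.JH p).comap (A.transH + A.energyH) := by
    refine A.pieceH_le fun a ha => ?_
    have haΓ : a ∈ A.VGamma := Submodule.mem_iSup_of_mem _ (Submodule.mem_iSup_of_mem _
      (Submodule.mem_iSup_of_mem h ha))
    have hg : 1 ⊗ₜ[ℂ] (⟨A.T a, A.T_mem_VGamma haΓ⟩ : A.VGamma) +
        (LaurentPolynomial.T 1 : ℂ[T;T⁻¹]) ⊗ₜ[ℂ] (⟨A.H a, A.H_mem_VGamma a haΓ⟩ : A.VGamma) ∈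
        A.J p := Submodule.mem_sup_left (Submodule.subset_span ⟨a, haΓ, rfl⟩)
    rw [← inclH_mem_JH, ← T_smul_mem_iff _ (-1)] at hg
    rw [Submodule.mem_comap]
    convert hg using 1
    rw [LinearMap.add_apply, transH_tmul, energyH, LinearMap.baseChange_tmul, map_add, inclH_tmul,
      inclH_tmul, smul_add, TensorProduct.smul_tmul', TensorProduct.smul_tmul', smul_eq_mul,
      smul_eq_mul, ← LaurentPolynomial.T_add]
    simp
  have := key hx
  rwa [Submodule.mem_comap, LinearMap.add_apply, A.energyH_of_mem_pieceH hx] at this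

lemma bracket_transH (r : ℂ) (n : ℤ) (x y : A.VH) :
    A.systemH.bracket (r + 1) n (A.transH x) y = (-n) • A.systemH.bracket r (n - 1) x y -
      ((n : ℂ) + r + 1) • A.systemH.bracket r n x y := by
  obtain ⟨N, hN⟩ := A.systemH.exists_prod_eq_zero x y
  rw [A.systemH.bracket_apply, A.systemH.bracket_apply, A.systemH.bracket_apply,
    ← weightedSum_deriv hN]
  simp only [systemH_prod, prodH_transH]

lemma bracket_mem_base (p : ℕ) {α β : Γ} {Δ Δ' : ℝ} {x y : A.VH} (hx : x ∈ A.pieceH α Δ)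
    (hy : y ∈ A.pieceH β Δ')
    (h : ((α : ℝ) - Δ) + (β - Δ') ∈ AddSubgroup.zmultiples (1 : ℝ)) :
    A.systemH.bracket ((Δ + epsReal (α - Δ) + p : ℝ) : ℂ)
      (-2 * p - 2 + chi (α - Δ) (β - Δ')) x y ∈ A.JH p := by
  set n : ℤ := -2 * p - 2 + chi (α - Δ) (β - Δ') with hn
  set r : ℂ := ((Δ + epsReal (α - Δ) + p : ℝ) : ℂ) with hr
  have h1 : A.pieceH α Δ ≤ (A.JH p).comap ((A.systemH.bracket r n).flip y) := by
    refine A.pieceH_le fun a ha => ?_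
    have h2 : A.pieceH β Δ' ≤ (A.JH p).comap (A.systemH.bracket r n (1 ⊗ₜ a)) := by
      refine A.pieceH_le fun b hb => ?_
      rw [Submodule.mem_comap, hr, ← A.inclH_modProd p _ n a b fun m => A.nprod_mem ha hb h m,
        T_smul_mem_iff, inclH_mem_JH]
      exact Submodule.mem_sup_right (Submodule.subset_span
        ⟨α, β, Δ, Δ', a, b, ha, hb, h, rfl⟩)
    exact h2 hy
  exact h1 hx

/-- Induction on the distance d of n below the index of the generators. Integration by parts
expresses the bracket of index n - 1 through that of index n and the bracket of `transH x` of index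
n. Since `transH x` has weight Δ + 1 and the same ε, weight and vector must vary in the induction.
-/
lemma bracket_mem_of_le (p : ℕ) {α β : Γ} {Δ' : ℝ} {y : A.VH} (hy : y ∈ A.pieceH β Δ') (n : ℤ) :
    ∀ (Δ : ℝ) (x : A.VH), x ∈ A.pieceH α Δ →
      ((α : ℝ) - Δ) + (β - Δ') ∈ AddSubgroup.zmultiples (1 : ℝ) →
      n ≤ -2 * p - 2 + chi (α - Δ) (β - Δ') →
      A.systemH.bracket ((Δ + epsReal (α - Δ) + p : ℝ) : ℂ) n x y ∈ A.JH p := by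
  suffices H : ∀ d : ℕ, ∀ (Δ : ℝ) (x : A.VH), x ∈ A.pieceH α Δ →
      ((α : ℝ) - Δ) + (β - Δ') ∈ AddSubgroup.zmultiples (1 : ℝ) →
      A.systemH.bracket ((Δ + epsReal (α - Δ) + p : ℝ) : ℂ)
        (-2 * p - 2 + chi (α - Δ) (β - Δ') - d) x y ∈ A.JH p by
    intro Δ x hx h hn
    have := H (-2 * p - 2 + chi (α - Δ) (β - Δ') - n).toNat Δ x hx h
    rwa [Int.toNat_of_nonneg (by omega), sub_sub_cancel] at this
  intro d
  induction d with
  | zero =>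
    intro Δ x hx h
    rw [Nat.cast_zero, sub_zero]
    exact A.bracket_mem_base p hx hy h
  | succ d ih =>
    intro Δ x hx h
    have hint : (α : ℝ) - (Δ + 1) - (α - Δ) ∈ AddSubgroup.zmultiples (1 : ℝ) :=
      mem_zmultiples_one.2 ⟨-1, by push_cast; ring⟩
    have h0 := ih Δ x hx h
    have h1 := ih (Δ + 1) (A.transH x) (A.transH_mem_pieceH hx) (by
      have := add_mem h hint
      ring_nf at this ⊢
      exact this)
    rw [epsReal_congr hint, chi_congr hint (y' := (β : ℝ) - Δ') (by simp)] at h1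
    set n : ℤ := -2 * p - 2 + chi (α - Δ) (β - Δ') - d with hn
    set r : ℂ := ((Δ + epsReal (α - Δ) + p : ℝ) : ℂ) with hr
    rw [show ((Δ + 1 + epsReal (α - Δ) + p : ℝ) : ℂ) = r + 1 by rw [hr]; push_cast; ring,
      bracket_transH] at h1
    have h2 := add_mem h1 (A.smul_mem_JH ((n : ℂ) + r + 1) h0)
    rw [sub_add_cancel, ← Int.cast_smul_eq_zsmul ℂ] at h2
    have h3 := A.smul_mem_JH (((-n : ℤ) : ℂ)⁻¹) h2
    -- Division by -n is possible because χ ≤ 1 gives n ≤ -2p - 1 < 0.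
    have hn0 : ((-n : ℤ) : ℂ) ≠ 0 := by
      rw [Int.cast_ne_zero]
      have := chi_le_one (α - Δ) (β - Δ')
      omega
    rw [inv_smul_smul₀ hn0] at h3
    rwa [show -2 * (p : ℤ) - 2 + chi (α - Δ) (β - Δ') - (d + 1 : ℕ) = n - 1 by
      rw [hn]; push_cast; ring]

/-- The modified products lying in `J_p`. -/
lemma bracket_mem (p : ℕ) {α β : Γ} {Δ Δ' : ℝ} {x y : A.VH} (hx : x ∈ A.pieceH α Δ)
    (hy : y ∈ A.pieceH β Δ')
    (h : ((α : ℝ) - Δ) + (β - Δ') ∈ AddSubgroup.zmultiples (1 : ℝ)) (e : ℕ) {r : ℂ}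
    (hr : r = ((Δ + epsReal (α - Δ) + p : ℝ) : ℂ) + e) {n : ℤ}
    (hn : n + e ≤ -2 * p - 2 + chi (α - Δ) (β - Δ')) : A.systemH.bracket r n x y ∈ A.JH p := by
  -- Expanding (1 + z)^e raises n by at most e, which is the room left by `hn`.
  rw [hr, A.systemH.bracket_add_natCast]
  refine sum_mem fun q hq => zsmul_mem (A.bracket_mem_of_le p hy _ Δ x hx h ?_) _
  simp only [Finset.mem_range] at hq
  omega

/-- The inner bracket is a sum of vectors y_(k+j) z of different weights but with the same class
modulo ℤ, and χ depends only on that class. Hence the second argument may be any such bracket, with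
arbitrary s and k. -/
lemma bracket_bracket_mem (p : ℕ) {α β γ : Γ} {Δ Δ' Δ'' : ℝ} {x y z : A.VH}
    (hx : x ∈ A.pieceH α Δ) (hy : y ∈ A.pieceH β Δ') (hz : z ∈ A.pieceH γ Δ'')
    (h : ((α : ℝ) - Δ) + ((β - Δ') + (γ - Δ'')) ∈ AddSubgroup.zmultiples (1 : ℝ)) (e : ℕ) {r : ℂ}
    (hr : r = ((Δ + epsReal (α - Δ) + p : ℝ) : ℂ) + e) {n : ℤ}
    (hn : n + e ≤ -2 * p - 2 + chi (α - Δ) ((β - Δ') + (γ - Δ''))) (s : ℂ) (k : ℤ) :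
    A.systemH.bracket r n x (A.systemH.bracket s k y z) ∈ A.JH p := by
  obtain ⟨M, hM⟩ := (A.systemH.bracket_eventually s k y z).exists
  rw [hM, map_sum]
  refine sum_mem fun j _ => ?_
  rw [LinearMap.map_smul_of_tower]
  have hint : (((β + γ : Γ) : ℝ) - (Δ' + Δ'' - (k + j : ℤ) - 1)) - ((β - Δ') + (γ - Δ'')) ∈
      AddSubgroup.zmultiples (1 : ℝ) :=
    mem_zmultiples_one.2 ⟨k + j + 1, by push_cast; ring⟩
  refine A.smul_mem_JH _ (A.bracket_mem p hx (A.prodH_mem_pieceH hy hz (k + j)) ?_ e hr ?_)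
  · have := add_mem h hint
    ring_nf at this ⊢
    exact this
  · rwa [chi_congr (x' := (α : ℝ) - Δ) (by simp) hint]

end GradedVertexAlgebra

/-! ### The Zhu product through residues: left and right ideal property, associativity. -/

lemma succ_mul_choose_succ (r : ℤ) (m : ℕ) :
    ((m : ℤ) + 1) * Ring.choose r (m + 1) = (r - m) * Ring.choose r m := by
  have := Ring.choose_smul_choose r (n := m + 1) (k := m) (by omega)
  simp only [Nat.choose_succ_self_right, nsmul_eq_mul, add_tsub_cancel_left,
    Ring.choose_one_right] at this
  push_cast at this
  rw [this, mul_comm]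

lemma zsmul_sub_zsmul_mem {R M : Type*} [Ring R] [AddCommGroup M] [Module R M] {S : Submodule R M}
    (n : ℤ) {x y : M} (h : x - y ∈ S) : n • x - n • y ∈ S := by
  rw [← zsmul_sub]
  exact zsmul_mem h n

namespace ProductSystem

variable {R W : Type*} [CommRing R] [Algebra ℂ R] [AddCommGroup W] [Module ℂ W] [Module R W]
  [IsScalarTower ℂ R W] {S : ProductSystem R W}

/-- The Borcherds identity for `(z - w)^n w^k (1 + z)^r (1 + w)^t`. -/
theorem Borcherds.bracket_zero {κ : ℂ} {x y : W} (h : S.Borcherds κ x y) (r t : ℂ) (k n : ℤ)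
    (z : W) : ∀ᶠ M : ℕ in Filter.atTop,
    ∑ l ∈ Finset.range M, Ring.choose r l • S.bracket (r + t - l) k (S.prod (n + l) x y) z =
    ∑ j ∈ Finset.range M, ((-1) ^ j * Ring.choose n j : ℤ) •
      (S.bracket r (n - j) x (S.bracket t (k + j) y z) -
        (κ * (-1 : ℂ) ^ n) • S.bracket t (k + n - j) y (S.bracket r j x z)) := by
  filter_upwards [h.bracket r t 0 k n z] with M hM
  simp only [zero_add] at hM
  rw [← hM]
  refine Finset.sum_congr rfl fun l _ => ?_
  rw [Finset.sum_eq_single (0, l)]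
  · simp
  · rintro ⟨i, j⟩ hij hne
    have hi : 0 < i := by
      rcases Nat.eq_zero_or_pos i with rfl | hi
      · rw [Finset.HasAntidiagonal.mem_antidiagonal, zero_add] at hij
        exact absurd (congrArg (Prod.mk 0) hij) hne
      · exact hi
    simp [Ring.choose_zero_pos ℤ hi]
  · intro h
    simp at h

/-- The commutator formula for `z^m w^k (1 + z)^r (1 + w)^t`. -/
theorem Borcherds.bracket_comm {κ : ℂ} {x y : W} (h : S.Borcherds κ x y) (r t : ℂ) (m k : ℤ)
    (z : W) : ∀ᶠ M : ℕ in Filter.atTop,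
    ∑ I ∈ Finset.range M, ∑ i ∈ Finset.HasAntidiagonal.antidiagonal I,
      Ring.choose m i.1 • Ring.choose r i.2 •
        S.bracket (r + t - i.2) (m + k - i.1) (S.prod I x y) z =
      S.bracket r m x (S.bracket t k y z) - κ • S.bracket t k y (S.bracket r m x z) := by
  filter_upwards [h.bracket r t m k 0 z, Filter.eventually_ge_atTop 1] with M hM h1
  simp only [zero_add] at hM
  rw [hM, Finset.sum_eq_single 0]
  · simp
  · intro j _ hj
    simp [Ring.choose_zero_pos ℤ (Nat.pos_of_ne_zero hj)]
  · intro h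
    simp only [Finset.mem_range] at h
    omega

variable (S)

/-- The sum `∑_{m=0}^p binom(-p-1, m) x_{[-p-1-m, p]} y` with `γ` in place of `γ_x`. -/
def zhuProd (p : ℕ) (γ : ℝ) : W →ₗ[R] W →ₗ[R] W :=
  ∑ m ∈ Finset.range (p + 1), Ring.choose (-p - 1 : ℤ) m •
    S.bracket ((γ + p : ℝ) : ℂ) (-p - 1 - m)

lemma zhuProd_apply (p : ℕ) (γ : ℝ) (x y : W) : S.zhuProd p γ x y =
    ∑ m ∈ Finset.range (p + 1), Ring.choose (-p - 1 : ℤ) m •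
      S.bracket ((γ + p : ℝ) : ℂ) (-p - 1 - m) x y := by
  simp [zhuProd, LinearMap.sum_apply]

/-- The binomial expansion of 1 = ((1 + w) - w)^q, inserted in the residue. -/
lemma sum_antidiagonal_bracket (q : ℕ) (s : ℂ) (k : ℤ) (y z : W) :
    ∑ i ∈ Finset.HasAntidiagonal.antidiagonal q, q.choose i.1 • ((-1 : ℤ) ^ i.2 •
      S.bracket (s + i.1) (k + i.2) y z) = S.bracket s k y z := by
  induction q generalizing s k with
  | zero => simp
  | succ q ih =>
    rw [Finset.sum_antidiagonal_choose_succ_nsmul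
      (fun i j => (-1 : ℤ) ^ j • S.bracket (s + i) (k + j) y z)]
    have h1 : ∀ i j : ℕ, S.bracket (s + i) (k + (j + 1 : ℕ)) y z =
        S.bracket (s + i) (k + 1 + j) y z := fun i j => by
      congr 3
      push_cast
      ring
    have h2 : ∀ i j : ℕ, S.bracket (s + (i + 1 : ℕ)) (k + j) y z =
        S.bracket (s + 1 + i) (k + j) y z := fun i j => by
      congr 3
      push_cast
      ring
    simp only [h1, h2, pow_succ, mul_neg_one, neg_smul, smul_neg, Finset.sum_neg_distrib]
    rw [ih]
    have h3 : ∑ i ∈ Finset.HasAntidiagonal.antidiagonal q, q.choose i.2 • ((-1 : ℤ) ^ i.2 •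
        S.bracket (s + 1 + i.1) (k + i.2) y z) = S.bracket (s + 1) k y z := by
      rw [← ih (s + 1)]
      refine Finset.sum_congr rfl fun i hi => ?_
      rw [← Finset.HasAntidiagonal.mem_antidiagonal.1 hi, Nat.choose_symm_add]
    rw [h3, S.bracket_add_one]
    abel

end ProductSystem

namespace GradedVertexAlgebra

variable {Γ : AddSubgroup ℝ} {V : Type*} [AddCommGroup V] [Module ℂ V]
  (A : GradedVertexAlgebra Γ V)

/-- Left multiplication preserves the part of `J_p` spanned by modified products. -/
lemma bracket_left_mem {p : ℕ} {α β γ : Γ} {Δ Δ' Δ'' : ℝ} {a b c : A.VH}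
    (ha : a ∈ A.pieceH α Δ) (hb : b ∈ A.pieceH β Δ') (hc : c ∈ A.pieceH γ Δ'')
    (h : ((α : ℝ) - Δ) + (β - Δ') ∈ AddSubgroup.zmultiples (1 : ℝ))
    (hγ : (γ : ℝ) - Δ'' ∈ AddSubgroup.zmultiples (1 : ℝ)) {κ : ℂ}
    (hκ : A.systemH.Borcherds κ c a) {m : ℤ} (hm : m ≤ -p - 1) :
    A.systemH.bracket ((Δ'' + p : ℝ) : ℂ) m c
      (A.systemH.bracket ((Δ + epsReal (α - Δ) + p : ℝ) : ℂ)
        (-2 * p - 2 + chi (α - Δ) (β - Δ')) a b) ∈ A.JH p := by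
  set k : ℤ := -2 * p - 2 + chi (α - Δ) (β - Δ') with hk
  -- The commutator formula trades c_[m] (a_[k] b) for brackets of c_(I) a with b, plus a sign times
  -- a_[k] (c_[m] b). The last one keeps the index k of a generator, since multiplying b by c does
  -- not change its class.
  obtain ⟨M, hM⟩ := (hκ.bracket_comm ((Δ'' + p : ℝ) : ℂ) ((Δ + epsReal (α - Δ) + p : ℝ) : ℂ)
    m k b).exists
  rw [eq_sub_iff_add_eq] at hM
  rw [← hM]
  refine add_mem (sum_mem fun I _ => sum_mem ?_) (A.smul_mem_JH _ ?_)
  · rintro ⟨i, l⟩ hil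
    simp only [Finset.HasAntidiagonal.mem_antidiagonal] at hil
    refine zsmul_mem (A.smul_mem_JH _ ?_) _
    have hint : (((γ + α : Γ) : ℝ) - (Δ'' + Δ - (I : ℤ) - 1)) - (α - Δ) ∈
        AddSubgroup.zmultiples (1 : ℝ) := by
      obtain ⟨u, hu⟩ := mem_zmultiples_one.1 hγ
      refine mem_zmultiples_one.2 ⟨u + I + 1, ?_⟩
      push_cast
      linarith
    -- The vector c_(I) a has weight Δ'' + Δ - I - 1, so with I = i + l the excess of the exponent
    -- is I + 1 + p - l = i + p + 1. The index plus the excess is m + k + p + 1, which is at most k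
    -- exactly when m ≤ -p - 1.
    refine A.bracket_mem p (A.prodH_mem_pieceH hc ha I) hb ?_ (i + p + 1) ?_ ?_
    · have := add_mem h hint
      ring_nf at this ⊢
      exact this
    · rw [epsReal_congr hint, ← hil]
      push_cast
      ring
    · rw [chi_congr (y' := (β : ℝ) - Δ') hint (by simp)]
      push_cast
      omega
  · refine A.bracket_bracket_mem p ha hc hb ?_ 0 (by simp) ?_ _ _
    · have := add_mem h hγ
      ring_nf at this ⊢
      exact this
    · rw [chi_congr (x' := (α : ℝ) - Δ) (y' := (β : ℝ) - Δ') (by simp) (by simpa using hγ)]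
      simp [hk]

lemma zhuProd_left_mem {p : ℕ} {α β γ : Γ} {Δ Δ' Δ'' : ℝ} {a b c : A.VH}
    (ha : a ∈ A.pieceH α Δ) (hb : b ∈ A.pieceH β Δ') (hc : c ∈ A.pieceH γ Δ'')
    (h : ((α : ℝ) - Δ) + (β - Δ') ∈ AddSubgroup.zmultiples (1 : ℝ))
    (hγ : (γ : ℝ) - Δ'' ∈ AddSubgroup.zmultiples (1 : ℝ)) {κ : ℂ}
    (hκ : A.systemH.Borcherds κ c a) :
    A.systemH.zhuProd p Δ'' c (A.systemH.bracket ((Δ + epsReal (α - Δ) + p : ℝ) : ℂ)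
        (-2 * p - 2 + chi (α - Δ) (β - Δ')) a b) ∈ A.JH p := by
  rw [ProductSystem.zhuProd_apply]
  exact sum_mem fun m _ => zsmul_mem (A.bracket_left_mem ha hb hc h hγ hκ (by omega)) _

/-- Right multiplication preserves the part of `J_p` spanned by modified products. -/
lemma zhuProd_right_mem {p : ℕ} {α β γ : Γ} {Δ Δ' Δ'' : ℝ} {a b c : A.VH}
    (ha : a ∈ A.pieceH α Δ) (hb : b ∈ A.pieceH β Δ') (hc : c ∈ A.pieceH γ Δ'')
    (h : ((α : ℝ) - Δ) + (β - Δ') ∈ AddSubgroup.zmultiples (1 : ℝ))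
    (hγ : (γ : ℝ) - Δ'' ∈ AddSubgroup.zmultiples (1 : ℝ)) {κ : ℂ}
    (hκ : A.systemH.Borcherds κ a b) {n : ℤ} (hn : n = -2 * p - 2 + chi (α - Δ) (β - Δ')) :
    ∀ᶠ M : ℕ in Filter.atTop, ∑ l ∈ Finset.range M,
      Ring.choose ((Δ + epsReal (α - Δ) + p : ℝ) : ℂ) l •
        A.systemH.zhuProd p (Δ + Δ' - (n + l : ℤ) - 1) (A.systemH.prod (n + l) a b) c ∈
        A.JH p := by
  have H : ∀ m ∈ Finset.range (p + 1), ∀ᶠ M : ℕ in Filter.atTop, ∑ l ∈ Finset.range M,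
      Ring.choose ((Δ + epsReal (α - Δ) + p : ℝ) : ℂ) l •
        A.systemH.bracket ((Δ + Δ' - (n + l : ℤ) - 1 + p : ℝ) : ℂ) (-p - 1 - m)
          (A.systemH.prod (n + l) a b) c ∈ A.JH p := by
    intro m _
    -- The exponent of 1 + w is γ_b + p with excess p + 1: because ε_a + ε_b = -χ, the total
    -- exponent then equals the weight of a_(n+l) b plus p. The excess is affordable since b occurs
    -- with the index -p - 1 - m + n - j.
    filter_upwards [hκ.bracket_zero ((Δ + epsReal (α - Δ) + p : ℝ) : ℂ)
      (((Δ' + epsReal (β - Δ') + p : ℝ) : ℂ) + (p + 1 : ℕ)) (-p - 1 - m) n c] with M hM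
    have hchi := chi_eq_neg h
    have hr : ∀ l : ℕ, ((Δ + Δ' - (n + l : ℤ) - 1 + p : ℝ) : ℂ) =
        ((Δ + epsReal (α - Δ) + p : ℝ) : ℂ) +
        (((Δ' + epsReal (β - Δ') + p : ℝ) : ℂ) + (p + 1 : ℕ)) - l := by
      intro l
      have : (Δ + Δ' - (n + l : ℤ) - 1 + p : ℝ) = (Δ + epsReal (α - Δ) + p) +
        ((Δ' + epsReal (β - Δ') + p) + (p + 1 : ℕ)) - l := by
        rw [hn]
        push_cast
        linarith
      rw [this]
      push_cast
      ring
    simp only [hr]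
    rw [hM]
    refine sum_mem fun j _ => zsmul_mem (sub_mem ?_ (A.smul_mem_JH _ ?_)) _
    · refine A.bracket_bracket_mem p ha hb hc ?_ 0 (by simp) ?_ _ _
      · have := add_mem h hγ
        ring_nf at this ⊢
        exact this
      · rw [chi_congr (x' := (α : ℝ) - Δ) (y' := (β : ℝ) - Δ') (by simp) (by simpa using hγ)]
        push_cast
        omega
    · refine A.bracket_bracket_mem p hb ha hc ?_ (p + 1) rfl ?_ _ _
      · have := add_mem h hγ
        ring_nf at this ⊢
        exact this
      · rw [chi_congr (x' := (β : ℝ) - Δ') (y' := (α : ℝ) - Δ) (by simp) (by simpa using hγ),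
          chi_comm]
        push_cast
        omega
  filter_upwards [(Filter.eventually_all_finset _).2 H] with M hM
  simp only [ProductSystem.zhuProd_apply, Finset.smul_sum]
  rw [Finset.sum_comm]
  refine sum_mem fun m hm => ?_
  have := zsmul_mem (hM m hm) (Ring.choose (-p - 1 : ℤ) m)
  rw [Finset.smul_sum] at this
  convert this using 2 with l
  rw [smul_comm]

/-- The associativity of `*_p` modulo `J_p`. -/
lemma zhuProd_assoc {p : ℕ} {α β γ : Γ} {Δ Δ' Δ'' : ℝ} {a b c : A.VH}
    (ha : a ∈ A.pieceH α Δ) (hb : b ∈ A.pieceH β Δ') (hc : c ∈ A.pieceH γ Δ'')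
    (hα : (α : ℝ) - Δ ∈ AddSubgroup.zmultiples (1 : ℝ))
    (hβ : (β : ℝ) - Δ' ∈ AddSubgroup.zmultiples (1 : ℝ))
    (hγ : (γ : ℝ) - Δ'' ∈ AddSubgroup.zmultiples (1 : ℝ)) {κ : ℂ}
    (hκ : A.systemH.Borcherds κ a b) :
    ∀ᶠ M : ℕ in Filter.atTop, ∑ m ∈ Finset.range (p + 1), Ring.choose (-p - 1 : ℤ) m •
      ∑ l ∈ Finset.range M, Ring.choose ((Δ + p : ℝ) : ℂ) l •
        A.systemH.zhuProd p (Δ + Δ' - (-p - 1 - m + l : ℤ) - 1)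
          (A.systemH.prod (-p - 1 - m + l) a b) c -
      A.systemH.zhuProd p Δ a (A.systemH.zhuProd p Δ' b c) ∈ A.JH p := by
  have hchi : chi (α - Δ) ((β - Δ') + (γ - Δ'')) = 0 := chi_of_mem hα (add_mem hβ hγ)
  have hchi' : chi (β - Δ') ((α - Δ) + (γ - Δ'')) = 0 := chi_of_mem hβ (add_mem hα hγ)
  have hint : ((α : ℝ) - Δ) + ((β - Δ') + (γ - Δ'')) ∈ AddSubgroup.zmultiples (1 : ℝ) :=
    add_mem hα (add_mem hβ hγ)
  have hint' : ((β : ℝ) - Δ') + ((α - Δ) + (γ - Δ'')) ∈ AddSubgroup.zmultiples (1 : ℝ) :=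
    add_mem hβ (add_mem hα hγ)
  have hra : ((Δ + p : ℝ) : ℂ) = ((Δ + epsReal (α - Δ) + p : ℝ) : ℂ) + (0 : ℕ) := by
    simp [epsReal_of_mem hα]
  set B : ℤ → ℂ → ℤ → A.VH := fun n s k => A.systemH.bracket ((Δ + p : ℝ) : ℂ) n a
    (A.systemH.bracket s k b c) with hB
  have H : ∀ μ ∈ Finset.range (p + 1), ∀ m ∈ Finset.range (p + 1), ∀ᶠ M : ℕ in Filter.atTop,
      ∑ l ∈ Finset.range M, Ring.choose ((Δ + p : ℝ) : ℂ) l •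
        A.systemH.bracket ((Δ + Δ' - (-p - 1 - m + l : ℤ) - 1 + p : ℝ) : ℂ) (-p - 1 - μ)
          (A.systemH.prod (-p - 1 - m + l) a b) c -
      ∑ j ∈ Finset.range (p + 1 - m), ((-1) ^ j * Ring.choose (-p - 1 - m : ℤ) j : ℤ) •
        B (-p - 1 - (m + j : ℕ)) (((Δ' + p : ℝ) : ℂ) + m) (-p - 1 - μ + j) ∈ A.JH p := by
    intro μ hμ m hm
    -- An excess m in the exponent of b makes the total exponent equal to the weight of a_(-p-1-m+l)
    -- b plus p.
    filter_upwards [hκ.bracket_zero ((Δ + p : ℝ) : ℂ) (((Δ' + p : ℝ) : ℂ) + m) (-p - 1 - μ)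
      (-p - 1 - m) c, Filter.eventually_ge_atTop (p + 1 - m)] with M hM hM'
    have hr : ∀ l : ℕ, ((Δ + Δ' - (-p - 1 - m + l : ℤ) - 1 + p : ℝ) : ℂ) =
        ((Δ + p : ℝ) : ℂ) + (((Δ' + p : ℝ) : ℂ) + m) - l := by
      intro l
      push_cast
      ring
    simp only [hr]
    rw [hM]
    -- For m + j ≥ p + 1 the index of a is at most -2p - 2, so only the triangle m + j ≤ p survives
    -- modulo J_p.
    have h2 : ∀ j ∈ Finset.range M, j ∉ Finset.range (p + 1 - m) →
        ((-1) ^ j * Ring.choose (-p - 1 - m : ℤ) j : ℤ) •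
          B (-p - 1 - (m + j : ℕ)) (((Δ' + p : ℝ) : ℂ) + m) (-p - 1 - μ + j) ∈ A.JH p := by
      intro j _ hj
      simp only [Finset.mem_range, not_lt] at hj
      refine zsmul_mem (A.bracket_bracket_mem p ha hb hc hint 0 hra ?_ _ _) _
      rw [hchi]
      push_cast
      omega
    obtain ⟨M', rfl⟩ : ∃ M', M = p + 1 - m + M' := ⟨M - (p + 1 - m), by omega⟩
    rw [Finset.sum_range_add, add_sub_right_comm, ← Finset.sum_sub_distrib]
    -- The terms with b outermost all lie in J_p: the index plus the excess m equals -2p - 2 - μ -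
    -- j.
    have h3 : ∀ j : ℕ, A.systemH.bracket (((Δ' + p : ℝ) : ℂ) + m)
        (-p - 1 - μ + (-p - 1 - m) - j) b (A.systemH.bracket ((Δ + p : ℝ) : ℂ) j a c) ∈
        A.JH p := by
      intro j
      refine A.bracket_bracket_mem p hb ha hc hint' m ?_ ?_ _ _
      · simp [epsReal_of_mem hβ]
      · rw [hchi']
        omega
    have h4 : ∀ j : ℕ, (-p - 1 - m - j : ℤ) = -p - 1 - (m + j : ℕ) := fun j => by
      push_cast
      ring
    refine add_mem (sum_mem fun j _ => ?_) (sum_mem fun j hj => ?_)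
    · refine zsmul_sub_zsmul_mem _ ?_
      rw [h4, sub_right_comm, hB]
      dsimp only
      rw [sub_self, zero_sub]
      exact neg_mem (A.smul_mem_JH _ (h3 j))
    · rw [smul_sub]
      refine sub_mem ?_ (zsmul_mem (A.smul_mem_JH _ (h3 _)) _)
      rw [h4]
      simp only [Finset.mem_range] at hj
      exact h2 _ (by simp only [Finset.mem_range]; omega) (by simp)
  -- Summed over the diagonal q = m + j, the coefficients become binom(-p-1, q) binom(q, m)
  -- (-1)^{q-m}, and the inner sum over m collapses by `sum_antidiagonal_bracket`. What remains is
  -- the μ-th part of a * (b * c).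
  have H2 : ∀ μ : ℕ, ∑ m ∈ Finset.range (p + 1), Ring.choose (-p - 1 : ℤ) m •
      ∑ j ∈ Finset.range (p + 1 - m), ((-1) ^ j * Ring.choose (-p - 1 - m : ℤ) j : ℤ) •
        B (-p - 1 - (m + j : ℕ)) (((Δ' + p : ℝ) : ℂ) + m) (-p - 1 - μ + j) =
      ∑ q ∈ Finset.range (p + 1), Ring.choose (-p - 1 : ℤ) q •
        B (-p - 1 - q) ((Δ' + p : ℝ) : ℂ) (-p - 1 - μ) := by
    intro μ
    simp only [Finset.smul_sum]
    rw [← Finset.sum_range_diag_flip (p + 1) (fun m j => Ring.choose (-p - 1 : ℤ) m •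
      ((-1) ^ j * Ring.choose (-p - 1 - m : ℤ) j : ℤ) •
        B (-p - 1 - (m + j : ℕ)) (((Δ' + p : ℝ) : ℂ) + m) (-p - 1 - μ + j))]
    refine Finset.sum_congr rfl fun q _ => ?_
    rw [hB]
    dsimp only
    rw [← A.systemH.sum_antidiagonal_bracket q ((Δ' + p : ℝ) : ℂ), map_sum, Finset.smul_sum,
      Finset.Nat.sum_antidiagonal_eq_sum_range_succ_mk]
    refine Finset.sum_congr rfl fun m hm => ?_
    simp only [Finset.mem_range] at hm
    rw [map_nsmul, map_zsmul, Nat.add_sub_cancel' (by omega), ← natCast_zsmul, smul_smul, smul_smul,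
      smul_smul]
    congr 1
    have := Ring.choose_smul_choose (-p - 1 : ℤ) (n := q) (k := m) (by omega)
    rw [nsmul_eq_mul] at this
    linear_combination (-(-1 : ℤ) ^ (q - m)) * this
  filter_upwards [(Filter.eventually_all_finset _).2 fun μ hμ =>
    (Filter.eventually_all_finset _).2 (H μ hμ)] with M hM
  have e : A.systemH.zhuProd p Δ a (A.systemH.zhuProd p Δ' b c) =
      ∑ μ ∈ Finset.range (p + 1), Ring.choose (-p - 1 : ℤ) μ •
        ∑ q ∈ Finset.range (p + 1), Ring.choose (-p - 1 : ℤ) q •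
          B (-p - 1 - q) ((Δ' + p : ℝ) : ℂ) (-p - 1 - μ) := by
    rw [A.systemH.zhuProd_apply p Δ' b c, map_sum]
    refine Finset.sum_congr rfl fun μ _ => ?_
    rw [map_zsmul, A.systemH.zhuProd_apply]
  have e' : ∑ m ∈ Finset.range (p + 1), Ring.choose (-p - 1 : ℤ) m •
      ∑ l ∈ Finset.range M, Ring.choose ((Δ + p : ℝ) : ℂ) l •
        A.systemH.zhuProd p (Δ + Δ' - (-p - 1 - m + l : ℤ) - 1)
          (A.systemH.prod (-p - 1 - m + l) a b) c =
      ∑ μ ∈ Finset.range (p + 1), Ring.choose (-p - 1 : ℤ) μ •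
        ∑ m ∈ Finset.range (p + 1), Ring.choose (-p - 1 : ℤ) m •
        ∑ l ∈ Finset.range M, Ring.choose ((Δ + p : ℝ) : ℂ) l •
        A.systemH.bracket ((Δ + Δ' - (-p - 1 - m + l : ℤ) - 1 + p : ℝ) : ℂ) (-p - 1 - μ)
          (A.systemH.prod (-p - 1 - m + l) a b) c := by
    simp only [ProductSystem.zhuProd_apply, Finset.smul_sum]
    rw [Finset.sum_comm (s := Finset.range (p + 1)) (t := Finset.range (p + 1))]
    refine Finset.sum_congr rfl fun m _ => ?_
    rw [Finset.sum_comm (s := Finset.range M)]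
    refine Finset.sum_congr rfl fun μ _ => Finset.sum_congr rfl fun l _ => ?_
    rw [smul_comm (Ring.choose ((Δ + p : ℝ) : ℂ) l), smul_comm (Ring.choose (-p - 1 : ℤ) m)]
  rw [e, e', ← Finset.sum_sub_distrib]
  refine sum_mem fun μ hμ => ?_
  refine zsmul_sub_zsmul_mem _ ?_
  rw [← H2, ← Finset.sum_sub_distrib]
  exact sum_mem fun m hm => zsmul_sub_zsmul_mem _ (hM μ hμ m hm)

end GradedVertexAlgebra

/-! ### The generators (T + ħH)a, the unit, and the comparison of consecutive levels. -/

section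

variable {W : Type*} [AddCommGroup W] [Module ℂ W]

/-- After integration by parts the m-th summand is f(m) - f(m + 1) with f(m) = m binom(-p-1, m)
times the residue of index -p - 1 - m. The sum telescopes to the index -2p - 2, which is that of a
generator of J_p when χ = 0. -/
lemma sum_choose_smul_weightedSum_deriv {s : ℤ → W} {N : ℤ} (hs : ∀ i, N ≤ i → s i = 0) (p : ℕ)
    (Δ : ℂ) :
    ∑ m ∈ Finset.range (p + 1), Ring.choose (-p - 1 : ℤ) m •
      (weightedSum (Δ + p + 1) (-p - 1 - m) (fun k => (-k) • s (k - 1)) +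
        Δ • weightedSum (Δ + p) (-p - 1 - m) s) =
    (-((p + 1 : ℕ) * Ring.choose (-p - 1 : ℤ) (p + 1)) : ℤ) •
      weightedSum (Δ + p) (-2 * p - 2) s := by
  set f : ℕ → W := fun m => ((m : ℤ) * Ring.choose (-p - 1 : ℤ) m) •
    weightedSum (Δ + p) (-p - 1 - m) s with hf
  have h : ∀ m ∈ Finset.range (p + 1), Ring.choose (-p - 1 : ℤ) m •
      (weightedSum (Δ + p + 1) (-p - 1 - m) (fun k => (-k) • s (k - 1)) +
        Δ • weightedSum (Δ + p) (-p - 1 - m) s) = f m - f (m + 1) := by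
    intro m _
    rw [weightedSum_deriv hs, hf]
    dsimp only
    have key := succ_mul_choose_succ (-p - 1 : ℤ) m
    rw [show (-p - 1 - (m + 1 : ℕ) : ℤ) = -p - 1 - m - 1 by push_cast; ring, Nat.cast_add,
      Nat.cast_one, key]
    simp only [← Int.cast_smul_eq_zsmul ℂ]
    push_cast
    module
  rw [Finset.sum_congr rfl h, Finset.sum_range_sub', hf]
  dsimp only
  rw [Nat.cast_zero, zero_mul, zero_smul, zero_sub, neg_smul]
  congr 3
  push_cast
  ring

end

namespace GradedVertexAlgebra

variable {Γ : AddSubgroup ℝ} {V : Type*} [AddCommGroup V] [Module ℂ V]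
  (A : GradedVertexAlgebra Γ V)

lemma sum_choose_smul_mem {p : ℕ} {α β : Γ} {Δ Δ' : ℝ} {x y : A.VH} (hx : x ∈ A.pieceH α Δ)
    (hy : y ∈ A.pieceH β Δ') (hα : (α : ℝ) - Δ ∈ AddSubgroup.zmultiples (1 : ℝ))
    (hβ : (β : ℝ) - Δ' ∈ AddSubgroup.zmultiples (1 : ℝ)) :
    ∑ m ∈ Finset.range (p + 1), Ring.choose (-p - 1 : ℤ) m •
      (weightedSum ((Δ : ℂ) + p + 1) (-p - 1 - m) (fun k => (-k) • A.prodH (k - 1) x y) +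
        (Δ : ℂ) • weightedSum ((Δ : ℂ) + p) (-p - 1 - m) (fun k => A.prodH k x y)) ∈ A.JH p := by
  obtain ⟨N, hN⟩ := A.systemH.exists_prod_eq_zero x y
  have := sum_choose_smul_weightedSum_deriv (s := fun k => A.prodH k x y) hN p Δ
  rw [this]
  refine zsmul_mem ?_ _
  refine A.bracket_mem p hx hy (add_mem hα hβ) 0 ?_ ?_
  · rw [epsReal_of_mem hα]
    push_cast
    ring
  · rw [chi_of_mem hα hβ]
    simp

/-- `(T + ħ H) x * y ∈ J_p`. -/
lemma zhuProd_transH_left_mem {p : ℕ} {α β : Γ} {Δ Δ' : ℝ} {x y : A.VH} (hx : x ∈ A.pieceH α Δ)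
    (hy : y ∈ A.pieceH β Δ') (hα : (α : ℝ) - Δ ∈ AddSubgroup.zmultiples (1 : ℝ))
    (hβ : (β : ℝ) - Δ' ∈ AddSubgroup.zmultiples (1 : ℝ)) :
    A.systemH.zhuProd p (Δ + 1) (A.transH x) y + (Δ : ℂ) • A.systemH.zhuProd p Δ x y ∈
      A.JH p := by
  convert A.sum_choose_smul_mem (p := p) hx hy hα hβ using 1
  rw [ProductSystem.zhuProd_apply, ProductSystem.zhuProd_apply, Finset.smul_sum,
    ← Finset.sum_add_distrib]
  refine Finset.sum_congr rfl fun m _ => ?_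
  rw [smul_comm (Δ : ℂ), smul_add, ProductSystem.bracket_apply, ProductSystem.bracket_apply]
  simp only [systemH_prod, prodH_transH]
  rw [show ((Δ + 1 + p : ℝ) : ℂ) = (Δ : ℂ) + p + 1 by push_cast; ring,
    show ((Δ + p : ℝ) : ℂ) = (Δ : ℂ) + p by push_cast; ring]

/-- `x * (T + ħ H) y ∈ J_p`. -/
lemma zhuProd_transH_right_mem {p : ℕ} {α β : Γ} {Δ Δ' : ℝ} {x y : A.VH} (hx : x ∈ A.pieceH α Δ)
    (hy : y ∈ A.pieceH β Δ') (hα : (α : ℝ) - Δ ∈ AddSubgroup.zmultiples (1 : ℝ))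
    (hβ : (β : ℝ) - Δ' ∈ AddSubgroup.zmultiples (1 : ℝ)) :
    A.systemH.zhuProd p Δ x (A.transH y + (Δ' : ℂ) • y) ∈ A.JH p := by
  obtain ⟨N, hN⟩ := A.systemH.exists_prod_eq_zero x y
  have hs : ∀ i, N ≤ i → (fun k => A.prodH k x y) i = 0 := hN
  have hd : ∀ i, N + 1 ≤ i → (fun k : ℤ => (-k) • A.prodH (k - 1) x y) i = 0 := fun i hi => by
    simp only [hs (i - 1) (by omega), smul_zero]
  have h := A.sum_choose_smul_mem (p := p) hx hy hα hβ
  -- Because `transH` is a derivation of the products, applying T plus weight to y and to x adds up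
  -- to T plus weight applied to the products x_(n+j) y, which gives elements of J_p. The part
  -- coming from x is already in J_p by `h`.
  suffices H : ∀ m : ℕ, A.systemH.bracket ((Δ : ℂ) + p) (-p - 1 - m) x
      (A.transH y + (Δ' : ℂ) • y) +
      (weightedSum ((Δ : ℂ) + p + 1) (-p - 1 - m) (fun k => (-k) • A.prodH (k - 1) x y) +
        (Δ : ℂ) • weightedSum ((Δ : ℂ) + p) (-p - 1 - m) (fun k => A.prodH k x y)) ∈ A.JH p by
    have h2 : ∑ m ∈ Finset.range (p + 1), Ring.choose (-p - 1 : ℤ) m •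
        (A.systemH.bracket ((Δ : ℂ) + p) (-p - 1 - m) x (A.transH y + (Δ' : ℂ) • y) +
        (weightedSum ((Δ : ℂ) + p + 1) (-p - 1 - m) (fun k => (-k) • A.prodH (k - 1) x y) +
        (Δ : ℂ) • weightedSum ((Δ : ℂ) + p) (-p - 1 - m) (fun k => A.prodH k x y))) ∈ A.JH p :=
      sum_mem fun m _ => zsmul_mem (H m) _
    have h3 := sub_mem h2 h
    rw [← Finset.sum_sub_distrib] at h3
    rw [ProductSystem.zhuProd_apply]
    convert h3 using 2 with m
    rw [smul_add, add_sub_cancel_right]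
    push_cast
    rfl
  intro m
  set n : ℤ := -p - 1 - m
  set r : ℂ := (Δ : ℂ) + p
  rw [weightedSum_add_one hd]
  obtain ⟨M, h1, h2, h3, h4⟩ := ((A.systemH.bracket_eventually r n x
    (A.transH y + (Δ' : ℂ) • y)).and ((weightedSum_eventually hd r n).and
    ((weightedSum_eventually hd r (n + 1)).and (weightedSum_eventually hs r n)))).exists
  rw [h1, h2, h3, h4, Finset.smul_sum, ← Finset.sum_add_distrib, ← Finset.sum_add_distrib,
    ← Finset.sum_add_distrib]
  refine sum_mem fun j _ => ?_
  have hint : ((α + β : Γ) : ℝ) - (Δ + Δ' - (n + j : ℤ) - 1) ∈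
      AddSubgroup.zmultiples (1 : ℝ) := by
    obtain ⟨u, hu⟩ := mem_zmultiples_one.1 hα
    obtain ⟨v, hv⟩ := mem_zmultiples_one.1 hβ
    refine mem_zmultiples_one.2 ⟨u + v + (n + j) + 1, ?_⟩
    push_cast
    linarith
  have key := A.smul_mem_JH (Ring.choose r j)
    (A.transH_add_mem (p := p) hint (A.prodH_mem_pieceH hx hy (n + j)))
  rw [transH_prodH] at key
  convert key using 1
  rw [systemH_prod, map_add, LinearMap.map_smul_of_tower, show n + 1 + j - 1 = n + j by ring]
  simp only [← Int.cast_smul_eq_zsmul ℂ]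
  push_cast
  module

/-- Here x_(-k-1)|0⟩ is the k-th divided power of the translation operator applied to x. Modulo J_p
that operator is minus the weight, and each application raises the weight by one, so the factors -Δ,
-Δ - 1, … accumulate to a binomial coefficient. -/
lemma prodH_vacuumH_sub_mem {p : ℕ} {α : Γ} (k : ℕ) : ∀ (Δ : ℝ) (x : A.VH), x ∈ A.pieceH α Δ →
    (α : ℝ) - Δ ∈ AddSubgroup.zmultiples (1 : ℝ) →
    A.prodH (-k - 1) x A.vacuumH - Ring.choose (-Δ : ℂ) k • x ∈ A.JH p := by
  induction k with
  | zero =>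
    intro Δ x hx h
    simp [prodH_neg_one_vacuumH]
  | succ k ih =>
    intro Δ x hx h
    have h1 := ih (Δ + 1) (A.transH x) (A.transH_mem_pieceH hx) (by
      have := sub_mem h (AddSubgroup.mem_zmultiples (1 : ℝ))
      ring_nf at this ⊢
      exact this)
    rw [prodH_transH] at h1
    have h2 := add_mem h1 (A.smul_mem_JH (Ring.choose (-((Δ + 1 : ℝ) : ℂ)) k)
      (A.transH_add_mem h hx))
    have h3 := A.smul_mem_JH (((k : ℂ) + 1)⁻¹) h2
    have hk : (k : ℂ) + 1 ≠ 0 := by exact_mod_cast Nat.succ_ne_zero k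
    have hc : ((k : ℂ) + 1) * Ring.choose (-Δ : ℂ) (k + 1) =
        -Δ * Ring.choose (-((Δ + 1 : ℝ) : ℂ)) k := by
      have := Ring.choose_smul_choose (-Δ : ℂ) (n := k + 1) (k := 1) (by omega)
      simp only [Nat.choose_one_right, nsmul_eq_mul, add_tsub_cancel_right,
        Ring.choose_one_right] at this
      push_cast at this ⊢
      rw [this]
      congr 2
      ring
    convert h3 using 1
    rw [← sub_eq_zero, ← smul_right_injective A.VH hk |>.eq_iff]
    rw [smul_zero, smul_sub _ (_ - _), smul_inv_smul₀ hk, smul_sub, smul_smul, hc,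
      show (-(k + 1 : ℕ) - 1 : ℤ) = -k - 1 - 1 by push_cast; ring]
    simp only [← Int.cast_smul_eq_zsmul ℂ]
    push_cast
    module

/-- `x * |0⟩ ≡ x` modulo `J_p`. -/
lemma zhuProd_vacuumH_sub_mem {p : ℕ} {α : Γ} {Δ : ℝ} {x : A.VH} (hx : x ∈ A.pieceH α Δ)
    (h : (α : ℝ) - Δ ∈ AddSubgroup.zmultiples (1 : ℝ)) :
    A.systemH.zhuProd p Δ x A.vacuumH - x ∈ A.JH p := by
  have H : ∀ m : ℕ, A.systemH.bracket ((Δ + p : ℝ) : ℂ) (-p - 1 - m) x A.vacuumH -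
      (p.choose (p + m) : ℤ) • x ∈ A.JH p := by
    intro m
    have hN : ∀ i, (0 : ℤ) ≤ i → (fun k => A.systemH.prod k x A.vacuumH) i = 0 :=
      fun i hi => A.prodH_vacuumH_of_nonneg hi x
    -- Vandermonde for the exponents Δ + p and -Δ, whose sum p no longer involves the weight. The
    -- value is 0 unless m = 0, so the whole product reduces to x.
    have hc : ((p.choose (p + m) : ℤ) : ℂ) = ∑ j ∈ Finset.range (p + m + 1),
        Ring.choose ((Δ + p : ℝ) : ℂ) j * Ring.choose (-Δ : ℂ) (p + m - j) := by
      rw [← Finset.Nat.sum_antidiagonal_eq_sum_range_succ (fun i j =>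
        Ring.choose ((Δ + p : ℝ) : ℂ) i * Ring.choose (-Δ : ℂ) j),
        ← Ring.add_choose_eq _ (Commute.all _ _),
        show ((Δ + p : ℝ) : ℂ) + -Δ = (p : ℂ) by push_cast; ring, Ring.choose_natCast]
      simp
    rw [ProductSystem.bracket_apply, weightedSum_eq hN _ (M := p + m + 1) (by push_cast; omega),
      ← Int.cast_smul_eq_zsmul ℂ, hc, Finset.sum_smul, ← Finset.sum_sub_distrib]
    refine sum_mem fun j hj => ?_
    simp only [Finset.mem_range] at hj
    have := A.smul_mem_JH (Ring.choose ((Δ + p : ℝ) : ℂ) j)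
      (A.prodH_vacuumH_sub_mem (p := p) (p + m - j) Δ x hx h)
    rw [smul_sub, smul_smul] at this
    rwa [show (-(p + m - j : ℕ) - 1 : ℤ) = -p - 1 - m + j by omega] at this
  have H2 : ∑ m ∈ Finset.range (p + 1), Ring.choose (-p - 1 : ℤ) m •
      (p.choose (p + m) : ℤ) • x = x := by
    rw [Finset.sum_eq_single 0]
    · simp
    · intro m _ hm
      rw [Nat.choose_eq_zero_of_lt (by omega)]
      simp
    · simp
  have H3 : A.systemH.zhuProd p Δ x A.vacuumH - ∑ m ∈ Finset.range (p + 1),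
      Ring.choose (-p - 1 : ℤ) m • (p.choose (p + m) : ℤ) • x ∈ A.JH p := by
    rw [ProductSystem.zhuProd_apply, ← Finset.sum_sub_distrib]
    exact sum_mem fun m _ => zsmul_sub_zsmul_mem _ (H m)
  rwa [H2] at H3

/-- On the left the vacuum is a unit exactly, not only modulo J_p: its sole nonzero mode has index
-1 and coefficient binom(p, p + m), which is 0 for m > 0. -/
lemma zhuProd_vacuumH (p : ℕ) (y : A.VH) : A.systemH.zhuProd p 0 A.vacuumH y = y := by
  have H : ∀ m : ℕ, A.systemH.bracket ((0 + p : ℝ) : ℂ) (-p - 1 - m) A.vacuumH y =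
      (p.choose (p + m) : ℤ) • y := by
    intro m
    have hN : ∀ i, (0 : ℤ) ≤ i → (fun k => A.systemH.prod k A.vacuumH y) i = 0 := fun i hi => by
      simp only [systemH_prod, prodH_vacuumH_left]
      rw [if_neg (by omega)]
    rw [ProductSystem.bracket_apply, weightedSum_eq hN _ (M := p + m + 1) (by push_cast; omega),
      Finset.sum_eq_single (p + m)]
    · rw [systemH_prod, prodH_vacuumH_left, if_pos (by push_cast; ring), zero_add]
      rw [Complex.ofReal_natCast, Ring.choose_natCast, ← Int.cast_smul_eq_zsmul ℂ]
      push_cast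
      rfl
    · intro j _ hj
      rw [systemH_prod, prodH_vacuumH_left, if_neg (by omega), smul_zero]
    · simp
  rw [ProductSystem.zhuProd_apply]
  simp only [H]
  rw [Finset.sum_eq_single 0]
  · simp
  · intro m _ hm
    rw [Nat.choose_eq_zero_of_lt (by omega)]
    simp
  · simp

/-- The products of two consecutive levels agree modulo the lower ideal. -/
lemma zhuProd_succ_sub_mem {p : ℕ} {α β : Γ} {Δ Δ' : ℝ} {x y : A.VH} (hx : x ∈ A.pieceH α Δ)
    (hy : y ∈ A.pieceH β Δ') (hα : (α : ℝ) - Δ ∈ AddSubgroup.zmultiples (1 : ℝ))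
    (hβ : (β : ℝ) - Δ' ∈ AddSubgroup.zmultiples (1 : ℝ)) :
    A.systemH.zhuProd (p + 1) Δ x y - A.systemH.zhuProd p Δ x y ∈ A.JH p := by
  set b : ℕ → A.VH := fun m => A.systemH.bracket ((Δ + p : ℝ) : ℂ) (-p - 1 - m) x y with hb
  set c : ℕ → ℤ := fun m => Ring.choose (-p - 2 : ℤ) m with hc
  -- One factor 1 + z is split off the level p + 1 weight, so that both levels are expressed through
  -- the same brackets `b m`.
  have e1 : A.systemH.zhuProd (p + 1) Δ x y =
      ∑ m ∈ Finset.range (p + 2), c m • (b (m + 1) + b m) := by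
    rw [ProductSystem.zhuProd_apply]
    refine Finset.sum_congr rfl fun m _ => ?_
    rw [show ((Δ + (p + 1 : ℕ) : ℝ) : ℂ) = ((Δ + p : ℝ) : ℂ) + 1 by push_cast; ring,
      ProductSystem.bracket_add_one, hb, hc]
    congr 2
    · push_cast
      ring
    · congr 3
      push_cast
      ring
    · congr 3
      push_cast
      ring
  have hmem : ∀ m, p + 1 ≤ m → b m ∈ A.JH p := fun m hm => by
    refine A.bracket_mem p hx hy (add_mem hα hβ) 0 ?_ ?_
    · simp [epsReal_of_mem hα]
    · rw [chi_of_mem hα hβ]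
      push_cast
      omega
  -- Summation by parts with Pascal's rule binom(-p-2, m) + binom(-p-2, m-1) = binom(-p-1, m). For q
  -- = p + 1 the discrepancy from level p consists of multiples of b(p + 1) and b(p + 2), both in
  -- J_p.
  have e2 : ∀ q, ∑ m ∈ Finset.range (q + 1), c m • (b (m + 1) + b m) =
      ∑ m ∈ Finset.range (q + 1), Ring.choose (-p - 1 : ℤ) m • b m + c q • b (q + 1) := by
    intro q
    induction q with
    | zero => simp [hc, add_comm]
    | succ q ih =>
      rw [Finset.sum_range_succ, ih, Finset.sum_range_succ _ (q + 1),
        show (-p - 1 : ℤ) = -p - 2 + 1 by ring, Ring.choose_succ_succ, add_smul, smul_add]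
      abel
  rw [e1, e2, ProductSystem.zhuProd_apply, Finset.sum_range_succ, add_assoc, add_sub_cancel_left]
  exact add_mem (zsmul_mem (hmem _ le_rfl) _) (zsmul_mem (hmem _ (by omega)) _)

/-! ### Reduction to homogeneous vectors and transfer back to V_{Γ,ħ}. -/

/-- Since H preserves parity, (H - Δ)b = -(H - Δ)c is both even and odd, hence zero. Parity
homogeneity is needed because the sign in the Borcherds identity is only defined for such vectors.
-/
lemma exists_piece_parity_add {α : Γ} {Δ : ℝ} {a : V} (ha : a ∈ A.piece α Δ) :
    ∃ b ∈ A.piece α Δ, b ∈ A.parity 0 ∧ ∃ c ∈ A.piece α Δ, c ∈ A.parity 1 ∧ a = b + c := by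
  have h := ha.1
  rw [A.deg_parity] at h
  obtain ⟨b, hb, c, hc, rfl⟩ := Submodule.mem_sup.1 h
  have hH := Module.End.mem_eigenspace_iff.1 ha.2
  have e : A.H b - (Δ : ℂ) • b = -(A.H c - (Δ : ℂ) • c) := by
    rw [map_add, smul_add] at hH
    rw [neg_sub, sub_eq_sub_iff_add_eq_add, hH]
    abel
  have h0 : A.H b - (Δ : ℂ) • b ∈ A.parity 0 :=
    sub_mem (A.H_parity 0 b hb.2) (Submodule.smul_mem _ _ hb.2)
  have h1 : A.H c - (Δ : ℂ) • c ∈ A.parity 1 :=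
    sub_mem (A.H_parity 1 c hc.2) (Submodule.smul_mem _ _ hc.2)
  have hdis : Disjoint (A.parity 0) (A.parity 1) :=
    A.parity_isInternal.submodule_iSupIndep.pairwiseDisjoint (by decide)
  have hb0 : A.H b - (Δ : ℂ) • b = 0 :=
    Submodule.disjoint_def.1 hdis _ h0 (e ▸ neg_mem h1)
  have hc0 : A.H c - (Δ : ℂ) • c = 0 := by
    rw [hb0, zero_eq_neg] at e
    exact e
  exact ⟨b, ⟨hb.1, Module.End.mem_eigenspace_iff.2 (sub_eq_zero.1 hb0)⟩, hb.2, c,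
    ⟨hc.1, Module.End.mem_eigenspace_iff.2 (sub_eq_zero.1 hc0)⟩, hc.2, rfl⟩

lemma piece_le_VGamma {α : Γ} {Δ : ℝ} (h : (α : ℝ) - Δ ∈ AddSubgroup.zmultiples (1 : ℝ)) :
    A.piece α Δ ≤ A.VGamma := fun _ ha => Submodule.mem_iSup_of_mem _
  (Submodule.mem_iSup_of_mem _ (Submodule.mem_iSup_of_mem h ha))

/-- `V_{Γ,ħ}` is spanned by the elements of `V_Γ` homogeneous for the degree, the conformal weight
and the parity. -/
lemma mem_of_homogeneous {S : Submodule ℂ[T;T⁻¹] A.VGammaH}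
    (h : ∀ (i : ZMod 2) (α : Γ) (Δ : ℝ), (α : ℝ) - Δ ∈ AddSubgroup.zmultiples (1 : ℝ) →
      ∀ a (ha : a ∈ A.VGamma), a ∈ A.piece α Δ → a ∈ A.parity i → 1 ⊗ₜ ⟨a, ha⟩ ∈ S)
    (x : A.VGammaH) : x ∈ S := by
  induction x using TensorProduct.induction_on with
  | zero => exact zero_mem _
  | add x y hx hy => exact add_mem hx hy
  | tmul f a =>
    obtain ⟨a, ha⟩ := a
    have key : ∃ ha, 1 ⊗ₜ[ℂ] (⟨a, ha⟩ : A.VGamma) ∈ S := by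
      refine A.VGamma_induction (P := fun a => ∃ ha, 1 ⊗ₜ[ℂ] (⟨a, ha⟩ : A.VGamma) ∈ S) ha ?_ ?_ ?_
      · intro α Δ hα x hx
        obtain ⟨b, hb, hb0, c, hc, hc1, rfl⟩ := A.exists_piece_parity_add hx
        have hb' := A.piece_le_VGamma hα hb
        have hc' := A.piece_le_VGamma hα hc
        refine ⟨add_mem hb' hc', ?_⟩
        have := add_mem (h 0 α Δ hα b hb' hb hb0) (h 1 α Δ hα c hc' hc hc1)
        rwa [← TensorProduct.tmul_add] at this
      · refine ⟨zero_mem _, ?_⟩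
        have : (⟨0, zero_mem _⟩ : A.VGamma) = 0 := rfl
        rw [this, TensorProduct.tmul_zero]
        exact zero_mem _
      · rintro x y ⟨hx, hx'⟩ ⟨hy, hy'⟩
        refine ⟨add_mem hx hy, ?_⟩
        have := add_mem hx' hy'
        rwa [← TensorProduct.tmul_add] at this
    obtain ⟨_, hS⟩ := key
    have := Submodule.smul_mem _ f hS
    rwa [TensorProduct.smul_tmul', smul_eq_mul, mul_one] at this

lemma exists_inclH_eq {α : Γ} {Δ : ℝ} (hα : (α : ℝ) - Δ ∈ AddSubgroup.zmultiples (1 : ℝ))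
    {w : A.VH} (hw : w ∈ A.pieceH α Δ) :
    ∃ u ∈ Submodule.span ℂ[T;T⁻¹] {u : A.VGammaH | ∃ a : A.VGamma, (a : V) ∈ A.piece α Δ ∧
      u = 1 ⊗ₜ a}, A.inclH u = w := by
  have h : A.pieceH α Δ ≤ (Submodule.span ℂ[T;T⁻¹] {u : A.VGammaH | ∃ a : A.VGamma,
      (a : V) ∈ A.piece α Δ ∧ u = 1 ⊗ₜ a}).map A.inclH := by
    refine A.pieceH_le fun a ha => ⟨1 ⊗ₜ ⟨a, A.piece_le_VGamma hα ha⟩, ?_, rfl⟩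
    exact Submodule.subset_span ⟨_, ha, rfl⟩
  exact h hw

lemma inclH_star_one_tmul (p : ℕ) (Δ : ℝ) (a b : A.VGamma) (ha : A.H a = (Δ : ℂ) • (a : V)) :
    A.inclH (A.star p (1 ⊗ₜ a) (1 ⊗ₜ b)) =
      A.systemH.zhuProd p Δ (1 ⊗ₜ (a : V)) (1 ⊗ₜ (b : V)) := by
  rw [star_one_tmul, A.starGamma_apply p Δ a b ha, map_sum, ProductSystem.zhuProd_apply]
  refine Finset.sum_congr rfl fun m _ => ?_
  rw [map_zsmul, map_smul, ← A.inclH_modProd p Δ (-p - 1 - m) a b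
    fun k => A.nprod_mem_VGamma a.2 b.2 k]
  congr 3
  ring

lemma inclH_star (p : ℕ) {α : Γ} {Δ : ℝ} (hα : (α : ℝ) - Δ ∈ AddSubgroup.zmultiples (1 : ℝ))
    {x : A.VGammaH} (hx : A.inclH x ∈ A.pieceH α Δ) (y : A.VGammaH) :
    A.inclH (A.star p x y) = A.systemH.zhuProd p Δ (A.inclH x) (A.inclH y) := by
  obtain ⟨u, hu, hux⟩ := A.exists_inclH_eq hα hx
  obtain rfl := A.inclH_injective hux
  induction y using TensorProduct.induction_on with
  | zero => simp
  | add y y' h h' => rw [map_add, map_add, h, h', map_add, map_add]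
  | tmul f b =>
    have hs : Submodule.span ℂ[T;T⁻¹] {u : A.VGammaH | ∃ a : A.VGamma, (a : V) ∈ A.piece α Δ ∧
        u = 1 ⊗ₜ a} ≤ LinearMap.eqLocus (A.inclH ∘ₗ (A.star p).flip (1 ⊗ₜ b))
        ((A.systemH.zhuProd p Δ).flip (A.inclH (1 ⊗ₜ b)) ∘ₗ A.inclH) := by
      refine Submodule.span_le.2 ?_
      rintro _ ⟨a, ha, rfl⟩
      exact A.inclH_star_one_tmul p Δ a b (Module.End.mem_eigenspace_iff.1 ha.2)
    have h : A.inclH (A.star p u (1 ⊗ₜ b)) =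
      A.systemH.zhuProd p Δ (A.inclH u) (A.inclH (1 ⊗ₜ b)) := hs hu
    have hf : f ⊗ₜ[ℂ] b = f • (1 ⊗ₜ[ℂ] b) := by
      rw [TensorProduct.smul_tmul', smul_eq_mul, mul_one]
    rw [hf, map_smul, map_smul, h, map_smul, map_smul]

/-- The exponent γ in `*_p` depends on the weight of the left factor, so a left factor with
components of several weights must be multiplied component by component. Residues such as a_{[n,p]}
b are of this kind. -/
lemma inclH_star_of_sum (p : ℕ) {ι : Type*} {s : Finset ι} {f : ι → ℂ} {α : ι → Γ} {Δ : ι → ℝ}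
    {w : ι → A.VH} (hα : ∀ i ∈ s, (α i : ℝ) - Δ i ∈ AddSubgroup.zmultiples (1 : ℝ))
    (hw : ∀ i ∈ s, w i ∈ A.pieceH (α i) (Δ i)) {x : A.VGammaH}
    (hx : A.inclH x = ∑ i ∈ s, f i • w i) (y : A.VGammaH) :
    A.inclH (A.star p x y) = ∑ i ∈ s, f i • A.systemH.zhuProd p (Δ i) (w i) (A.inclH y) := by
  classical
  induction s using Finset.induction_on generalizing x with
  | empty =>
    rw [Finset.sum_empty, ← map_zero A.inclH] at hx
    obtain rfl := A.inclH_injective hx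
    simp
  | insert i s hi ih =>
    obtain ⟨u, -, hu⟩ := A.exists_inclH_eq (hα i (Finset.mem_insert_self i s))
      (hw i (Finset.mem_insert_self i s))
    have h1 : A.inclH (x - f i • u) = ∑ i ∈ s, f i • w i := by
      rw [map_sub, hx, LinearMap.map_smul_of_tower, hu, Finset.sum_insert hi,
        add_sub_cancel_left]
    have h2 := ih (fun j hj => hα j (Finset.mem_insert_of_mem hj))
      (fun j hj => hw j (Finset.mem_insert_of_mem hj)) h1
    have h3 := A.inclH_star p (hα i (Finset.mem_insert_self i s))
      (hu.symm ▸ hw i (Finset.mem_insert_self i s)) y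
    rw [Finset.sum_insert hi, ← h2, ← hu, ← h3, ← LinearMap.map_smul_of_tower, ← map_add,
      ← LinearMap.smul_apply, ← LinearMap.add_apply, ← LinearMap.map_smul_of_tower, ← map_add,
      add_sub_cancel]

/-- `J_p` is generated by the elements attached to parity-homogeneous vectors. -/
lemma J_le {p : ℕ} {S : Submodule ℂ[T;T⁻¹] A.VGammaH}
    (h1 : ∀ (i : ZMod 2) (α : Γ) (Δ : ℝ), (α : ℝ) - Δ ∈ AddSubgroup.zmultiples (1 : ℝ) →
      ∀ a ∈ A.piece α Δ, a ∈ A.parity i → ∀ x, A.inclH x =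
        A.transH (1 ⊗ₜ a) + (Δ : ℂ) • (1 ⊗ₜ a) → x ∈ S)
    (h2 : ∀ (i j : ZMod 2) (α β : Γ) (Δ Δ' : ℝ),
      ((α : ℝ) - Δ) + (β - Δ') ∈ AddSubgroup.zmultiples (1 : ℝ) →
      ∀ a ∈ A.piece α Δ, a ∈ A.parity i → ∀ b ∈ A.piece β Δ', b ∈ A.parity j → ∀ x, A.inclH x =
        A.systemH.bracket ((Δ + epsReal (α - Δ) + p : ℝ) : ℂ)
          (-2 * p - 2 + chi (α - Δ) (β - Δ')) (1 ⊗ₜ a) (1 ⊗ₜ b) → x ∈ S) : A.J p ≤ S := by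
  refine sup_le (Submodule.span_le.2 ?_) (Submodule.span_le.2 ?_)
  · rintro _ ⟨a, ha, rfl⟩
    have key : ∃ ha : a ∈ A.VGamma, (1 ⊗ₜ[ℂ] (⟨A.T a, A.T_mem_VGamma ha⟩ : A.VGamma) +
        (LaurentPolynomial.T 1 : ℂ[T;T⁻¹]) ⊗ₜ[ℂ] (⟨A.H a, A.H_mem_VGamma a ha⟩ : A.VGamma)) ∈
        S := by
      have hadd : ∀ x y, (∃ ha : x ∈ A.VGamma,
          (1 ⊗ₜ[ℂ] (⟨A.T x, A.T_mem_VGamma ha⟩ : A.VGamma) +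
          (LaurentPolynomial.T 1 : ℂ[T;T⁻¹]) ⊗ₜ[ℂ] (⟨A.H x, A.H_mem_VGamma x ha⟩ : A.VGamma)) ∈
          S) → (∃ ha : y ∈ A.VGamma, (1 ⊗ₜ[ℂ] (⟨A.T y, A.T_mem_VGamma ha⟩ : A.VGamma) +
          (LaurentPolynomial.T 1 : ℂ[T;T⁻¹]) ⊗ₜ[ℂ] (⟨A.H y, A.H_mem_VGamma y ha⟩ : A.VGamma)) ∈
          S) → (∃ ha : x + y ∈ A.VGamma,
          (1 ⊗ₜ[ℂ] (⟨A.T (x + y), A.T_mem_VGamma ha⟩ : A.VGamma) +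
          (LaurentPolynomial.T 1 : ℂ[T;T⁻¹]) ⊗ₜ[ℂ]
            (⟨A.H (x + y), A.H_mem_VGamma (x + y) ha⟩ : A.VGamma)) ∈ S) := by
        rintro x y ⟨hx, hx'⟩ ⟨hy, hy'⟩
        refine ⟨add_mem hx hy, ?_⟩
        have := add_mem hx' hy'
        rw [add_add_add_comm, ← TensorProduct.tmul_add, ← TensorProduct.tmul_add] at this
        convert this using 3
        · exact Subtype.ext (A.nprod_add_left _ _ _ _)
        · exact Subtype.ext (map_add A.H x y)
      have hhom : ∀ (i : ZMod 2) (α : Γ) (Δ : ℝ), (α : ℝ) - Δ ∈ AddSubgroup.zmultiples (1 : ℝ) →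
          ∀ a ∈ A.piece α Δ, a ∈ A.parity i → ∃ ha : a ∈ A.VGamma,
          (1 ⊗ₜ[ℂ] (⟨A.T a, A.T_mem_VGamma ha⟩ : A.VGamma) +
          (LaurentPolynomial.T 1 : ℂ[T;T⁻¹]) ⊗ₜ[ℂ] (⟨A.H a, A.H_mem_VGamma a ha⟩ : A.VGamma)) ∈
          S := by
        intro i α Δ hα a ha hi
        refine ⟨A.piece_le_VGamma hα ha, ?_⟩
        -- Division by ħ turns (T + ħH)a into the rescaled translation of a plus Δ a.
        rw [← T_smul_mem_iff _ (-1)]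
        refine h1 i α Δ hα a ha hi _ ?_
        rw [map_smul, map_add, inclH_tmul, inclH_tmul, smul_add, TensorProduct.smul_tmul',
          TensorProduct.smul_tmul', smul_eq_mul, smul_eq_mul, ← LaurentPolynomial.T_add,
          transH_tmul]
        dsimp only
        rw [Module.End.mem_eigenspace_iff.1 ha.2, neg_add_cancel, LaurentPolynomial.T_zero,
          TensorProduct.tmul_smul]
      refine A.VGamma_induction (P := fun a => ∃ ha : a ∈ A.VGamma,
        (1 ⊗ₜ[ℂ] (⟨A.T a, A.T_mem_VGamma ha⟩ : A.VGamma) +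
        (LaurentPolynomial.T 1 : ℂ[T;T⁻¹]) ⊗ₜ[ℂ] (⟨A.H a, A.H_mem_VGamma a ha⟩ : A.VGamma)) ∈
        S) ha ?_ ?_ hadd
      · intro α Δ hα x hx
        obtain ⟨b, hb, hb0, c, hc, hc1, rfl⟩ := A.exists_piece_parity_add hx
        exact hadd b c (hhom 0 α Δ hα b hb hb0) (hhom 1 α Δ hα c hc hc1)
      · exact hhom 0 0 0 (by simp) 0 (zero_mem _) (zero_mem _)
    obtain ⟨_, hS⟩ := key
    exact hS
  · rintro _ ⟨α, β, Δ, Δ', a, b, ha, hb, h, rfl⟩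
    rw [SetLike.mem_coe, ← T_smul_mem_iff _ (-2 * p - 2 + chi (α - Δ) (β - Δ') + 1)]
    refine (A.inclH_injective.mem_set_image (s := (S : Set A.VGammaH))).1 ?_
    change A.inclH _ ∈ S.map A.inclH
    rw [map_smul, A.inclH_modProd p _ _ a b fun m => A.nprod_mem ha hb h m]
    have key : ∀ i j, ∀ a ∈ A.piece α Δ, a ∈ A.parity i → ∀ b ∈ A.piece β Δ', b ∈ A.parity j →
        A.systemH.bracket ((Δ + epsReal (α - Δ) + p : ℝ) : ℂ)
          (-2 * p - 2 + chi (α - Δ) (β - Δ')) (1 ⊗ₜ a) (1 ⊗ₜ b) ∈ S.map A.inclH := by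
      intro i j a ha hi b hb hj
      have e := A.inclH_modProd p (Δ + epsReal (α - Δ)) (-2 * p - 2 + chi (α - Δ) (β - Δ')) a b
        fun m => A.nprod_mem ha hb h m
      rw [← map_smul] at e
      exact ⟨_, h2 i j α β Δ Δ' h a ha hi b hb hj _ e, e⟩
    obtain ⟨a₀, ha₀, hi₀, a₁, ha₁, hi₁, rfl⟩ := A.exists_piece_parity_add ha
    obtain ⟨b₀, hb₀, hj₀, b₁, hb₁, hj₁, rfl⟩ := A.exists_piece_parity_add hb
    rw [TensorProduct.tmul_add, TensorProduct.tmul_add, map_add, map_add, LinearMap.add_apply,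
      LinearMap.add_apply]
    exact add_mem
      (add_mem (key _ _ _ ha₀ hi₀ _ hb₀ hj₀) (key _ _ _ ha₁ hi₁ _ hb₀ hj₀))
      (add_mem (key _ _ _ ha₀ hi₀ _ hb₁ hj₁) (key _ _ _ ha₁ hi₁ _ hb₁ hj₁))

lemma J_succ_le (p : ℕ) : A.J (p + 1) ≤ A.J p := by
  refine A.J_le ?_ ?_
  · intro i α Δ hα a ha _ x hx
    rw [← inclH_mem_JH, hx]
    exact A.transH_add_mem hα (A.one_tmul_mem_pieceH ha)
  · intro i j α β Δ Δ' h a ha _ b hb _ x hx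
    rw [← inclH_mem_JH, hx]
    -- A generator of level p + 1 has excess 1 at level p, and its index lies two below the level p
    -- bound.
    refine A.bracket_mem p (A.one_tmul_mem_pieceH ha) (A.one_tmul_mem_pieceH hb) h 1 ?_ ?_
    · push_cast
      ring
    · push_cast
      omega

lemma star_succ_sub_mem (p : ℕ) (x y : A.VGammaH) :
    A.star (p + 1) x y - A.star p x y ∈ A.J p := by
  refine A.mem_of_homogeneous
    (S := (A.J p).comap ((A.star (p + 1)).flip y - (A.star p).flip y)) ?_ x
  intro i α Δ hα a ha haα _
  refine A.mem_of_homogeneous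
    (S := (A.J p).comap (A.star (p + 1) (1 ⊗ₜ ⟨a, ha⟩) - A.star p (1 ⊗ₜ ⟨a, ha⟩))) ?_ y
  intro j β Δ' hβ b hb hbβ _
  have ha' : A.inclH (1 ⊗ₜ ⟨a, ha⟩) ∈ A.pieceH α Δ := A.one_tmul_mem_pieceH haα
  have hb' : A.inclH (1 ⊗ₜ ⟨b, hb⟩) ∈ A.pieceH β Δ' := A.one_tmul_mem_pieceH hbβ
  rw [Submodule.mem_comap, LinearMap.sub_apply, ← inclH_mem_JH, map_sub, A.inclH_star _ hα ha',
    A.inclH_star _ hα ha']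
  exact A.zhuProd_succ_sub_mem ha' hb' hα hβ

lemma prodH_class {α β : Γ} {Δ Δ' : ℝ}
    (h : ((α : ℝ) - Δ) + (β - Δ') ∈ AddSubgroup.zmultiples (1 : ℝ)) (n : ℤ) :
    ((α + β : Γ) : ℝ) - (Δ + Δ' - n - 1) ∈ AddSubgroup.zmultiples (1 : ℝ) := by
  obtain ⟨u, hu⟩ := mem_zmultiples_one.1 h
  refine mem_zmultiples_one.2 ⟨u + n + 1, ?_⟩
  push_cast
  linarith

lemma star_mem_J_right (p : ℕ) (x : A.VGammaH) (hx : x ∈ A.J p) (y : A.VGammaH) :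
    A.star p x y ∈ A.J p := by
  refine A.mem_of_homogeneous (S := (A.J p).comap (A.star p x)) ?_ y
  intro l γ Δ'' hγ c hc hcγ _
  have hc' : A.inclH (1 ⊗ₜ ⟨c, hc⟩) ∈ A.pieceH γ Δ'' := A.one_tmul_mem_pieceH hcγ
  refine A.J_le (S := (A.J p).comap ((A.star p).flip (1 ⊗ₜ ⟨c, hc⟩))) ?_ ?_ hx
  · intro i α Δ hα a ha _ x hx
    have ha' := A.one_tmul_mem_pieceH ha
    have hα' : (α : ℝ) - (Δ + 1) ∈ AddSubgroup.zmultiples (1 : ℝ) := by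
      have := sub_mem hα (AddSubgroup.mem_zmultiples (1 : ℝ))
      rwa [sub_sub] at this
    obtain ⟨u, -, hu⟩ := A.exists_inclH_eq hα ha'
    obtain ⟨v, -, hv⟩ := A.exists_inclH_eq hα' (A.transH_mem_pieceH ha')
    -- The two summands have weights Δ + 1 and Δ, so their products with c are computed with
    -- different exponents.
    have hxv : x = v + (Δ : ℂ) • u := A.inclH_injective (by
      rw [hx, map_add, LinearMap.map_smul_of_tower, hu, hv])
    have e1 := A.inclH_star p hα (hu.symm ▸ ha') (1 ⊗ₜ ⟨c, hc⟩)
    have e2 := A.inclH_star p hα' (hv.symm ▸ A.transH_mem_pieceH ha') (1 ⊗ₜ ⟨c, hc⟩)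
    have e3 : A.inclH (A.star p x (1 ⊗ₜ ⟨c, hc⟩)) = A.inclH (A.star p v (1 ⊗ₜ ⟨c, hc⟩)) +
        (Δ : ℂ) • A.inclH (A.star p u (1 ⊗ₜ ⟨c, hc⟩)) := by
      rw [hxv, map_add, LinearMap.map_smul_of_tower, LinearMap.add_apply, LinearMap.smul_apply,
        map_add, LinearMap.map_smul_of_tower]
    rw [Submodule.mem_comap, LinearMap.flip_apply, ← inclH_mem_JH, e3, e1, e2, hu, hv]
    exact A.zhuProd_transH_left_mem ha' hc' hα hγ
  · intro i j α β Δ Δ' h a ha hi b hb hj x hx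
    have ha' := A.one_tmul_mem_pieceH ha
    have hb' := A.one_tmul_mem_pieceH hb
    rw [Submodule.mem_comap, LinearMap.flip_apply, ← inclH_mem_JH]
    obtain ⟨M, h1, h2⟩ := ((A.systemH.bracket_eventually _ _ _ _).and
      (A.zhuProd_right_mem (p := p) ha' hb' hc' h hγ (A.systemH_borcherds hi hj) rfl)).exists
    rw [h1] at hx
    rw [A.inclH_star_of_sum p (fun l _ => prodH_class h _)
      (fun l _ => A.prodH_mem_pieceH ha' hb' _) hx]
    exact h2

lemma star_mem_J_left (p : ℕ) (x y : A.VGammaH) (hy : y ∈ A.J p) :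
    A.star p x y ∈ A.J p := by
  refine A.mem_of_homogeneous (S := (A.J p).comap ((A.star p).flip y)) ?_ x
  intro l γ Δ'' hγ c hc hcγ hl
  have hc' : A.inclH (1 ⊗ₜ ⟨c, hc⟩) ∈ A.pieceH γ Δ'' := A.one_tmul_mem_pieceH hcγ
  refine A.J_le (S := (A.J p).comap (A.star p (1 ⊗ₜ ⟨c, hc⟩))) ?_ ?_ hy
  · intro i α Δ hα a ha _ x hx
    rw [Submodule.mem_comap, ← inclH_mem_JH, A.inclH_star p hγ hc', hx]
    exact A.zhuProd_transH_right_mem hc' (A.one_tmul_mem_pieceH ha) hγ hα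
  · intro i j α β Δ Δ' h a ha hi b hb hj x hx
    rw [Submodule.mem_comap, ← inclH_mem_JH, A.inclH_star p hγ hc', hx]
    exact A.zhuProd_left_mem (A.one_tmul_mem_pieceH ha) (A.one_tmul_mem_pieceH hb) hc' h hγ
      (A.systemH_borcherds hl hi)

lemma star_assoc_mem_J (p : ℕ) (x y z : A.VGammaH) :
    A.star p (A.star p x y) z - A.star p x (A.star p y z) ∈ A.J p := by
  refine A.mem_of_homogeneous (S := (A.J p).comap ((A.star p).flip z ∘ₗ (A.star p).flip y -
    (A.star p).flip (A.star p y z))) ?_ x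
  intro i α Δ hα a ha haα hi
  refine A.mem_of_homogeneous (S := (A.J p).comap ((A.star p).flip z ∘ₗ
    A.star p (1 ⊗ₜ ⟨a, ha⟩) - A.star p (1 ⊗ₜ ⟨a, ha⟩) ∘ₗ (A.star p).flip z)) ?_ y
  intro j β Δ' hβ b hb hbβ hj
  refine A.mem_of_homogeneous (S := (A.J p).comap
    (A.star p (A.star p (1 ⊗ₜ ⟨a, ha⟩) (1 ⊗ₜ ⟨b, hb⟩)) - A.star p (1 ⊗ₜ ⟨a, ha⟩) ∘ₗ
      A.star p (1 ⊗ₜ ⟨b, hb⟩))) ?_ z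
  intro l γ Δ'' hγ c hc hcγ _
  have ha' : A.inclH (1 ⊗ₜ ⟨a, ha⟩) ∈ A.pieceH α Δ := A.one_tmul_mem_pieceH haα
  have hb' : A.inclH (1 ⊗ₜ ⟨b, hb⟩) ∈ A.pieceH β Δ' := A.one_tmul_mem_pieceH hbβ
  have hc' : A.inclH (1 ⊗ₜ ⟨c, hc⟩) ∈ A.pieceH γ Δ'' := A.one_tmul_mem_pieceH hcγ
  rw [Submodule.mem_comap, LinearMap.sub_apply, LinearMap.comp_apply, ← inclH_mem_JH, map_sub,
    A.inclH_star p hα ha', A.inclH_star p hβ hb']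
  have hbr : ∀ᶠ M : ℕ in Filter.atTop, ∀ m ∈ Finset.range (p + 1),
      A.systemH.bracket ((Δ + p : ℝ) : ℂ) (-p - 1 - m) (A.inclH (1 ⊗ₜ ⟨a, ha⟩))
        (A.inclH (1 ⊗ₜ ⟨b, hb⟩)) = ∑ l ∈ Finset.range M, Ring.choose ((Δ + p : ℝ) : ℂ) l •
        A.systemH.prod (-p - 1 - m + l) (A.inclH (1 ⊗ₜ ⟨a, ha⟩)) (A.inclH (1 ⊗ₜ ⟨b, hb⟩)) :=
    (Filter.eventually_all_finset _).2 fun m _ => A.systemH.bracket_eventually _ _ _ _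
  obtain ⟨M, h1, h2⟩ := (hbr.and (A.zhuProd_assoc (p := p) ha' hb' hc' hα hβ hγ
    (A.systemH_borcherds hi hj))).exists
  -- The product a * b written as a finite sum of weight-homogeneous vectors, with one truncation M
  -- valid for all m, so that it can be multiplied by c.
  have e : A.inclH (A.star p (1 ⊗ₜ ⟨a, ha⟩) (1 ⊗ₜ ⟨b, hb⟩)) =
      ∑ k ∈ Finset.range (p + 1) ×ˢ Finset.range M,
        (((Ring.choose (-p - 1 : ℤ) k.1 : ℤ) : ℂ) * Ring.choose ((Δ + p : ℝ) : ℂ) k.2) •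
        A.systemH.prod (-p - 1 - k.1 + k.2) (A.inclH (1 ⊗ₜ ⟨a, ha⟩))
          (A.inclH (1 ⊗ₜ ⟨b, hb⟩)) := by
    rw [A.inclH_star p hα ha', ProductSystem.zhuProd_apply, Finset.sum_product]
    refine Finset.sum_congr rfl fun m hm => ?_
    rw [h1 m hm, Finset.smul_sum]
    simp only [mul_smul, Int.cast_smul_eq_zsmul]
  rw [A.inclH_star_of_sum p (fun k _ => prodH_class (add_mem hα hβ) _)
    (fun k _ => A.prodH_mem_pieceH ha' hb' _) e, Finset.sum_product]
  convert h2 using 2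
  refine Finset.sum_congr rfl fun m _ => ?_
  rw [Finset.smul_sum]
  simp only [mul_smul, Int.cast_smul_eq_zsmul]
  rfl

lemma inclH_vacH : A.inclH A.vacH = A.vacuumH := rfl

lemma isZhuIdeal (p : ℕ) : A.IsZhuIdeal p where
  star_mem_right := A.star_mem_J_right p
  star_mem_left := A.star_mem_J_left p
  star_assoc := A.star_assoc_mem_J p
  vac_star x := by
    rw [← inclH_mem_JH, map_sub, A.inclH_star p (α := 0) (Δ := 0) (by simp)
      A.vacuumH_mem_pieceH, inclH_vacH, zhuProd_vacuumH, sub_self]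
    exact zero_mem _
  star_vac x := by
    refine A.mem_of_homogeneous
      (S := (A.J p).comap ((A.star p).flip A.vacH - LinearMap.id)) ?_ x
    intro i α Δ hα a ha haα _
    have ha' : A.inclH (1 ⊗ₜ ⟨a, ha⟩) ∈ A.pieceH α Δ := A.one_tmul_mem_pieceH haα
    rw [Submodule.mem_comap, LinearMap.sub_apply, LinearMap.flip_apply, LinearMap.id_apply,
      ← inclH_mem_JH, map_sub, A.inclH_star p hα ha', inclH_vacH]
    exact A.zhuProd_vacuumH_sub_mem ha' hα

/-! ### The parity involution on V, on V_{Γ,ħ} and on J_p. -/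

/-- The sign `(-1)^i`. -/
def paritySign (i : ZMod 2) : ℂ := (-1) ^ i.val

lemma paritySign_add (i j : ZMod 2) : paritySign (i + j) = paritySign i * paritySign j := by
  have h : ∀ i j : ZMod 2, (i + j).val % 2 = (i.val + j.val) % 2 := by decide
  rw [paritySign, paritySign, paritySign, ← pow_add, neg_one_pow_eq_pow_mod_two, h,
    ← neg_one_pow_eq_pow_mod_two]

lemma parity_bijective :
    Function.Bijective (DirectSum.coeLinearMap A.parity) := A.parity_isInternal

/-- The parity involution of `V`. -/
def signHom : V →ₗ[ℂ] V :=
  (DirectSum.toModule ℂ (ZMod 2) V fun i => paritySign i • (A.parity i).subtype) ∘ₗ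
    (LinearEquiv.ofBijective _ A.parity_bijective).symm.toLinearMap

lemma signHom_of_mem {i : ZMod 2} {a : V} (ha : a ∈ A.parity i) :
    A.signHom a = paritySign i • a := by
  have h : (LinearEquiv.ofBijective _ A.parity_bijective).symm a =
      DirectSum.lof ℂ (ZMod 2) (fun i => A.parity i) i ⟨a, ha⟩ := by
    refine (LinearEquiv.symm_apply_eq _).2 ?_
    exact (DirectSum.coeLinearMap_lof _ i ⟨a, ha⟩).symm
  rw [signHom, LinearMap.comp_apply, LinearEquiv.coe_coe, h, DirectSum.toModule_lof]
  rfl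

lemma signHom_mem_VGamma : ∀ a ∈ A.VGamma, A.signHom a ∈ A.VGamma := by
  intro a ha
  refine A.VGamma_induction (P := fun a => A.signHom a ∈ A.VGamma) ha ?_ (by simp) ?_
  · intro α Δ hα x hx
    obtain ⟨b, hb, hb0, c, hc, hc1, rfl⟩ := A.exists_piece_parity_add hx
    rw [map_add, A.signHom_of_mem hb0, A.signHom_of_mem hc1]
    exact add_mem (Submodule.smul_mem _ _ (A.piece_le_VGamma hα hb))
      (Submodule.smul_mem _ _ (A.piece_le_VGamma hα hc))
  · intro x y hx hy
    rw [map_add]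
    exact add_mem hx hy

/-- The parity involution of `V_{Γ,ħ}`. -/
def signGammaH : A.VGammaH →ₗ[ℂ[T;T⁻¹]] A.VGammaH :=
  (A.signHom.restrict A.signHom_mem_VGamma).baseChange ℂ[T;T⁻¹]

/-- The parity involution of `ℂ[ħ, ħ⁻¹] ⊗ V`. -/
def signH : A.VH →ₗ[ℂ[T;T⁻¹]] A.VH := A.signHom.baseChange ℂ[T;T⁻¹]

lemma inclH_signGammaH (x : A.VGammaH) : A.inclH (A.signGammaH x) = A.signH (A.inclH x) := by
  induction x using TensorProduct.induction_on with
  | zero => simp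
  | add x y hx hy => rw [map_add, map_add, hx, hy, map_add, map_add]
  | tmul f a => rfl

lemma signH_one_tmul {i : ZMod 2} {a : V} (ha : a ∈ A.parity i) (f : ℂ[T;T⁻¹]) :
    A.signH (f ⊗ₜ a) = paritySign i • (f ⊗ₜ a) := by
  rw [signH, LinearMap.baseChange_tmul, A.signHom_of_mem ha, TensorProduct.tmul_smul]

lemma signGammaH_one_tmul {i : ZMod 2} {a : A.VGamma} (ha : (a : V) ∈ A.parity i) :
    A.signGammaH (1 ⊗ₜ a) = paritySign i • (1 ⊗ₜ a) := by
  apply A.inclH_injective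
  rw [inclH_signGammaH, LinearMap.map_smul_of_tower, inclH_tmul, A.signH_one_tmul ha]

lemma signH_bracket {i j : ZMod 2} {a b : V} (ha : a ∈ A.parity i) (hb : b ∈ A.parity j) (r : ℂ)
    (n : ℤ) : A.signH (A.systemH.bracket r n (1 ⊗ₜ a) (1 ⊗ₜ b)) =
      paritySign (i + j) • A.systemH.bracket r n (1 ⊗ₜ a) (1 ⊗ₜ b) := by
  obtain ⟨M, hM⟩ := (A.systemH.bracket_eventually r n (1 ⊗ₜ a) (1 ⊗ₜ b)).exists
  rw [hM, map_sum, Finset.smul_sum]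
  refine Finset.sum_congr rfl fun l _ => ?_
  have h : A.nprod (n + l) a b ∈ A.parity (i + j) := A.Y_parity i j _ a b ha hb
  rw [LinearMap.map_smul_of_tower, systemH_prod, prodH_one_tmul, A.signH_one_tmul h, smul_comm]

/-- The generators attached to parity-homogeneous vectors are eigenvectors of the involution, so J_p
is stable under it and the involution descends to the quotient. -/
lemma J_le_comap_signGammaH (p : ℕ) : A.J p ≤ (A.J p).comap A.signGammaH := by
  refine A.J_le ?_ ?_
  · intro i α Δ hα a ha hi x hx
    have hT : A.T a ∈ A.parity i := by
      have := A.Y_parity i 0 (-2) a A.vac hi A.vac_even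
      rwa [add_zero] at this
    rw [Submodule.mem_comap, ← inclH_mem_JH, inclH_signGammaH, hx, map_add,
      LinearMap.map_smul_of_tower, transH_tmul, A.signH_one_tmul hT, A.signH_one_tmul hi,
      smul_comm, ← smul_add, ← transH_tmul]
    exact A.smul_mem_JH _ (A.transH_add_mem hα (A.one_tmul_mem_pieceH ha))
  · intro i j α β Δ Δ' h a ha hi b hb hj x hx
    rw [Submodule.mem_comap, ← inclH_mem_JH, inclH_signGammaH, hx, A.signH_bracket hi hj]
    exact A.smul_mem_JH _ (A.bracket_mem_base p (A.one_tmul_mem_pieceH ha)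
      (A.one_tmul_mem_pieceH hb) h)

lemma signGammaH_star (p : ℕ) (x y : A.VGammaH) :
    A.signGammaH (A.star p x y) = A.star p (A.signGammaH x) (A.signGammaH y) := by
  refine A.mem_of_homogeneous (S := LinearMap.eqLocus (A.signGammaH ∘ₗ (A.star p).flip y)
    ((A.star p).flip (A.signGammaH y) ∘ₗ A.signGammaH)) ?_ x
  intro i α Δ hα a ha haα hi
  refine A.mem_of_homogeneous (S := LinearMap.eqLocus (A.signGammaH ∘ₗ A.star p (1 ⊗ₜ ⟨a, ha⟩))
    (A.star p (A.signGammaH (1 ⊗ₜ ⟨a, ha⟩)) ∘ₗ A.signGammaH)) ?_ y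
  intro j β Δ' hβ b hb _ hj
  change A.signGammaH (A.star p (1 ⊗ₜ ⟨a, ha⟩) (1 ⊗ₜ ⟨b, hb⟩)) =
    A.star p (A.signGammaH (1 ⊗ₜ ⟨a, ha⟩)) (A.signGammaH (1 ⊗ₜ ⟨b, hb⟩))
  have e : A.inclH (A.star p (1 ⊗ₜ ⟨a, ha⟩) (1 ⊗ₜ ⟨b, hb⟩)) =
      A.systemH.zhuProd p Δ (1 ⊗ₜ a) (1 ⊗ₜ b) :=
    A.inclH_star_one_tmul p Δ ⟨a, ha⟩ ⟨b, hb⟩ (Module.End.mem_eigenspace_iff.1 haα.2)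
  rw [A.signGammaH_one_tmul (a := ⟨a, ha⟩) hi, A.signGammaH_one_tmul (a := ⟨b, hb⟩) hj]
  have e' : A.star p (paritySign i • (1 ⊗ₜ ⟨a, ha⟩)) (paritySign j • (1 ⊗ₜ ⟨b, hb⟩)) =
      paritySign (i + j) • A.star p (1 ⊗ₜ ⟨a, ha⟩) (1 ⊗ₜ ⟨b, hb⟩) := by
    rw [LinearMap.map_smul_of_tower, LinearMap.map_smul_of_tower (A.star p), LinearMap.smul_apply,
      smul_smul, mul_comm, paritySign_add]
  apply A.inclH_injective
  rw [e', LinearMap.map_smul_of_tower, inclH_signGammaH, e, ProductSystem.zhuProd_apply, map_sum, Finset.smul_sum]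
  refine Finset.sum_congr rfl fun m _ => ?_
  rw [map_zsmul, A.signH_bracket hi hj, smul_comm]

lemma J_le_of_le {q p : ℕ} (h : q ≤ p) : A.J p ≤ A.J q := antitone_nat_of_succ_le A.J_succ_le h

lemma star_sub_star_mem {q p : ℕ} (h : q ≤ p) (x y : A.VGammaH) :
    A.star p x y - A.star q x y ∈ A.J q := by
  induction p, h using Nat.le_induction with
  | base => simp
  | succ p h ih =>
    have := add_mem (A.J_le_of_le h (A.star_succ_sub_mem p x y)) ih
    rwa [sub_add_sub_cancel] at this

/-! ### The maps between the Zhu algebras and their ℤ/2-grading. -/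

namespace Zhu

variable {A}

/-- The homomorphism `φ_{p,q}` between the Zhu algebras of levels `p ≥ q`. -/
def levelHom {q p : ℕ} (h : q ≤ p) (hp : A.IsZhuIdeal p) (hq : A.IsZhuIdeal q) :
    A.Zhu p hp →ₐ[ℂ[T;T⁻¹]] A.Zhu q hq :=
  AlgHom.ofLinearMap
    ((A.J p).liftQ (proj hq) fun _ hx =>
      (Submodule.Quotient.mk_eq_zero _).2 (A.J_le_of_le h hx) : A.Zhu p hp →ₗ[ℂ[T;T⁻¹]] A.Zhu q hq)
    rfl
    (fun x y => by
      obtain ⟨x, rfl⟩ := proj_surjective hp x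
      obtain ⟨y, rfl⟩ := proj_surjective hp y
      exact (proj_eq_proj hq).2 (A.star_sub_star_mem h x y))

lemma levelHom_proj {q p : ℕ} (h : q ≤ p) (hp : A.IsZhuIdeal p) (hq : A.IsZhuIdeal q)
    (v : A.VGammaH) : levelHom h hp hq (proj hp v) = proj hq v := rfl

lemma levelHom_surjective {q p : ℕ} (h : q ≤ p) (hp : A.IsZhuIdeal p) (hq : A.IsZhuIdeal q) :
    Function.Surjective (levelHom h hp hq) := fun x => by
  obtain ⟨v, rfl⟩ := proj_surjective hq x
  exact ⟨proj hp v, levelHom_proj h hp hq v⟩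

lemma levelHom_mem_parity {q p : ℕ} (h : q ≤ p) (hp : A.IsZhuIdeal p) (hq : A.IsZhuIdeal q)
    (i : ZMod 2) {x : A.Zhu p hp} (hx : x ∈ parity hp i) : levelHom h hp hq x ∈ parity hq i := by
  refine Submodule.span_induction (p := fun x _ => levelHom h hp hq x ∈ parity hq i) ?_ ?_ ?_ ?_ hx
  · rintro _ ⟨a, ha, rfl⟩
    rw [levelHom_proj]
    exact Submodule.subset_span ⟨a, ha, rfl⟩
  · rw [map_zero]
    exact zero_mem _
  · intro x y _ _ hx hy
    rw [map_add]
    exact add_mem hx hy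
  · intro r x _ hx
    rw [map_smul]
    exact Submodule.smul_mem _ r hx

lemma levelHom_self {p : ℕ} (hp : A.IsZhuIdeal p) (x : A.Zhu p hp) :
    levelHom le_rfl hp hp x = x := by
  obtain ⟨v, rfl⟩ := proj_surjective hp x
  exact levelHom_proj le_rfl hp hp v

lemma levelHom_levelHom {r q p : ℕ} (hrq : r ≤ q) (hqp : q ≤ p) (hp : A.IsZhuIdeal p)
    (hq : A.IsZhuIdeal q) (hr : A.IsZhuIdeal r) (x : A.Zhu p hp) :
    levelHom hrq hq hr (levelHom hqp hp hq x) = levelHom (hrq.trans hqp) hp hr x := by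
  obtain ⟨v, rfl⟩ := proj_surjective hp x
  rw [levelHom_proj, levelHom_proj, levelHom_proj]

variable {p : ℕ} (h : A.IsZhuIdeal p)

/-- The parity involution of the Zhu algebra. -/
def signMap : A.Zhu p h →ₗ[ℂ[T;T⁻¹]] A.Zhu p h :=
  (A.J p).liftQ (proj h ∘ₗ A.signGammaH) fun _ hx =>
    (Submodule.Quotient.mk_eq_zero _).2 (A.J_le_comap_signGammaH p hx)

lemma signMap_proj (v : A.VGammaH) : signMap h (proj h v) = proj h (A.signGammaH v) := rfl

lemma signMap_mul (x y : A.Zhu p h) : signMap h (x * y) = signMap h x * signMap h y := by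
  obtain ⟨x, rfl⟩ := proj_surjective h x
  obtain ⟨y, rfl⟩ := proj_surjective h y
  rw [proj_mul, signMap_proj, signMap_proj, signMap_proj, proj_mul, signGammaH_star]

/-- The sign `(-1)^i` as a Laurent polynomial. -/
def paritySignL (i : ZMod 2) : ℂ[T;T⁻¹] := LaurentPolynomial.C (paritySign i)

lemma signMap_of_mem {i : ZMod 2} {x : A.Zhu p h} (hx : x ∈ parity h i) :
    signMap h x = paritySignL i • x := by
  have : parity h i ≤ LinearMap.eqLocus (signMap h) (paritySignL i • LinearMap.id) := by
    refine Submodule.span_le.2 ?_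
    rintro _ ⟨a, ha, rfl⟩
    change signMap h (proj h (1 ⊗ₜ a)) = paritySignL i • proj h (1 ⊗ₜ a)
    rw [signMap_proj, A.signGammaH_one_tmul ha, ← map_smul, TensorProduct.smul_tmul',
      TensorProduct.smul_tmul', paritySignL, LaurentPolynomial.smul_eq_C_mul, smul_eq_mul]
  exact this hx

lemma iSup_parity : ⨆ i, parity h i = ⊤ := by
  rw [eq_top_iff]
  rintro x -
  obtain ⟨x, rfl⟩ := proj_surjective h x
  refine A.mem_of_homogeneous (S := (⨆ i, parity h i).comap (proj h)) ?_ x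
  intro i α Δ _ a ha _ hi
  exact Submodule.mem_iSup_of_mem i (Submodule.subset_span ⟨⟨a, ha⟩, hi, rfl⟩)

lemma eq_zero_of_add_self {x : A.Zhu p h} (hx : x + x = 0) : x = 0 := by
  have h2 : (LaurentPolynomial.C (2⁻¹ : ℂ) : ℂ[T;T⁻¹]) * 2 = 1 := by
    rw [← map_ofNat (LaurentPolynomial.C (R := ℂ)) 2, ← map_mul]
    norm_num
  rw [← one_smul ℂ[T;T⁻¹] x, ← h2, mul_smul, ofNat_smul_eq_nsmul, two_nsmul, hx, smul_zero]

lemma exists_parity_add (x : A.Zhu p h) (i : ZMod 2) :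
    ∃ y ∈ parity h i, ∃ z ∈ parity h (i + 1), x = y + z := by
  have hx : x ∈ ⨆ i, parity h i := by
    rw [iSup_parity]
    trivial
  have hle : ⨆ j, parity h j ≤ parity h i ⊔ parity h (i + 1) := by
    refine iSup_le fun j => ?_
    have : j = i ∨ j = i + 1 := by
      revert i j
      decide
    rcases this with rfl | rfl
    exacts [le_sup_left, le_sup_right]
  obtain ⟨y, hy, z, hz, rfl⟩ := Submodule.mem_sup.1 (hle hx)
  exact ⟨y, hy, z, hz, rfl⟩

lemma paritySignL_add_one (i : ZMod 2) : paritySignL (i + 1) = -paritySignL i := by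
  rw [paritySignL, paritySign_add, paritySignL]
  simp [paritySign, ZMod.val_one]

lemma paritySignL_mul_self (i : ZMod 2) : paritySignL i * paritySignL i = 1 := by
  rw [paritySignL, ← map_mul, paritySign, ← pow_add, ← two_mul, pow_mul]
  simp

lemma eq_zero_of_signMap {i : ZMod 2} {z : A.Zhu p h} (hz : z ∈ parity h (i + 1))
    (hs : signMap h z = paritySignL i • z) : z = 0 := by
  rw [signMap_of_mem h hz, paritySignL_add_one, neg_smul, neg_eq_iff_add_eq_zero, ← smul_add] at hs
  have := congrArg (fun w => paritySignL i • w) hs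
  simp only [smul_smul, paritySignL_mul_self, one_smul, smul_zero] at this
  exact eq_zero_of_add_self h this

/-- The parts, defined as spans of images, are the eigenspaces of the involution: a component of
opposite parity satisfies z + z = 0, and 2 is invertible. Stability under multiplication then
follows from the multiplicativity of the involution. -/
lemma mem_parity_iff {i : ZMod 2} {x : A.Zhu p h} :
    x ∈ parity h i ↔ signMap h x = paritySignL i • x := by
  refine ⟨signMap_of_mem h, fun hx => ?_⟩
  obtain ⟨y, hy, z, hz, rfl⟩ := exists_parity_add h x i
  rw [map_add, signMap_of_mem h hy, smul_add, add_right_inj] at hx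
  rw [eq_zero_of_signMap h hz hx, add_zero]
  exact hy

lemma parity_gradedMonoid : SetLike.GradedMonoid (parity h) where
  one_mem := by
    rw [← proj_vacH]
    exact Submodule.subset_span ⟨⟨A.vac, A.vac_mem_VGamma⟩, A.vac_even, rfl⟩
  mul_mem := by
    intro i j x y hx hy
    rw [mem_parity_iff, signMap_mul, signMap_of_mem h hx, signMap_of_mem h hy,
      smul_mul_smul_comm, paritySignL, paritySignL, paritySignL, paritySign_add, map_mul]

lemma parity_isInternal : DirectSum.IsInternal (parity h) := by
  refine DirectSum.isInternal_submodule_of_iSupIndep_of_iSup_eq_top ?_ (iSup_parity h)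
  intro i
  have hle : ⨆ j, ⨆ (_ : j ≠ i), parity h j ≤ parity h (i + 1) := by
    refine iSup₂_le fun j hj => ?_
    have : j = i + 1 := by
      revert i j
      decide
    rw [this]
  refine Disjoint.mono_right hle (Submodule.disjoint_def.2 fun x hx hx' => ?_)
  exact eq_zero_of_signMap h hx' (signMap_of_mem h hx)

end Zhu

end GradedVertexAlgebra

end

theorem mainTheorem5 (Γ : AddSubgroup ℝ) (hΓ : (1 : ℝ) ∈ Γ) {V : Type*} [AddCommGroup V] [Module ℂ V]
    (A : GradedVertexAlgebra Γ V) :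
    (∀ p : ℕ, 1 ≤ p → A.J p ≤ A.J (p - 1)) ∧
    (∀ p : ℕ, 1 ≤ p → ∀ x y : A.VGammaH, A.star p x y - A.star (p - 1) x y ∈ A.J (p - 1)) ∧
    ∃ h : ∀ p : ℕ, A.IsZhuIdeal p,
      (∀ p : ℕ, SetLike.GradedMonoid (GradedVertexAlgebra.Zhu.parity (h p)) ∧
        DirectSum.IsInternal (GradedVertexAlgebra.Zhu.parity (h p))) ∧
      ∃ φ : ∀ ⦃q p : ℕ⦄, q ≤ p → A.Zhu p (h p) →ₐ[LaurentPolynomial ℂ] A.Zhu q (h q),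
        (∀ (q p : ℕ) (hqp : q ≤ p),
          (∀ v : A.VGammaH, φ hqp (GradedVertexAlgebra.Zhu.proj (h p) v) =
            GradedVertexAlgebra.Zhu.proj (h q) v) ∧
          Function.Surjective (φ hqp) ∧
          ∀ (i : ZMod 2), ∀ x ∈ GradedVertexAlgebra.Zhu.parity (h p) i,
            φ hqp x ∈ GradedVertexAlgebra.Zhu.parity (h q) i) ∧
        InverseSystem (F := fun p => A.Zhu p (h p)) (fun _ _ hqp => φ hqp) := by
  refine ⟨fun p _ => A.J_le_of_le (Nat.sub_le p 1),
    fun p _ x y => A.star_sub_star_mem (Nat.sub_le p 1) x y, A.isZhuIdeal,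
    fun p => ⟨GradedVertexAlgebra.Zhu.parity_gradedMonoid _,
      GradedVertexAlgebra.Zhu.parity_isInternal _⟩,
    fun q p hqp => GradedVertexAlgebra.Zhu.levelHom hqp (A.isZhuIdeal p) (A.isZhuIdeal q),
    fun q p hqp => ⟨GradedVertexAlgebra.Zhu.levelHom_proj _ _ _,
      GradedVertexAlgebra.Zhu.levelHom_surjective _ _ _,
      fun i x hx => GradedVertexAlgebra.Zhu.levelHom_mem_parity _ _ _ i hx⟩,
    ⟨fun {p} x => GradedVertexAlgebra.Zhu.levelHom_self (A.isZhuIdeal p) x,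
      fun {k j i} hkj hji x => GradedVertexAlgebra.Zhu.levelHom_levelHom hkj hji
        (A.isZhuIdeal i) (A.isZhuIdeal j) (A.isZhuIdeal k) x⟩⟩
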